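/- Let $N\ge 1$, let $\Omega\subset\mathbb{R}^N$ be a bounded open set with $C^\infty$ boundary, and let $D_1,D_2\subset\Omega$ be disjoint open sets with Lipschitz boundary (locally a strict epigraph of a Lipschitz function) such that $\overline{\Omega}=\overline{D_1\cup D_2}$, with interface $\Gamma=\partial D_1\cap\Omega=\partial D_2\cap\Omega$. Let $p>2$ and let $$\mathcal{W}(\Omega)=\Big\{v\in W_0^{1,2}(\Omega):\ \int_{D_2}|\nabla v|^p\,dx<\infty\Big\},\qquad [v]_{\mathcal{W}(\Omega)}=\|\nabla v\|_{L^2(D_1)}+\|\nabla v\|_{L^p(D_2)},$$ where $W_0^{1,2}(\Omega)$ is the closure of $C_c^\infty(\Omega)$ in $W^{1,2}(\Omega)$ and functions equal a.e. are identified. For $f\in L^2(\Omega)$ consider the problem $$-\Delta u=f\ \text{in } D_1,\qquad -\Delta_p u=f\ \text{in } D_2,\qquad \frac{\partial u}{\partial\eta}=|\nabla u|^{p-2}\frac{\partial u}{\partial \eta},\ \ u|_{D_1}=u|_{D_2}\ \text{on }\Gamma,\qquad u=0\ \text{on }\partial\Omega, \tag{P}$$ with $\eta$ the unit normal to $\Gamma$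 pointing out of $D_1$. A weak solution of (P) is a function $u\in\mathcal{W}(\Omega)$ such that $$\int_{D_1}\nabla u\cdot\nabla\varphi\,dx+\int_{D_2}|\nabla u|^{p-2}\nabla u\cdot\nabla\varphi\,dx=\int_\Omega f\varphi\,dx\qquad\text{for all }\varphi\in C_c^\infty(\Omega);$$ a weak subsolution (respectively supersolution) is a function $u\in\mathcal{W}(\Omega)$ satisfying the same relation with $\le$ (respectively $\ge$) in place of $=$, for all $\varphi\in C_c^\infty(\Omega)$ with $\varphi\ge 0$. Then, for every $f\in L^2(\Omega)$: 1. Problem (P) has a unique weak solution in $\mathcal{W}(\Omega)$. 2. The functional $$I(u)=\int_{D_1}\frac{|\nabla u|^2}{2}\,dx+\int_{D_2}\frac{|\nabla u|^p}{p}\,dx-\int_\Omega f\,u\,dx$$ is strictly convex on $\mathcal{W}(\Omega)$ and coercive, that is, $I(u)\to\infty$ as $[u]_{\mathcal{W}(\Omega)}\to\infty$; and a function $u\in\mathcal{W}(\Omega)$ is a weak solution of (P) if and only if $I(u)=\min_{\mathcal{W}(\Omega)}I$. 3. If $u_1,u_2\in\mathcal{W}(\Omega)$ are respectively a weak subsolution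 and a weak supersolution of (P), then $u_1\le u_2$ a.e. in $\Omega$. -/

import Mathlib

open MeasureTheory Filter Topology Set
open scoped ContDiff RealInnerProductSpace Gradient

noncomputable section

namespace Transmission

/-- Euclidean space `ℝᴺ`. -/
abbrev Rn (N : ℕ) := EuclideanSpace ℝ (Fin N)

/-- Near each of its boundary points, `D` is the strict epigraph, in some direction `ν`, of a
Lipschitz function `g` of the component of `x` orthogonal to `ν`. -/
def HasLipschitzBoundary {N : ℕ} (D : Set (Rn N)) : Prop :=
  ∀ x₀ ∈ frontier D, ∃ ν : Rn N, ‖ν‖ = 1 ∧ ∃ g : Rn N → ℝ, (∃ K, LipschitzWith K g) ∧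
    ∃ U ∈ 𝓝 x₀, ∀ x ∈ U, x ∈ D ↔ g (x - ⟪ν, x⟫ • ν) < ⟪ν, x⟫

/-- Near each of its boundary points, `D` is the strict epigraph, in some direction `ν`, of a
`C^∞` function `g` of the component of `x` orthogonal to `ν`. -/
def HasSmoothBoundary {N : ℕ} (D : Set (Rn N)) : Prop :=
  ∀ x₀ ∈ frontier D, ∃ ν : Rn N, ‖ν‖ = 1 ∧ ∃ g : Rn N → ℝ, ContDiff ℝ ∞ g ∧
    ∃ U ∈ 𝓝 x₀, ∀ x ∈ U, x ∈ D ↔ g (x - ⟪ν, x⟫ • ν) < ⟪ν, x⟫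

/-- A bounded open set `Ω` with smooth boundary, split into two disjoint open subsets `D₁`, `D₂`
with Lipschitz boundary, with common interface `Γ = ∂D₁ ∩ Ω = ∂D₂ ∩ Ω`. -/
structure IsSplitting {N : ℕ} (Ω D₁ D₂ : Set (Rn N)) : Prop where
  isOpen : IsOpen Ω
  isBounded : Bornology.IsBounded Ω
  smooth : HasSmoothBoundary Ω
  isOpen₁ : IsOpen D₁
  isOpen₂ : IsOpen D₂
  subset₁ : D₁ ⊆ Ω
  subset₂ : D₂ ⊆ Ω
  lipschitz₁ : HasLipschitzBoundary D₁
  lipschitz₂ : HasLipschitzBoundary D₂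
  disjoint : D₁ ∩ D₂ = ∅
  closure_eq : closure Ω = closure (D₁ ∪ D₂)
  interface_eq : frontier D₁ ∩ Ω = frontier D₂ ∩ Ω

/-- `φ ∈ C_c^∞(Ω)`. -/
structure IsTest {N : ℕ} (Ω : Set (Rn N)) (φ : Rn N → ℝ) : Prop where
  contDiff : ContDiff ℝ ∞ φ
  hasCompactSupport : HasCompactSupport φ
  tsupport_subset : tsupport φ ⊆ Ω

/-- `G` is the weak gradient of `u` in `Ω`. -/
structure HasWeakGradient {N : ℕ} (Ω : Set (Rn N)) (u : Rn N → ℝ) (G : Rn N → Rn N) : Prop where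
  locallyIntegrableOn : LocallyIntegrableOn u Ω
  locallyIntegrableOn_grad : LocallyIntegrableOn G Ω
  integral_eq : ∀ φ, IsTest Ω φ → ∫ x in Ω, u x • ∇ φ x = - ∫ x in Ω, φ x • G x

open Classical in
/-- The weak gradient of `u` in `Ω` (unique up to null sets), where it exists. -/
def weakGrad {N : ℕ} (Ω : Set (Rn N)) (u : Rn N → ℝ) : Rn N → Rn N :=
  if h : ∃ G, HasWeakGradient Ω u G then h.choose else 0

/-- `u ∈ W₀^{1,2}(Ω)` with weak gradient `G`: `u` and `G` are in `L²(Ω)`, and `u` is the limit in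
the norm of `W^{1,2}(Ω)` of a sequence in `C_c^∞(Ω)`. -/
structure IsW012 {N : ℕ} (Ω : Set (Rn N)) (u : Rn N → ℝ) (G : Rn N → Rn N) : Prop where
  hasWeakGradient : HasWeakGradient Ω u G
  memLp : MemLp u 2 (volume.restrict Ω)
  memLp_grad : MemLp G 2 (volume.restrict Ω)
  exists_seq : ∃ φ : ℕ → Rn N → ℝ, (∀ n, IsTest Ω (φ n)) ∧
    Tendsto (fun n => eLpNorm (fun x => φ n x - u x) 2 (volume.restrict Ω)) atTop (𝓝 0) ∧
    Tendsto (fun n => eLpNorm (fun x => ∇ (φ n) x - G x) 2 (volume.restrict Ω)) atTop (𝓝 0)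

/-- `u ∈ 𝒲(Ω)`: `u ∈ W₀^{1,2}(Ω)` and `∫_{D₂} |∇u|^p < ∞`. -/
def MemW {N : ℕ} (Ω D₂ : Set (Rn N)) (p : ℝ) (u : Rn N → ℝ) : Prop :=
  ∃ G, IsW012 Ω u G ∧ MemLp G (ENNReal.ofReal p) (volume.restrict D₂)

section Helpers

variable {N : ℕ} {Ω D₂ : Set (Rn N)} {p : ℝ} {u v φ : Rn N → ℝ} {G H : Rn N → Rn N}

theorem IsTest.zero : IsTest Ω (fun _ => 0) where
  contDiff := contDiff_const
  hasCompactSupport := HasCompactSupport.zero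
  tsupport_subset := by
    have : tsupport (fun _ : Rn N => (0 : ℝ)) = ∅ := tsupport_eq_empty_iff.2 rfl
    simp [this]

theorem IsTest.add (hu : IsTest Ω u) (hv : IsTest Ω v) : IsTest Ω (fun x => u x + v x) where
  contDiff := hu.contDiff.add hv.contDiff
  hasCompactSupport := hu.hasCompactSupport.add hv.hasCompactSupport
  tsupport_subset :=
    (tsupport_add u v).trans (union_subset hu.tsupport_subset hv.tsupport_subset)

theorem IsTest.const_mul (c : ℝ) (hu : IsTest Ω u) : IsTest Ω (fun x => c * u x) where
  contDiff := contDiff_const.mul hu.contDiff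
  hasCompactSupport := hu.hasCompactSupport.mul_left
  tsupport_subset := (tsupport_mul_subset_right (f := fun _ => c) (g := u)).trans hu.tsupport_subset

theorem IsTest.differentiable (hu : IsTest Ω u) : Differentiable ℝ u :=
  hu.contDiff.differentiable (by simp)

theorem IsTest.continuous_gradient (hu : IsTest Ω u) : Continuous (fun x => ∇ u x) :=
  (InnerProductSpace.toDual ℝ (Rn N)).symm.continuous.comp (hu.contDiff.continuous_fderiv (by simp))

theorem IsTest.gradient_eq_zero {x : Rn N} (hx : x ∉ tsupport u) : ∇ u x = 0 := by
  have : fderiv ℝ u x = 0 := by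
    by_contra h
    exact hx (support_fderiv_subset ℝ h)
  simp [gradient, this]

theorem gradient_add_apply (hu : Differentiable ℝ u) (hv : Differentiable ℝ v) (x : Rn N) :
    ∇ (fun y => u y + v y) x = ∇ u x + ∇ v x := by
  simp [gradient, fderiv_fun_add (hu x) (hv x)]

theorem gradient_const_mul_apply (c : ℝ) (hu : Differentiable ℝ u) (x : Rn N) :
    ∇ (fun y => c * u y) x = c • ∇ u x := by
  simp [gradient, fderiv_const_mul (hu x)]

theorem IsTest.integrable_smul_gradient (hφ : IsTest Ω φ) (hu : LocallyIntegrableOn u Ω) :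
    Integrable (fun x => u x • ∇ φ x) (volume.restrict Ω) := by
  have h1 : IntegrableOn u (tsupport φ) :=
    hu.integrableOn_compact_subset hφ.tsupport_subset hφ.hasCompactSupport
  have h2 : IntegrableOn (fun x => u x • ∇ φ x) (tsupport φ) :=
    h1.smul_continuousOn hφ.continuous_gradient.continuousOn hφ.hasCompactSupport
  have h3 : Integrable (fun x => u x • ∇ φ x) volume :=
    (integrableOn_iff_integrable_of_support_subset (fun x hx => by
      by_contra h
      exact hx (by simp [IsTest.gradient_eq_zero h]))).1 h2
  exact h3.integrableOn

theorem IsTest.integrable_smul (hφ : IsTest Ω φ) (hG : LocallyIntegrableOn G Ω) :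
    Integrable (fun x => φ x • G x) (volume.restrict Ω) := by
  have h1 : IntegrableOn G (tsupport φ) :=
    hG.integrableOn_compact_subset hφ.tsupport_subset hφ.hasCompactSupport
  have h2 : IntegrableOn (fun x => φ x • G x) (tsupport φ) :=
    h1.continuousOn_smul hφ.contDiff.continuous.continuousOn hφ.hasCompactSupport
  have h3 : Integrable (fun x => φ x • G x) volume :=
    (integrableOn_iff_integrable_of_support_subset (fun x hx => by
      by_contra h
      exact hx (by simp [image_eq_zero_of_notMem_tsupport h]))).1 h2
  exact h3.integrableOn

theorem HasWeakGradient.zero : HasWeakGradient Ω (fun _ => 0) (fun _ => 0) where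
  locallyIntegrableOn := locallyIntegrableOn_zero
  locallyIntegrableOn_grad := locallyIntegrableOn_zero
  integral_eq := by simp

theorem HasWeakGradient.add (hu : HasWeakGradient Ω u G) (hv : HasWeakGradient Ω v H) :
    HasWeakGradient Ω (fun x => u x + v x) (fun x => G x + H x) where
  locallyIntegrableOn := hu.1.add hv.1
  locallyIntegrableOn_grad := hu.2.add hv.2
  integral_eq φ hφ := by
    simp only [add_smul, smul_add]
    rw [integral_add (hφ.integrable_smul_gradient hu.1) (hφ.integrable_smul_gradient hv.1),
      integral_add (hφ.integrable_smul hu.2) (hφ.integrable_smul hv.2), hu.3 φ hφ, hv.3 φ hφ]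
    abel

theorem HasWeakGradient.const_mul (c : ℝ) (hu : HasWeakGradient Ω u G) :
    HasWeakGradient Ω (fun x => c * u x) (fun x => c • G x) where
  locallyIntegrableOn := hu.1.smul c
  locallyIntegrableOn_grad := hu.2.smul c
  integral_eq φ hφ := by
    simp only [mul_smul, smul_comm _ c (_ : Rn N)]
    rw [integral_smul, integral_smul, hu.3 φ hφ, smul_neg]

theorem HasWeakGradient.congr (hu : HasWeakGradient Ω u G) (h : u =ᵐ[volume.restrict Ω] v) :
    HasWeakGradient Ω v G where
  locallyIntegrableOn x hx := by
    obtain ⟨s, hs, hi⟩ := hu.1 x hx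
    refine ⟨s ∩ Ω, inter_mem hs self_mem_nhdsWithin, ?_⟩
    exact (hi.mono_set inter_subset_left).congr_fun_ae
      (ae_restrict_of_ae_restrict_of_subset inter_subset_right h)
  locallyIntegrableOn_grad := hu.2
  integral_eq φ hφ := by
    rw [← hu.3 φ hφ]
    refine integral_congr_ae ?_
    filter_upwards [h] with x hx
    rw [hx]

theorem IsW012.zero : IsW012 Ω (fun _ => 0) (fun _ => 0) where
  hasWeakGradient := HasWeakGradient.zero
  memLp := MemLp.zero
  memLp_grad := MemLp.zero
  exists_seq := by
    refine ⟨fun _ _ => 0, fun _ => IsTest.zero, ?_, ?_⟩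
    · simp
    · have : ∀ x : Rn N, ∇ (fun _ : Rn N => (0 : ℝ)) x = 0 := by
        intro x; simp [gradient]
      simp [this]

theorem IsW012.add (hu : IsW012 Ω u G) (hv : IsW012 Ω v H) :
    IsW012 Ω (fun x => u x + v x) (fun x => G x + H x) where
  hasWeakGradient := hu.1.add hv.1
  memLp := hu.2.add hv.2
  memLp_grad := hu.3.add hv.3
  exists_seq := by
    obtain ⟨a, ha, ha1, ha2⟩ := hu.4
    obtain ⟨b, hb, hb1, hb2⟩ := hv.4
    refine ⟨fun n x => a n x + b n x, fun n => (ha n).add (hb n), ?_, ?_⟩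
    · refine tendsto_of_tendsto_of_tendsto_of_le_of_le tendsto_const_nhds
        (by simpa using ha1.add hb1) (fun _ => zero_le) (fun n => ?_)
      have e : (fun x => a n x + b n x - (u x + v x))
          = (fun x => a n x - u x) + (fun x => b n x - v x) := by
        ext x; simp only [Pi.add_apply]; ring
      rw [e]
      exact eLpNorm_add_le
        ((ha n).contDiff.continuous.aestronglyMeasurable.sub hu.2.1)
        ((hb n).contDiff.continuous.aestronglyMeasurable.sub hv.2.1) (by norm_num)
    · refine tendsto_of_tendsto_of_tendsto_of_le_of_le tendsto_const_nhds
        (by simpa using ha2.add hb2) (fun _ => zero_le) (fun n => ?_)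
      have e : (fun x => ∇ (fun y => a n y + b n y) x - (G x + H x))
          = (fun x => ∇ (a n) x - G x) + (fun x => ∇ (b n) x - H x) := by
        ext1 x
        rw [gradient_add_apply (ha n).differentiable (hb n).differentiable]
        simp only [Pi.add_apply]; abel
      rw [e]
      exact eLpNorm_add_le
        ((ha n).continuous_gradient.aestronglyMeasurable.sub hu.3.1)
        ((hb n).continuous_gradient.aestronglyMeasurable.sub hv.3.1) (by norm_num)

theorem IsW012.const_mul (c : ℝ) (hu : IsW012 Ω u G) :
    IsW012 Ω (fun x => c * u x) (fun x => c • G x) where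
  hasWeakGradient := hu.1.const_mul c
  memLp := hu.2.const_mul c
  memLp_grad := hu.3.const_smul c
  exists_seq := by
    obtain ⟨a, ha, ha1, ha2⟩ := hu.4
    refine ⟨fun n x => c * a n x, fun n => (ha n).const_mul c, ?_, ?_⟩
    · have e : ∀ n, (fun x => c * a n x - c * u x) = c • (fun x => a n x - u x) := by
        intro n; ext x; simp [mul_sub]
      simp only [e, eLpNorm_const_smul]
      simpa using ENNReal.Tendsto.const_mul ha1 (Or.inr (by simp))
    · have e : ∀ n, (fun x => ∇ (fun y => c * a n y) x - c • G x)
          = c • (fun x => ∇ (a n) x - G x) := by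
        intro n; ext1 x
        rw [gradient_const_mul_apply c (ha n).differentiable]
        simp [smul_sub]
      simp only [e, eLpNorm_const_smul]
      simpa using ENNReal.Tendsto.const_mul ha2 (Or.inr (by simp))

theorem IsW012.congr (hu : IsW012 Ω u G) (h : u =ᵐ[volume.restrict Ω] v) : IsW012 Ω v G where
  hasWeakGradient := hu.1.congr h
  memLp := (memLp_congr_ae h).1 hu.2
  memLp_grad := hu.3
  exists_seq := by
    obtain ⟨a, ha, ha1, ha2⟩ := hu.4
    refine ⟨a, ha, ha1.congr (fun n => eLpNorm_congr_ae ?_), ha2⟩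
    filter_upwards [h] with x hx
    rw [hx]

theorem MemW.congr (hu : MemW Ω D₂ p u) (h : u =ᵐ[volume.restrict Ω] v) : MemW Ω D₂ p v := by
  obtain ⟨G, h1, h2⟩ := hu
  exact ⟨G, h1.congr h, h2⟩

end Helpers

/-- The space `𝒲(Ω)`, as a space of classes of functions modulo equality a.e. in `Ω`. -/
def spaceW {N : ℕ} (Ω D₂ : Set (Rn N)) (p : ℝ) : Submodule ℝ (Lp ℝ 2 (volume.restrict Ω)) where
  carrier := {u | MemW Ω D₂ p u}
  zero_mem' :=
    MemW.congr ⟨_, IsW012.zero, MemLp.zero⟩ (Lp.coeFn_zero ℝ 2 (volume.restrict Ω)).symm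
  add_mem' := by
    rintro u v ⟨G, h1, h2⟩ ⟨H, h3, h4⟩
    exact MemW.congr ⟨_, h1.add h3, h2.add h4⟩ (Lp.coeFn_add u v).symm
  smul_mem' := by
    rintro c u ⟨G, h1, h2⟩
    exact MemW.congr ⟨_, h1.const_mul c, h2.const_smul c⟩ (Lp.coeFn_smul c u).symm

/-- The norm `[u] = ‖∇u‖_{L²(D₁)} + ‖∇u‖_{Lᵖ(D₂)}` of `𝒲(Ω)`. -/
def normW {N : ℕ} (Ω D₁ D₂ : Set (Rn N)) (p : ℝ) (u : Rn N → ℝ) : ℝ :=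
  (eLpNorm (weakGrad Ω u) 2 (volume.restrict D₁)).toReal
    + (eLpNorm (weakGrad Ω u) (ENNReal.ofReal p) (volume.restrict D₂)).toReal

/-- `∫_{D₁} ∇u·∇φ + ∫_{D₂} |∇u|^{p-2} ∇u·∇φ`. -/
def weakForm {N : ℕ} (Ω D₁ D₂ : Set (Rn N)) (p : ℝ) (u φ : Rn N → ℝ) : ℝ :=
  (∫ x in D₁, ⟪weakGrad Ω u x, ∇ φ x⟫)
    + ∫ x in D₂, ‖weakGrad Ω u x‖ ^ (p - 2) * ⟪weakGrad Ω u x, ∇ φ x⟫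

/-- `u ∈ 𝒲(Ω)` is a weak solution of `-Δu = f` in `D₁`, `-Δ_p u = f` in `D₂`, with
`u|_{D₁} = u|_{D₂}` and `∂u/∂η = |∇u|^{p-2} ∂u/∂η` on the interface, and `u = 0` on `∂Ω`. -/
def IsWeakSolution {N : ℕ} {Ω : Set (Rn N)} (D₁ : Set (Rn N)) {D₂ : Set (Rn N)} {p : ℝ}
    (f : Rn N → ℝ) (u : spaceW Ω D₂ p) : Prop :=
  ∀ φ, IsTest Ω φ → weakForm Ω D₁ D₂ p u.1 φ = ∫ x in Ω, f x * φ x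

/-- Weak subsolutions of the same problem. -/
def IsWeakSubsolution {N : ℕ} {Ω : Set (Rn N)} (D₁ : Set (Rn N)) {D₂ : Set (Rn N)} {p : ℝ}
    (f : Rn N → ℝ) (u : spaceW Ω D₂ p) : Prop :=
  ∀ φ, IsTest Ω φ → (∀ x, 0 ≤ φ x) → weakForm Ω D₁ D₂ p u.1 φ ≤ ∫ x in Ω, f x * φ x

/-- Weak supersolutions of the same problem. -/
def IsWeakSupersolution {N : ℕ} {Ω : Set (Rn N)} (D₁ : Set (Rn N)) {D₂ : Set (Rn N)} {p : ℝ}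
    (f : Rn N → ℝ) (u : spaceW Ω D₂ p) : Prop :=
  ∀ φ, IsTest Ω φ → (∀ x, 0 ≤ φ x) → ∫ x in Ω, f x * φ x ≤ weakForm Ω D₁ D₂ p u.1 φ

/-- The functional `I(u) = ∫_{D₁} |∇u|²/2 + ∫_{D₂} |∇u|^p/p - ∫_Ω f u` on `𝒲(Ω)`. -/
def energy {N : ℕ} {Ω : Set (Rn N)} (D₁ : Set (Rn N)) {D₂ : Set (Rn N)} {p : ℝ}
    (f : Rn N → ℝ) (u : spaceW Ω D₂ p) : ℝ :=
  (∫ x in D₁, ‖weakGrad Ω u.1 x‖ ^ 2 / 2) + (∫ x in D₂, ‖weakGrad Ω u.1 x‖ ^ p / p)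
    - ∫ x in Ω, f x * u.1 x

end Transmission

end

/-! The problem is the Euler–Lagrange equation of `energy`, and everything follows from one
pointwise inequality, `norm_rpow_uniformly_convex`: for `s ≥ 2` the function `‖·‖ ^ s / s` lies
above its tangent by at least a multiple of `‖b - a‖ ^ s`. With `s = 2` on `D₁` and `s = p` on `D₂`
it integrates to a tangent inequality for the energy with a remainder controlling the gradient
difference (`pairEnergy_uniformly_convex`). Together with the Poincaré inequality this gives strict
convexity and uniqueness. It also makes minimizing sequences Cauchy in the strong topology, so that
a minimizer exists by completeness, without weak compactness. Comparing two tangent inequalities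
gives strong monotonicity of the operator, and testing with `(u₁ - u₂)⁺` then yields the comparison
principle.

The delicate point is that the equation is tested only with `C_c^∞(Ω)`, whereas the arguments need
test functions in all of `𝒲(Ω)`. Hence `IsSplitting.isTestGradLimit`: smooth compactly supported
functions are dense, nonnegative ones among nonnegative elements. Ordinary mollification fails near
the interface, because it carries the gradient from `D₁`, where it is merely square integrable, into
`D₂`, where `p`-integrability is required. The remedy is a kernel supported in a cone of directions
`z` with `D₁ + z ⊆ D₁` and `closure Ω + z ⊆ Ω` locally: values in `D₂` then never come from `D₁`,
and supports are pushed inside `Ω`. A common cone exists even where the interface reaches `∂Ω`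
(`IsSplitting.exists_coneAt`): there `Ω` has a tangent half-space, and an open cone contained in `D₁
⊆ Ω` must point strictly into it. A partition by cutoffs glues the local approximations; it requires
bounded functions, obtained by a smooth truncation. -/

noncomputable section

namespace Transmission

/-! ### Pointwise convexity inequalities for powers of a norm. -/

section Pointwise

variable {E : Type*} [NormedAddCommGroup E] [InnerProductSpace ℝ E] {s : ℝ}

theorem rpow_sub_two_mul_self_mul {s x : ℝ} (hs : 2 ≤ s) (hx : 0 ≤ x) :
    x ^ (s - 2) * (x * x) = x ^ s := by
  rcases hx.eq_or_lt with rfl | hx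
  · rw [Real.zero_rpow (by linarith : s ≠ 0)]; simp
  · rw [← sq, ← Real.rpow_natCast, ← Real.rpow_add hx]; norm_num

theorem rpow_sub_two_mul_mul_le {s x y : ℝ} (hs : 2 ≤ s) (hx : 0 ≤ x) (hy : 0 ≤ y) :
    x ^ (s - 2) * (x * y) ≤ (1 - 1 / s) * x ^ s + y ^ s / s := by
  have h1 : x ^ (s - 2) * (x * y) = y * x ^ (s - 1) := by
    rcases hx.eq_or_lt with rfl | hx
    · rw [Real.zero_rpow (by linarith : s - 1 ≠ 0)]; simp
    · rw [← mul_assoc, ← Real.rpow_add_one hx.ne', mul_comm]; congr 2; ring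
  have hc : s.HolderConjugate (s / (s - 1)) := Real.HolderConjugate.conjExponent (by linarith)
  have h2 := Real.young_inequality_of_nonneg hy (Real.rpow_nonneg hx (s - 1)) hc
  have h3 : (x ^ (s - 1)) ^ (s / (s - 1)) = x ^ s := by
    rw [← Real.rpow_mul hx]; congr 1
    field_simp [show s - 1 ≠ 0 by linarith]
  rw [h1]
  rw [h3] at h2
  have h4 : x ^ s / (s / (s - 1)) = (1 - 1 / s) * x ^ s := by
    have : s ≠ 0 := by linarith
    have : s - 1 ≠ 0 := by linarith
    field_simp
  linarith

/-- Cauchy–Schwarz reduces the inequality to Young's inequality for `‖a‖` and `‖b‖`. -/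
theorem norm_rpow_tangent_le (hs : 2 ≤ s) (a b : E) :
    ‖a‖ ^ s / s + ‖a‖ ^ (s - 2) * ⟪a, b - a⟫ ≤ ‖b‖ ^ s / s := by
  have h1 := rpow_sub_two_mul_mul_le hs (norm_nonneg a) (norm_nonneg b)
  have h2 := rpow_sub_two_mul_self_mul hs (norm_nonneg a)
  have h3 : ⟪a, b - a⟫ ≤ ‖a‖ * ‖b‖ - ‖a‖ * ‖a‖ := by
    rw [inner_sub_right, real_inner_self_eq_norm_mul_norm]
    linarith [real_inner_le_norm a b]
  have h4 := mul_le_mul_of_nonneg_left h3 (Real.rpow_nonneg (norm_nonneg a) (s - 2))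
  rw [mul_sub, h2] at h4
  have h5 : (1 - 1 / s) * ‖a‖ ^ s = ‖a‖ ^ s - ‖a‖ ^ s / s := by ring
  linarith

/-- The parallelogram law settles the squares. Since `s / 2 ≥ 1`, the power `t ^ (s / 2)` is
superadditive, which handles the left side, and convex, which handles the right side. -/
theorem norm_rpow_clarkson (hs : 2 ≤ s) (a b : E) :
    ‖(1 / 2 : ℝ) • (a + b)‖ ^ s + ‖(1 / 2 : ℝ) • (b - a)‖ ^ s ≤ (‖a‖ ^ s + ‖b‖ ^ s) / 2 := by
  have hpow : ∀ x : ℝ, 0 ≤ x → x ^ s = (x ^ 2) ^ (s / 2) := fun x hx => by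
    rw [← Real.rpow_natCast, ← Real.rpow_mul hx]; congr 1; push_cast; ring
  have h0 : ‖(1 / 2 : ℝ) • (a + b)‖ ^ 2 + ‖(1 / 2 : ℝ) • (b - a)‖ ^ 2
      = 1 / 2 * ‖a‖ ^ 2 + 1 / 2 * ‖b‖ ^ 2 := by
    rw [norm_smul, norm_smul, mul_pow, mul_pow, norm_add_sq_real, norm_sub_sq_real,
      real_inner_comm]
    norm_num; ring
  rw [hpow _ (norm_nonneg _), hpow _ (norm_nonneg ((1 / 2 : ℝ) • (b - a))),
    hpow _ (norm_nonneg a), hpow _ (norm_nonneg b)]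
  calc _ ≤ (‖(1 / 2 : ℝ) • (a + b)‖ ^ 2 + ‖(1 / 2 : ℝ) • (b - a)‖ ^ 2) ^ (s / 2) :=
        Real.add_rpow_le_rpow_add (by positivity) (by positivity) (by linarith)
    _ = (1 / 2 * ‖a‖ ^ 2 + 1 / 2 * ‖b‖ ^ 2) ^ (s / 2) := by rw [h0]
    _ ≤ 1 / 2 * (‖a‖ ^ 2) ^ (s / 2) + 1 / 2 * (‖b‖ ^ 2) ^ (s / 2) :=
        by
        have := Real.rpow_arith_mean_le_arith_mean_rpow Finset.univ ![1 / 2, 1 / 2]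
          ![‖a‖ ^ 2, ‖b‖ ^ 2] (by simp [Fin.forall_fin_two]) (by simp; norm_num)
          (by simp [Fin.forall_fin_two]) (p := s / 2) (by linarith)
        simpa using this
    _ = _ := by ring

/-- The modulus of uniform convexity of `‖·‖ ^ s / s`. -/
def convexityConst (s : ℝ) : ℝ := 2 * (1 / 2) ^ s / s

theorem convexityConst_pos (hs : 2 ≤ s) : 0 < convexityConst s := by
  unfold convexityConst
  have : 0 < s := by linarith
  positivity

/-- The tangent inequality at `a` is applied to the midpoint of `a` and `b`, where it sees half of
the linear term. Clarkson's inequality bounds the midpoint and contributes the remainder; doubling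
gives the constant. -/
theorem norm_rpow_uniformly_convex (hs : 2 ≤ s) (a b : E) :
    ‖a‖ ^ s / s + ‖a‖ ^ (s - 2) * ⟪a, b - a⟫ + convexityConst s * ‖b - a‖ ^ s ≤ ‖b‖ ^ s / s := by
  have h1 := norm_rpow_clarkson hs a b
  have h2 := norm_rpow_tangent_le hs a ((1 / 2 : ℝ) • (a + b))
  have h3 : (1 / 2 : ℝ) • (a + b) - a = (1 / 2 : ℝ) • (b - a) := by module
  have h4 : ‖(1 / 2 : ℝ) • (b - a)‖ ^ s = (1 / 2) ^ s * ‖b - a‖ ^ s := by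
    rw [norm_smul, Real.mul_rpow (norm_nonneg _) (norm_nonneg _)]; norm_num
  rw [h3, inner_smul_right] at h2
  rw [h4] at h1
  have hs0 : 0 < s := by linarith
  have h5 := div_le_div_of_nonneg_right h1 hs0.le
  unfold convexityConst
  have e1 : (‖(1 / 2 : ℝ) • (a + b)‖ ^ s + (1 / 2) ^ s * ‖b - a‖ ^ s) / s
    = ‖(1 / 2 : ℝ) • (a + b)‖ ^ s / s + (2 * (1 / 2) ^ s / s * ‖b - a‖ ^ s) / 2 := by ring
  have e2 : (‖a‖ ^ s + ‖b‖ ^ s) / 2 / s = (‖a‖ ^ s / s + ‖b‖ ^ s / s) / 2 := by ring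
  rw [e1, e2] at h5
  nlinarith

theorem abs_rpow_mul_inner_le (hs : 2 ≤ s) (a h : E) :
    |‖a‖ ^ (s - 2) * ⟪a, h⟫| ≤ ‖a‖ ^ s + ‖h‖ ^ s := by
  have h1 := rpow_sub_two_mul_mul_le hs (norm_nonneg a) (norm_nonneg h)
  rw [abs_mul, abs_of_nonneg (Real.rpow_nonneg (norm_nonneg a) _)]
  have h2 := mul_le_mul_of_nonneg_left (abs_real_inner_le_norm a h)
    (Real.rpow_nonneg (norm_nonneg a) (s - 2))
  have h3 : (1 - 1 / s) * ‖a‖ ^ s ≤ ‖a‖ ^ s := by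
    have : 0 ≤ 1 / s := by positivity
    nlinarith [Real.rpow_nonneg (norm_nonneg a) s]
  have h4 : ‖h‖ ^ s / s ≤ ‖h‖ ^ s :=
    div_le_self (Real.rpow_nonneg (norm_nonneg h) s) (by linarith)
  linarith

end Pointwise

/-! ### Integrated inequalities and limits for the `s`-Laplacian form. -/

section Flux

variable {α E : Type*} [MeasurableSpace α] {μ : Measure α} [NormedAddCommGroup E]
  [InnerProductSpace ℝ E] {s : ℝ} {a b h k : α → E}

/-- `∫ |a|^{s-2} a · h`. -/
def flux (s : ℝ) (μ : Measure α) (a h : α → E) : ℝ := ∫ x, ‖a x‖ ^ (s - 2) * ⟪a x, h x⟫ ∂μ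

/-- `∫ |a|^s`. -/
def powInt (s : ℝ) (μ : Measure α) (a : α → E) : ℝ := ∫ x, ‖a x‖ ^ s ∂μ

theorem powInt_nonneg : 0 ≤ powInt s μ a :=
  integral_nonneg fun _ => Real.rpow_nonneg (norm_nonneg _) _

theorem integrable_norm_rpow (hs : 2 ≤ s) (ha : MemLp a (ENNReal.ofReal s) μ) :
    Integrable (fun x => ‖a x‖ ^ s) μ := by
  have := ha.integrable_norm_rpow (by simp; linarith) (by simp)
  rwa [ENNReal.toReal_ofReal (by linarith)] at this

theorem integrable_flux (hs : 2 ≤ s) (ha : MemLp a (ENNReal.ofReal s) μ)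
    (hh : MemLp h (ENNReal.ofReal s) μ) :
    Integrable (fun x => ‖a x‖ ^ (s - 2) * ⟪a x, h x⟫) μ := by
  refine ((integrable_norm_rpow hs ha).add (integrable_norm_rpow hs hh)).mono' ?_ ?_
  · exact ((Real.continuous_rpow_const (by linarith)).comp_aestronglyMeasurable ha.1.norm).mul
      (ha.1.inner hh.1)
  · exact ae_of_all _ fun x => abs_rpow_mul_inner_le hs (a x) (h x)

theorem flux_smul (c : ℝ) : flux s μ a (fun x => c • h x) = c * flux s μ a h := by
  unfold flux
  rw [← integral_const_mul]
  congr 1; ext x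
  rw [inner_smul_right]; ring

theorem flux_sub (hs : 2 ≤ s) (ha : MemLp a (ENNReal.ofReal s) μ)
    (hh : MemLp h (ENNReal.ofReal s) μ) (hk : MemLp k (ENNReal.ofReal s) μ) :
    flux s μ a (fun x => h x - k x) = flux s μ a h - flux s μ a k := by
  unfold flux
  rw [← integral_sub (integrable_flux hs ha hh) (integrable_flux hs ha hk)]
  simp only [inner_sub_right, mul_sub]

theorem powInt_congr (ha : a =ᵐ[μ] b) : powInt s μ a = powInt s μ b := by
  refine integral_congr_ae ?_
  filter_upwards [ha] with x h1
  rw [h1]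

theorem powInt_smul (c : ℝ) : powInt s μ (fun x => c • a x) = |c| ^ s * powInt s μ a := by
  unfold powInt
  rw [← integral_const_mul]
  congr 1; ext x
  rw [norm_smul, Real.mul_rpow (norm_nonneg _) (norm_nonneg _), Real.norm_eq_abs]

theorem ae_eq_zero_of_powInt_eq_zero (hs : 2 ≤ s) (ha : MemLp a (ENNReal.ofReal s) μ)
    (h0 : powInt s μ a = 0) : a =ᵐ[μ] 0 := by
  have := (integral_eq_zero_iff_of_nonneg (fun x => Real.rpow_nonneg (norm_nonneg (a x)) s)
    (integrable_norm_rpow hs ha)).1 h0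
  filter_upwards [this] with x hx
  have hx' : ‖a x‖ ^ s = 0 := hx
  rw [Real.rpow_eq_zero (norm_nonneg _) (by linarith)] at hx'
  simpa using hx'

theorem powInt_uniformly_convex (hs : 2 ≤ s) (ha : MemLp a (ENNReal.ofReal s) μ)
    (hb : MemLp b (ENNReal.ofReal s) μ) :
    powInt s μ a / s + flux s μ a (fun x => b x - a x)
      + convexityConst s * powInt s μ (fun x => b x - a x) ≤ powInt s μ b / s := by
  have hba : MemLp (fun x => b x - a x) (ENNReal.ofReal s) μ := hb.sub ha
  unfold powInt flux
  rw [← integral_div, ← integral_div, ← integral_const_mul,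
    ← integral_add ((integrable_norm_rpow hs ha).div_const s) (integrable_flux hs ha hba),
    ← integral_add (f := fun x => ‖a x‖ ^ s / s + ‖a x‖ ^ (s - 2) * ⟪a x, b x - a x⟫)
      (((integrable_norm_rpow hs ha).div_const s).add (integrable_flux hs ha hba))
      ((integrable_norm_rpow hs hba).const_mul _)]
  refine integral_mono ((((integrable_norm_rpow hs ha).div_const s).add
    (integrable_flux hs ha hba)).add ((integrable_norm_rpow hs hba).const_mul _))
    ((integrable_norm_rpow hs hb).div_const s) fun x => ?_
  exact norm_rpow_uniformly_convex hs (a x) (b x)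

theorem abs_flux_le (hs : 2 ≤ s) (ha : MemLp a (ENNReal.ofReal s) μ)
    (hh : MemLp h (ENNReal.ofReal s) μ) : |flux s μ a h| ≤ powInt s μ a + powInt s μ h := by
  unfold flux powInt
  rw [← integral_add (integrable_norm_rpow hs ha) (integrable_norm_rpow hs hh)]
  refine (abs_integral_le_integral_abs).trans
    (integral_mono (integrable_flux hs ha hh).abs
      ((integrable_norm_rpow hs ha).add (integrable_norm_rpow hs hh)) fun x => ?_)
  exact abs_rpow_mul_inner_le hs (a x) (h x)

/-- A substitute for Hölder's inequality: rescaling `h` by `c` in the additive bound `abs_flux_le`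
gives `|flux| ≤ (powInt a + c ^ s * powInt h) / c`. A large `c` makes the first term small, and then
the second tends to zero. -/
theorem tendsto_flux_zero (hs : 2 ≤ s) (ha : MemLp a (ENNReal.ofReal s) μ)
    {h : ℕ → α → E} (hh : ∀ n, MemLp (h n) (ENNReal.ofReal s) μ)
    (h0 : Tendsto (fun n => powInt s μ (h n)) atTop (𝓝 0)) :
    Tendsto (fun n => flux s μ a (h n)) atTop (𝓝 0) := by
  have key : ∀ c : ℝ, 0 < c → ∀ n,
      |flux s μ a (h n)| ≤ (powInt s μ a + c ^ s * powInt s μ (h n)) / c := fun c hc n => by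
    have h1 := abs_flux_le hs ha ((hh n).const_smul c)
    have h2 : flux s μ a (c • h n) = c * flux s μ a (h n) := flux_smul c
    have h3 : powInt s μ (c • h n) = |c| ^ s * powInt s μ (h n) := powInt_smul c
    rw [h2, h3, abs_mul, abs_of_pos hc] at h1
    rw [le_div_iff₀ hc]; linarith
  rw [Metric.tendsto_atTop]
  intro ε hε
  have hP : 0 ≤ powInt s μ a := powInt_nonneg
  obtain ⟨c, hc, hc'⟩ : ∃ c : ℝ, 0 < c ∧ powInt s μ a / c < ε / 2 :=
    ⟨(2 * powInt s μ a + 1) / ε, by positivity, by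
      rw [div_lt_iff₀ (by positivity)]; field_simp; linarith⟩
  have h2 : Tendsto (fun n => c ^ s * powInt s μ (h n) / c) atTop (𝓝 0) := by
    simpa using (h0.const_mul (c ^ s)).div_const c
  obtain ⟨N, hN⟩ := eventually_atTop.1 (h2.eventually (gt_mem_nhds (half_pos hε)))
  refine ⟨N, fun n hn => ?_⟩
  rw [Real.dist_eq, sub_zero]
  have := key c hc n
  rw [add_div] at this
  linarith [hN n hn]

/-- Dominated convergence, with a majorant valid for `|t| < 1`. This continuity along lines replaces
differentiating the energy. -/
theorem tendsto_flux_add_smul (hs : 2 ≤ s) (ha : MemLp a (ENNReal.ofReal s) μ)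
    (hh : MemLp h (ENNReal.ofReal s) μ) :
    Tendsto (fun t : ℝ => flux s μ (fun x => a x + t • h x) h) (𝓝 0) (𝓝 (flux s μ a h)) := by
  have hn : MemLp (fun x => ‖a x‖ + ‖h x‖) (ENNReal.ofReal s) μ := ha.norm.add hh.norm
  refine tendsto_integral_filter_of_dominated_convergence
    (fun x => ‖(‖a x‖ + ‖h x‖)‖ ^ s + ‖h x‖ ^ s) ?_ ?_
    ((integrable_norm_rpow hs hn).add (integrable_norm_rpow hs hh)) ?_
  · exact Eventually.of_forall fun t => (integrable_flux hs (ha.add (hh.const_smul t)) hh).1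
  · have : ∀ᶠ t : ℝ in 𝓝 0, |t| < 1 := by
      have := (continuous_abs (G := ℝ)).tendsto 0
      rw [abs_zero] at this
      exact this.eventually (gt_mem_nhds one_pos)
    filter_upwards [this] with t ht
    refine ae_of_all _ fun x => ?_
    refine (abs_rpow_mul_inner_le hs (a x + t • h x) (h x)).trans ?_
    gcongr
    refine (norm_add_le _ _).trans ?_
    rw [Real.norm_of_nonneg (by positivity), norm_smul]
    gcongr
    exact mul_le_of_le_one_left (norm_nonneg _) ht.le
  · refine ae_of_all _ fun x => ?_
    have hc : Continuous fun t : ℝ => ‖a x + t • h x‖ ^ (s - 2) * ⟪a x + t • h x, h x⟫ := by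
      refine Continuous.mul ?_ (by fun_prop)
      exact (Real.continuous_rpow_const (by linarith)).comp (by fun_prop)
    simpa using hc.tendsto 0

end Flux

/-! ### Interior cones for `Ω` and `D₁`, and negligibility of the interface. -/

section Geometry

variable {N : ℕ}

/-- Near `x₀`, the set `S` is stable under small translations in directions close to `d`. -/
def ConeAt (S : Set (Rn N)) (x₀ d : Rn N) : Prop :=
  ∃ δ > 0, ∀ y ∈ S, dist y x₀ < δ → ∀ t : ℝ, 0 < t → t < δ → ∀ z : Rn N, ‖z‖ < δ * t →
    y + t • d + z ∈ S

/-- The cone is open, so replacing a limit point `y` by a nearby `y' ∈ S` costs only the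
perturbation `z + (y - y')`, still in the cone. -/
theorem ConeAt.closure {S : Set (Rn N)} {x₀ d : Rn N} (h : ConeAt S x₀ d) :
    ∃ δ > 0, ∀ y ∈ closure S, dist y x₀ < δ → ∀ t : ℝ, 0 < t → t < δ → ∀ z : Rn N, ‖z‖ < δ * t →
      y + t • d + z ∈ S := by
  obtain ⟨δ, hδ, h⟩ := h
  refine ⟨δ, hδ, fun y hy hyx t ht htδ z hz => ?_⟩
  have hO : IsOpen {y' : Rn N | dist y' x₀ < δ ∧ ‖z + (y - y')‖ < δ * t} :=
    IsOpen.and (isOpen_lt (by fun_prop) (by fun_prop)) (isOpen_lt (by fun_prop) (by fun_prop))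
  obtain ⟨y', ⟨h1, h2⟩, hy'⟩ := mem_closure_iff.1 hy _ hO ⟨hyx, by simpa using hz⟩
  have := h y' hy' h1 t ht htδ _ h2
  convert this using 1
  abel

theorem coneAt_of_mem_nhds {S : Set (Rn N)} {x₀ : Rn N} (h : S ∈ 𝓝 x₀) (d : Rn N) :
    ConeAt S x₀ d := by
  obtain ⟨ρ, hρ, hS⟩ := Metric.mem_nhds_iff.1 h
  refine ⟨min 1 (ρ / (‖d‖ + 2)), by positivity, fun y _ hy t ht htδ z hz => hS ?_⟩
  set δ := min 1 (ρ / (‖d‖ + 2))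
  have h1 : δ ≤ 1 := min_le_left _ _
  have h2 : δ * (‖d‖ + 2) ≤ ρ := (le_div_iff₀ (by positivity)).1 (min_le_right _ _)
  rw [Metric.mem_ball, dist_eq_norm]
  rw [dist_eq_norm] at hy
  have e : y + t • d + z - x₀ = (y - x₀) + t • d + z := by abel
  have h3 : ‖t • d‖ ≤ δ * ‖d‖ := by
    rw [norm_smul, Real.norm_of_nonneg ht.le]; gcongr
  have h4 : δ * t ≤ δ := by nlinarith
  rw [e]
  calc _ ≤ ‖y - x₀‖ + ‖t • d‖ + ‖z‖ := norm_add₃_le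
    _ < δ + δ * ‖d‖ + δ := by linarith
    _ ≤ ρ := by linarith

theorem coneAt_of_compl_mem_nhds {S : Set (Rn N)} {x₀ : Rn N} (h : Sᶜ ∈ 𝓝 x₀) (d : Rn N) :
    ConeAt S x₀ d := by
  obtain ⟨ρ, hρ, hS⟩ := Metric.mem_nhds_iff.1 h
  exact ⟨ρ, hρ, fun y hy hyx => absurd hy (hS hyx)⟩

theorem coneAt_of_increasing {S U : Set (Rn N)} {x₀ d : Rn N} {Φ : Rn N → ℝ} (hU : U ∈ 𝓝 x₀)
    (hS : ∀ x ∈ U, x ∈ S ↔ 0 < Φ x) {δ : ℝ} (hδ : 0 < δ) {V : Set (Rn N)} (hV : V ∈ 𝓝 x₀)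
    (hΦ : ∀ y ∈ V, ∀ t : ℝ, 0 < t → ∀ z : Rn N, ‖z‖ < δ * t → y + t • d + z ∈ V →
      Φ y ≤ Φ (y + t • d + z)) : ConeAt S x₀ d := by
  have hW : U ∩ V ∈ 𝓝 x₀ := inter_mem hU hV
  obtain ⟨δ', hδ', h'⟩ := coneAt_of_mem_nhds hW d
  obtain ⟨ρ, hρ, hB⟩ := Metric.mem_nhds_iff.1 hW
  refine ⟨min (min δ δ') ρ, by positivity, fun y hy hyx t ht htδ z hz => ?_⟩
  have h1 : min (min δ δ') ρ ≤ δ := (min_le_left _ _).trans (min_le_left _ _)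
  have h2 : min (min δ δ') ρ ≤ δ' := (min_le_left _ _).trans (min_le_right _ _)
  have hyW : y ∈ U ∩ V := hB (hyx.trans_le (min_le_right _ _))
  have hzW : y + t • d + z ∈ U ∩ V :=
    h' y hyW (hyx.trans_le h2) t ht (htδ.trans_le h2) z (hz.trans_le (by gcongr))
  exact (hS _ hzW.1).2 (((hS _ hyW.1).1 hy).trans_le
    (hΦ y hyW.2 t ht z (hz.trans_le (by gcongr)) hzW.2))

/-- Moving by `t • ν + z` raises the height by at least `t - ‖z‖`, while the graph rises by at most
`2 * K * ‖z‖`; the opening `1 / (2 * K + 1)` balances the two. -/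
theorem coneAt_of_lipschitz {S U : Set (Rn N)} {x₀ ν : Rn N} (hν : ‖ν‖ = 1) {g : Rn N → ℝ}
    {K : NNReal} (hg : LipschitzWith K g) (hU : U ∈ 𝓝 x₀)
    (hS : ∀ x ∈ U, x ∈ S ↔ g (x - ⟪ν, x⟫ • ν) < ⟪ν, x⟫) : ConeAt S x₀ ν := by
  refine coneAt_of_increasing (Φ := fun x => ⟪ν, x⟫ - g (x - ⟪ν, x⟫ • ν))
    (δ := 1 / (2 * K + 1)) hU (fun x hx => by rw [hS x hx, sub_pos]) (by positivity) univ_mem ?_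
  intro y _ t ht z hz _
  have hνν : ⟪ν, ν⟫ = 1 := by rw [real_inner_self_eq_norm_sq, hν]; norm_num
  have e1 : ⟪ν, y + t • ν + z⟫ = ⟪ν, y⟫ + t + ⟪ν, z⟫ := by
    rw [inner_add_right, inner_add_right, inner_smul_right, hνν, mul_one]
  have e2 : y + t • ν + z - ⟪ν, y + t • ν + z⟫ • ν
      = y - ⟪ν, y⟫ • ν + (z - ⟪ν, z⟫ • ν) := by rw [e1]; module
  have h1 : |⟪ν, z⟫| ≤ ‖z‖ := by simpa [hν] using abs_real_inner_le_norm ν z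
  have h2 := hg.dist_le_mul (y - ⟪ν, y⟫ • ν + (z - ⟪ν, z⟫ • ν)) (y - ⟪ν, y⟫ • ν)
  rw [dist_eq_norm, dist_eq_norm, add_sub_cancel_left, Real.norm_eq_abs] at h2
  have h3 : ‖z - ⟪ν, z⟫ • ν‖ ≤ 2 * ‖z‖ := by
    refine (norm_sub_le _ _).trans ?_
    rw [norm_smul, hν, Real.norm_eq_abs]; linarith
  have h4 : (K : ℝ) * ‖z - ⟪ν, z⟫ • ν‖ ≤ K * (2 * ‖z‖) := by gcongr
  have h5 : ‖z‖ * (2 * K + 1) < t := by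
    rwa [one_div, inv_mul_eq_div, lt_div_iff₀ (by positivity)] at hz
  simp only [e2]
  rw [e1]
  linarith [neg_abs_le ⟪ν, z⟫, le_abs_self (g (y - ⟪ν, y⟫ • ν + (z - ⟪ν, z⟫ • ν))
    - g (y - ⟪ν, y⟫ • ν))]

/-- Locally the frontier lies in a graph over the hyperplane orthogonal to `ν`. The translates of a
graph by the bounded sequence `2⁻ⁿ ν` are pairwise disjoint, so a graph is null. -/
theorem volume_frontier_eq_zero {S : Set (Rn N)} (hO : IsOpen S) (hS : HasLipschitzBoundary S) :
    volume (frontier S) = 0 := by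
  refine measure_null_of_locally_null _ fun x₀ hx₀ => ?_
  obtain ⟨ν, hν, g, ⟨K, hg⟩, U, hU, hUS⟩ := hS x₀ hx₀
  refine ⟨frontier S ∩ interior U, inter_mem_nhdsWithin _ (interior_mem_nhds.2 hU), ?_⟩
  have hgc := hg.continuous
  have hsub : frontier S ∩ interior U ⊆ {x | g (x - ⟪ν, x⟫ • ν) = ⟪ν, x⟫} := by
    rintro x ⟨hx, hxU⟩
    refine le_antisymm ?_ ?_
    · by_contra! hlt
      have hV : IsOpen (interior U ∩ {x | ⟪ν, x⟫ < g (x - ⟪ν, x⟫ • ν)}) :=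
        isOpen_interior.inter (isOpen_lt (by fun_prop) (by fun_prop))
      obtain ⟨y, ⟨hyU, hy⟩, hyS⟩ := mem_closure_iff.1 hx.1 _ hV ⟨hxU, hlt⟩
      exact lt_asymm hy ((hUS y (interior_subset hyU)).1 hyS)
    · by_contra! hlt
      have := (hUS x (interior_subset hxU)).2 hlt
      rw [hO.frontier_eq] at hx
      exact hx.2 this
  refine measure_mono_null hsub ?_
  have hνν : ⟪ν, ν⟫ = 1 := by rw [real_inner_self_eq_norm_sq, hν]; norm_num
  refine Measure.addHaar_eq_zero_of_disjoint_translates volume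
    (fun n : ℕ => ((1 / 2 : ℝ) ^ n) • ν) ?_ ?_
    (isClosed_eq (by fun_prop) (by fun_prop)).measurableSet
  · refine (Metric.isBounded_closedBall (x := (0 : Rn N)) (r := 1)).subset ?_
    rintro _ ⟨n, rfl⟩
    rw [mem_closedBall_zero_iff, norm_smul, hν, mul_one, Real.norm_of_nonneg (by positivity)]
    exact pow_le_one₀ (by norm_num) (by norm_num)
  · intro m n hmn
    rw [Function.onFun, disjoint_left]
    rintro _ ⟨_, rfl, x, hx, rfl⟩ ⟨_, rfl, y, hy, hxy⟩
    simp only [mem_ofPred_eq] at hx hy hxy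
    have e : y = x + ((1 / 2 : ℝ) ^ m - (1 / 2 : ℝ) ^ n) • ν := by
      rw [sub_smul, ← add_sub_assoc, eq_sub_iff_add_eq, add_comm, hxy, add_comm]
    have e1 : ⟪ν, y⟫ = ⟪ν, x⟫ + ((1 / 2 : ℝ) ^ m - (1 / 2 : ℝ) ^ n) := by
      rw [e, inner_add_right, inner_smul_right, hνν, mul_one]
    have e2 : y - ⟪ν, y⟫ • ν = x - ⟪ν, x⟫ • ν := by rw [e1, e]; module
    rw [e2, hx, e1] at hy
    have h3 : (1 / 2 : ℝ) ^ m = (1 / 2 : ℝ) ^ n := by linarith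
    exact hmn ((pow_right_strictAnti₀ (by norm_num : (0 : ℝ) < 1 / 2) (by norm_num)).injective h3)

/-- Strict differentiability controls increments between any two points near `x₀`. The constants
make the linearization error and the contribution of `z` at most a quarter of the gain `t * m d`
each. -/
theorem coneAt_of_strictDeriv {S U : Set (Rn N)} {x₀ d : Rn N} {Φ : Rn N → ℝ}
    {m : Rn N →L[ℝ] ℝ} (hU : U ∈ 𝓝 x₀) (hS : ∀ x ∈ U, x ∈ S ↔ 0 < Φ x)
    (hΦ : HasStrictFDerivAt Φ m x₀) (hd : 0 < m d) : ConeAt S x₀ d := by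
  have hc : 0 < m d / (4 * (‖d‖ + 1)) := by positivity
  obtain ⟨V, hV, happ⟩ := hΦ.approximates_deriv_on_nhds (c := ⟨_, hc.le⟩) (Or.inr hc)
  refine coneAt_of_increasing hU hS (δ := min 1 (m d / (4 * (‖m‖ + 1)))) (by positivity) hV ?_
  intro y hy t ht z hz hyz
  set δ := min 1 (m d / (4 * (‖m‖ + 1)))
  have h1 := happ _ hyz _ hy
  have e : y + t • d + z - y = t • d + z := by abel
  rw [e, map_add, map_smul, smul_eq_mul, Real.norm_eq_abs] at h1
  have h2 : ‖t • d + z‖ ≤ t * (‖d‖ + 1) := by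
    refine (norm_add_le _ _).trans ?_
    rw [norm_smul, Real.norm_of_nonneg ht.le]
    have : δ * t ≤ 1 * t := by gcongr; exact min_le_left _ _
    linarith
  have h3 : (m d / (4 * (‖d‖ + 1))) * ‖t • d + z‖ ≤ t * m d / 4 := by
    calc _ ≤ (m d / (4 * (‖d‖ + 1))) * (t * (‖d‖ + 1)) := by gcongr
      _ = _ := by field_simp
  have h4 : |m z| ≤ t * m d / 4 := by
    calc |m z| ≤ ‖m‖ * ‖z‖ := m.le_opNorm z
      _ ≤ (‖m‖ + 1) * (m d / (4 * (‖m‖ + 1)) * t) := by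
        gcongr
        · linarith
        · exact hz.le.trans (by gcongr; exact min_le_right _ _)
      _ = _ := by field_simp
  have h5 : |Φ (y + t • d + z) - Φ y - (t * m d + m z)| ≤ t * m d / 4 := h1.trans h3
  have h6 : 0 < t * m d := by positivity
  linarith [neg_abs_le (Φ (y + t • d + z) - Φ y - (t * m d + m z)), neg_abs_le (m z)]

/-- Directions in the open cone of `D` at `x₀` lead into `{Φ > 0}` from a point with `Φ ≤ 0`, so `m`
is nonnegative on them. As the cone is open, this also holds for `d - η • n`, which turns the weak
inequality into the strict one `m d ≥ η * m n > 0`. -/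
theorem deriv_pos_of_coneAt {S D U : Set (Rn N)} {x₀ d n : Rn N} {Φ : Rn N → ℝ}
    {m : Rn N →L[ℝ] ℝ} (hU : U ∈ 𝓝 x₀) (hS : ∀ x ∈ U, x ∈ S ↔ 0 < Φ x)
    (hΦ : HasFDerivAt Φ m x₀) (hn : 0 < m n) (hDS : D ⊆ S) (hx₀ : x₀ ∈ closure D) (hx₀S : x₀ ∉ S)
    (hD : ConeAt D x₀ d) : 0 < m d := by
  obtain ⟨δ, hδ, hD⟩ := hD.closure
  set η := δ / (2 * (‖n‖ + 1)) with hη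
  have hη0 : 0 < η := by positivity
  have hηn : ‖η • n‖ < δ := by
    rw [norm_smul, Real.norm_of_nonneg hη0.le, hη, div_mul_eq_mul_div, div_lt_iff₀ (by positivity)]
    nlinarith [norm_nonneg n]
  have hΦ0 : Φ x₀ ≤ 0 := by
    by_contra! h
    exact hx₀S ((hS x₀ (mem_of_mem_nhds hU)).2 h)
  have hlim := (hΦ.hasLineDerivAt (d - η • n)).tendsto_slope_zero_right
  have hm : 0 ≤ m (d - η • n) := by
    refine ge_of_tendsto hlim ?_
    have hU' : ∀ᶠ t : ℝ in 𝓝[>] 0, x₀ + t • (d - η • n) ∈ U := by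
      have hc : ContinuousAt (fun t : ℝ => x₀ + t • (d - η • n)) 0 := by fun_prop
      exact (hc.eventually_mem (by simpa using hU)).filter_mono nhdsWithin_le_nhds
    filter_upwards [hU', self_mem_nhdsWithin,
      (gt_mem_nhds hδ : ∀ᶠ t : ℝ in 𝓝 0, t < δ).filter_mono nhdsWithin_le_nhds] with t h1 h2 h3
    have h2 : 0 < t := h2
    have h4 : x₀ + t • (d - η • n) ∈ D := by
      have := hD x₀ hx₀ (by simpa using hδ) t h2 h3 (-(t • (η • n))) (by
        rw [norm_neg, norm_smul, Real.norm_of_nonneg h2.le, mul_comm]; gcongr)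
      convert this using 1
      module
    have h5 := (hS _ h1).1 (hDS h4)
    rw [smul_eq_mul]
    have : 0 < t⁻¹ := by positivity
    exact mul_nonneg this.le (by linarith)
  rw [map_sub, map_smul, smul_eq_mul] at hm
  have : 0 < η * m n := by positivity
  linarith

/-- Every point of `closure Ω` has a neighbourhood in which both `Ω` and `D₁` are stable under
small translations in a common open cone of directions. -/
theorem IsSplitting.exists_coneAt {Ω D₁ D₂ : Set (Rn N)} (h : IsSplitting Ω D₁ D₂) {x₀ : Rn N}
    (hx₀ : x₀ ∈ closure Ω) : ∃ d, ConeAt Ω x₀ d ∧ ConeAt D₁ x₀ d := by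
  have hfr : ∀ x, x ∉ frontier D₁ → ∀ d, ConeAt D₁ x d := fun x hx d => by
    by_cases hx1 : x ∈ D₁
    · exact coneAt_of_mem_nhds (h.isOpen₁.mem_nhds hx1) d
    · refine coneAt_of_compl_mem_nhds ?_ d
      have : x ∉ closure D₁ := fun hc => hx (by rw [h.isOpen₁.frontier_eq]; exact ⟨hc, hx1⟩)
      exact mem_of_superset (isClosed_closure.isOpen_compl.mem_nhds this)
        (compl_subset_compl.2 subset_closure)
  have hlip : x₀ ∈ frontier D₁ → ∃ d, ConeAt D₁ x₀ d := fun hx => by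
    obtain ⟨ν, hν, g, ⟨K, hg⟩, U, hU, hUS⟩ := h.lipschitz₁ x₀ hx
    exact ⟨ν, coneAt_of_lipschitz hν hg hU hUS⟩
  by_cases hΩ : x₀ ∈ Ω
  · by_cases hx : x₀ ∈ frontier D₁
    · obtain ⟨d, hd⟩ := hlip hx
      exact ⟨d, coneAt_of_mem_nhds (h.isOpen.mem_nhds hΩ) d, hd⟩
    · exact ⟨0, coneAt_of_mem_nhds (h.isOpen.mem_nhds hΩ) 0, hfr x₀ hx 0⟩
  obtain ⟨n, hn, g, hg, U, hU, hUS⟩ := h.smooth x₀ (by rw [h.isOpen.frontier_eq]; exact ⟨hx₀, hΩ⟩)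
  set Φ : Rn N → ℝ := fun x => ⟪n, x⟫ - g (x - ⟪n, x⟫ • n) with hΦ
  have hnn : ⟪n, n⟫ = 1 := by rw [real_inner_self_eq_norm_sq, hn]; norm_num
  have hΦd : ContDiff ℝ ∞ Φ := by
    have hi : ContDiff ℝ ∞ fun x : Rn N => ⟪n, x⟫ := contDiff_const.inner ℝ contDiff_id
    exact hi.sub (hg.comp (contDiff_id.sub (hi.smul contDiff_const)))
  have hstrict : HasStrictFDerivAt Φ (fderiv ℝ Φ x₀) x₀ :=
    hΦd.contDiffAt.hasStrictFDerivAt (by simp)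
  have hUS' : ∀ x ∈ U, x ∈ Ω ↔ 0 < Φ x := fun x hx => by rw [hUS x hx, sub_pos]
  -- Moving along `n` leaves the orthogonal component fixed, so `Φ` grows at unit speed.
  have hmn : fderiv ℝ Φ x₀ n = 1 := by
    have h1 := hstrict.hasFDerivAt.hasLineDerivAt n
    have h2 : HasLineDerivAt ℝ Φ 1 x₀ n := by
      have e : (fun t : ℝ => Φ (x₀ + t • n)) = fun t => t + Φ x₀ := by
        ext t
        have e1 : ⟪n, x₀ + t • n⟫ = ⟪n, x₀⟫ + t := by
          rw [inner_add_right, inner_smul_right, hnn, mul_one]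
        have e2 : x₀ + t • n - ⟪n, x₀ + t • n⟫ • n = x₀ - ⟪n, x₀⟫ • n := by rw [e1]; module
        simp only [hΦ, e2]
        rw [e1]; ring
      unfold HasLineDerivAt
      rw [e]
      exact (hasDerivAt_id (0 : ℝ)).add_const _
    exact h1.unique h2
  by_cases hx : x₀ ∈ frontier D₁
  · obtain ⟨d, hd⟩ := hlip hx
    -- At a point of both `∂Ω` and `∂D₁`, the direction given by the Lipschitz graph of `D₁` also
    -- serves `Ω`, because `D₁ ⊆ Ω`.
    refine ⟨d, coneAt_of_strictDeriv hU hUS' hstrict ?_, hd⟩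
    exact deriv_pos_of_coneAt hU hUS' hstrict.hasFDerivAt (hmn ▸ one_pos) h.subset₁
      (frontier_subset_closure hx) hΩ hd
  · exact ⟨n, coneAt_of_strictDeriv hU hUS' hstrict (hmn ▸ one_pos), hfr x₀ hx n⟩

/-- Up to a null set, `Ω` is the union of `D₁` and `D₂`. -/
theorem IsSplitting.ae_mem {Ω D₁ D₂ : Set (Rn N)} (h : IsSplitting Ω D₁ D₂) :
    ∀ᵐ x : Rn N, x ∈ Ω → x ∈ D₁ ∪ D₂ := by
  have := volume_frontier_eq_zero h.isOpen₁ h.lipschitz₁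
  filter_upwards [measure_eq_zero_iff_ae_notMem.1 this] with x hx hxΩ
  by_contra hx12
  have h1 : x ∈ closure (D₁ ∪ D₂) := h.closure_eq ▸ subset_closure hxΩ
  rw [closure_union] at h1
  rcases h1 with h1 | h1
  · exact hx (by rw [h.isOpen₁.frontier_eq]; exact ⟨h1, fun h' => hx12 (Or.inl h')⟩)
  · have : x ∈ frontier D₂ ∩ Ω :=
      ⟨by rw [h.isOpen₂.frontier_eq]; exact ⟨h1, fun h' => hx12 (Or.inr h')⟩, hxΩ⟩
    rw [← h.interface_eq] at this
    exact hx this.1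

end Geometry

/-! ### Mollification by kernels not centred at the origin. -/

section Mollify

open scoped ENNReal Convolution

variable {N : ℕ} {F : Type*} [NormedAddCommGroup F] [NormedSpace ℝ F]

theorem exists_forall_eLpNorm_translate_sub_le {v : Rn N → F} {r : ℝ≥0∞} (hr : 1 ≤ r)
    (hr' : r ≠ ⊤) (hv : MemLp v r volume) {ε : ℝ≥0∞} (hε : 0 < ε) :
    ∃ ρ > 0, ∀ z : Rn N, ‖z‖ < ρ → eLpNorm (fun x => v (x - z) - v x) r volume ≤ ε := by
  have : Fact (1 ≤ r) := ⟨hr⟩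
  have : Fact (r ≠ ⊤) := ⟨hr'⟩
  have : ContinuousVAdd (Rn N)ᵈᵃᵃ (Lp F r (volume : Measure (Rn N))) :=
    Lp.instContinuousVAddDomAddAct
  have hc : Continuous fun z : Rn N => DomAddAct.mk (-z) +ᵥ hv.toLp v :=
    (DomAddAct.continuous_mk.comp continuous_neg).vadd continuous_const
  have h0 := EMetric.tendsto_nhds.1 (hc.tendsto 0) ε hε
  obtain ⟨ρ, hρ, h⟩ := Metric.eventually_nhds_iff_ball.1 h0
  refine ⟨ρ, hρ, fun z hz => ?_⟩
  have h1 := h z (by simpa using hz)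
  rw [neg_zero, DomAddAct.mk_zero, zero_vadd, DomAddAct.mk_vadd_toLp, Lp.edist_toLp_toLp] at h1
  refine (eLpNorm_congr_ae (ae_of_all _ fun x => ?_)).trans_le h1.le
  simp [sub_eq_neg_add]

/-- A mollifying kernel. -/
structure IsKernel (η : Rn N → ℝ) : Prop where
  contDiff : ContDiff ℝ ∞ η
  hasCompactSupport : HasCompactSupport η
  nonneg : ∀ x, 0 ≤ η x
  integral_eq : ∫ x, η x = 1

/-- The convolution of `v` with the kernel `η`. -/
def mollify (η : Rn N → ℝ) (v : Rn N → F) (x : Rn N) : F := ∫ z, η z • v (x - z)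

theorem mollify_eq_convolution (η : Rn N → ℝ) (v : Rn N → F) :
    mollify η v = η ⋆[ContinuousLinearMap.lsmul ℝ ℝ, volume] v := rfl

theorem mollify_eq_swap (η : Rn N → ℝ) (v : Rn N → F) (x : Rn N) :
    mollify η v x = ∫ y, η (x - y) • v y := by
  rw [mollify_eq_convolution, convolution_lsmul_swap]

theorem IsKernel.continuous {η : Rn N → ℝ} (hη : IsKernel η) : Continuous η :=
  hη.contDiff.continuous

theorem IsKernel.integrable {η : Rn N → ℝ} (hη : IsKernel η) : Integrable η :=
  hη.continuous.integrable_of_hasCompactSupport hη.hasCompactSupport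

theorem IsKernel.isProbabilityMeasure {η : Rn N → ℝ} (hη : IsKernel η) :
    IsProbabilityMeasure (volume.withDensity fun x => ENNReal.ofReal (η x)) := by
  constructor
  rw [withDensity_apply _ MeasurableSet.univ, setLIntegral_univ,
    ← ofReal_integral_eq_lintegral_ofReal hη.integrable (ae_of_all _ hη.nonneg), hη.integral_eq]
  simp

theorem IsKernel.integrable_smul {η : Rn N → ℝ} (hη : IsKernel η) {v : Rn N → F}
    (hv : LocallyIntegrable v) (x : Rn N) : Integrable fun z => η z • v (x - z) :=
  (HasCompactSupport.convolutionExists_left (L := ContinuousLinearMap.lsmul ℝ ℝ)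
    hη.hasCompactSupport hη.continuous hv x).integrable

/-- Minkowski's integral inequality for an average of translates: Jensen's inequality for the
probability measure `η dz` at each point, then Tonelli. Only translations by points where `η` is
nonzero matter, wherever that support lies. -/
theorem IsKernel.eLpNorm_mollify_sub_le [CompleteSpace F] {η : Rn N → ℝ} (hη : IsKernel η)
    {v : Rn N → F} {r : ℝ≥0∞} (hr : 1 ≤ r) (hr' : r ≠ ⊤) (hv : MemLp v r volume) {ε : ℝ≥0∞}
    (hε : ∀ z, η z ≠ 0 → eLpNorm (fun x => v (x - z) - v x) r volume ≤ ε) :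
    eLpNorm (fun x => mollify η v x - v x) r volume ≤ ε := by
  have hloc : LocallyIntegrable v := hv.locallyIntegrable hr
  have hr0 : r ≠ 0 := (one_pos.trans_le hr).ne'
  have hs1 : 1 ≤ r.toReal := by
    rw [← ENNReal.toReal_one]; exact ENNReal.toReal_mono hr' hr
  have hs0 : 0 < r.toReal := by linarith
  set s := r.toReal with hs
  have := hη.isProbabilityMeasure
  set P := volume.withDensity fun x => ENNReal.ofReal (η x) with hP
  have hηm : Measurable fun x => ENNReal.ofReal (η x) := hη.continuous.measurable.ennreal_ofReal
  have hPac : P ≪ volume := withDensity_absolutelyContinuous _ _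
  have hv2 : AEStronglyMeasurable (fun q : Rn N × Rn N => v (q.1 - q.2) - v q.1)
      (volume.prod volume) :=
    (hv.1.comp_quasiMeasurePreserving
      (quasiMeasurePreserving_sub_of_right_invariant volume volume)).sub hv.1.comp_fst
  have hv1 : ∀ x, AEStronglyMeasurable (fun z => v (x - z) - v x) volume := fun x =>
    (hv.1.comp_quasiMeasurePreserving
      (quasiMeasurePreserving_sub_left_of_right_invariant volume x)).sub
      aestronglyMeasurable_const
  have hpt : ∀ x, ‖mollify η v x - v x‖ₑ ^ s
      ≤ ∫⁻ z, ENNReal.ofReal (η z) * ‖v (x - z) - v x‖ₑ ^ s := fun x => by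
    have e1 : mollify η v x - v x = ∫ z, η z • (v (x - z) - v x) := by
      simp only [smul_sub]
      rw [integral_sub (hη.integrable_smul hloc x) (hη.integrable.smul_const _),
        integral_smul_const, hη.integral_eq, one_smul]; rfl
    have e2 : ‖mollify η v x - v x‖ₑ ≤ ∫⁻ z, ‖v (x - z) - v x‖ₑ ∂P := by
      rw [e1, hP, lintegral_withDensity_eq_lintegral_mul₀ hηm.aemeasurable (hv1 x).enorm]
      refine (enorm_integral_le_lintegral_enorm _).trans (lintegral_mono fun z => ?_)
      rw [enorm_smul, Real.enorm_of_nonneg (hη.nonneg z)]; rfl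
    have e3 := eLpNorm'_le_eLpNorm'_of_exponent_le one_pos hs1 P ((hv1 x).mono_ac hPac)
    simp only [eLpNorm'_eq_lintegral_enorm, ENNReal.rpow_one, ne_eq, one_ne_zero,
      not_false_eq_true, div_self] at e3
    calc _ ≤ (∫⁻ z, ‖v (x - z) - v x‖ₑ ∂P) ^ s := ENNReal.rpow_le_rpow e2 hs0.le
      _ ≤ ((∫⁻ z, ‖v (x - z) - v x‖ₑ ^ s ∂P) ^ (1 / s)) ^ s := ENNReal.rpow_le_rpow e3 hs0.le
      _ = ∫⁻ z, ‖v (x - z) - v x‖ₑ ^ s ∂P := by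
        rw [← ENNReal.rpow_mul, one_div_mul_cancel hs0.ne', ENNReal.rpow_one]
      _ = _ := by
        rw [hP, lintegral_withDensity_eq_lintegral_mul₀ hηm.aemeasurable
          ((hv1 x).enorm.pow_const s)]; rfl
  rw [eLpNorm_eq_lintegral_rpow_enorm_toReal hr0 hr', ← hs, one_div,
    ENNReal.rpow_inv_le_iff hs0]
  calc _ ≤ ∫⁻ x, ∫⁻ z, ENNReal.ofReal (η z) * ‖v (x - z) - v x‖ₑ ^ s := lintegral_mono hpt
    _ = ∫⁻ z, ∫⁻ x, ENNReal.ofReal (η z) * ‖v (x - z) - v x‖ₑ ^ s :=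
      lintegral_lintegral_swap ((hηm.comp measurable_snd).aemeasurable.mul
        (hv2.enorm.pow_const s))
    _ ≤ ∫⁻ z, ENNReal.ofReal (η z) * ε ^ s := by
      refine lintegral_mono fun z => ?_
      rw [lintegral_const_mul' _ _ ENNReal.ofReal_ne_top]
      by_cases hz : η z = 0
      · simp [hz]
      gcongr
      have := hε z hz
      rwa [eLpNorm_eq_lintegral_rpow_enorm_toReal hr0 hr', ← hs, one_div,
        ENNReal.rpow_inv_le_iff hs0] at this
    _ = ε ^ s := by
      rw [lintegral_mul_const _ hηm,
        ← ofReal_integral_eq_lintegral_ofReal hη.integrable (ae_of_all _ hη.nonneg),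
        hη.integral_eq, ENNReal.ofReal_one, one_mul]

theorem IsKernel.contDiff_mollify [CompleteSpace F] {η : Rn N → ℝ} (hη : IsKernel η)
    {v : Rn N → F} (hv : LocallyIntegrable v) : ContDiff ℝ ∞ (mollify η v) :=
  hη.hasCompactSupport.contDiff_convolution_left (n := ⊤) (ContinuousLinearMap.lsmul ℝ ℝ) hη.contDiff hv

theorem mollify_ne_zero {η : Rn N → ℝ} {v : Rn N → F} {x : Rn N} (h : mollify η v x ≠ 0) :
    ∃ z, η z ≠ 0 ∧ v (x - z) ≠ 0 := by
  by_contra! hc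
  refine h (integral_eq_zero_of_ae (ae_of_all _ fun z => ?_))
  by_cases hz : η z = 0
  · simp [hz]
  · simp [hc z hz]

theorem mollify_nonneg {η : Rn N → ℝ} (hη : IsKernel η) {v : Rn N → ℝ} (hv : ∀ᵐ x, 0 ≤ v x)
    (x : Rn N) : 0 ≤ mollify η v x := by
  rw [mollify_eq_swap]
  refine integral_nonneg_of_ae ?_
  filter_upwards [hv] with y hy
  exact mul_nonneg (hη.nonneg _) hy

theorem gradient_comp_sub_left {η : Rn N → ℝ} (hη : Differentiable ℝ η) (x y : Rn N) :
    ∇ (fun y => η (x - y)) y = -∇ η (x - y) := by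
  have h := (hη (x - y)).hasFDerivAt.comp y ((hasFDerivAt_const x y).sub (hasFDerivAt_id y))
  have e : fderiv ℝ (fun y => η (x - y)) y = -fderiv ℝ η (x - y) := by
    refine (HasFDerivAt.fderiv h).trans ?_
    ext w
    simp
  simp only [gradient]
  rw [e, map_neg]


theorem IsKernel.fderiv_mollify {η : Rn N → ℝ} (hη : IsKernel η) {v : Rn N → ℝ}
    (hv : LocallyIntegrable v) (x : Rn N) :
    fderiv ℝ (mollify η v) x = ∫ y, v y • fderiv ℝ η (x - y) := by
  have h1 := hη.hasCompactSupport.hasFDerivAt_convolution_left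
    (ContinuousLinearMap.lsmul ℝ ℝ) (hη.contDiff.of_le (by simp)) hv x
  refine (HasFDerivAt.fderiv h1).trans ?_
  rw [convolution_eq_swap]
  refine integral_congr_ae (ae_of_all _ fun y => ?_)
  ext w
  simp [ContinuousLinearMap.precompL_apply, mul_comm]

/-- The weak gradient is tested with `y ↦ η (x - y)`; the sign from the reflection cancels the one
from integration by parts. -/
theorem IsKernel.gradient_mollify {η : Rn N → ℝ} (hη : IsKernel η) {v : Rn N → ℝ}
    {G : Rn N → Rn N} (h : HasWeakGradient univ v G) (x : Rn N) :
    ∇ (mollify η v) x = mollify η G x := by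
  have hv : LocallyIntegrable v := locallyIntegrableOn_univ.1 h.1
  have hT : IsTest univ fun y => η (x - y) :=
    { contDiff := hη.contDiff.comp (contDiff_const.sub contDiff_id)
      hasCompactSupport := hη.hasCompactSupport.comp_homeomorph (Homeomorph.subLeft x)
      tsupport_subset := subset_univ _ }
  have h1 := h.integral_eq _ hT
  have hi := hT.integrable_smul_gradient (locallyIntegrableOn_univ.2 hv)
  have hgr := gradient_comp_sub_left (hη.contDiff.differentiable (by simp)) x
  simp only [Measure.restrict_univ, hgr, smul_neg, integral_neg, neg_inj] at h1 hi
  have hi : Integrable fun y => v y • ∇ η (x - y) := by simpa using hi.neg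
  have hi' : Integrable fun y => v y • fderiv ℝ η (x - y) := by
    have := (InnerProductSpace.toDual ℝ (Rn N)).toContinuousLinearEquiv.toContinuousLinearMap.integrable_comp hi
    refine this.congr (ae_of_all _ fun y => ?_)
    simp [gradient]
  rw [mollify_eq_swap, ← h1]
  refine ext_inner_right ℝ fun w => ?_
  rw [gradient, InnerProductSpace.toDual_symm_apply, hη.fderiv_mollify hv,
    ContinuousLinearMap.integral_apply hi', real_inner_comm, ← integral_inner hi]
  refine integral_congr_ae (ae_of_all _ fun y => ?_)
  simp only
  rw [inner_smul_right, real_inner_comm, gradient, InnerProductSpace.toDual_symm_apply]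
  rfl

end Mollify

/-! ### Weak gradients and closure properties of `W₀^{1,2}(Ω)`. -/

section Sobolev

open scoped ENNReal

variable {N : ℕ} {Ω D₂ S : Set (Rn N)} {p : ℝ} {u v φ ψ : Rn N → ℝ} {G H : Rn N → Rn N}

theorem eLpNorm_two_mul_le {α F : Type*} [MeasurableSpace α] {μ : Measure α}
    [NormedAddCommGroup F] [NormedSpace ℝ F] {f : α → F} {g : α → ℝ}
    (hf : AEStronglyMeasurable f μ) (hg : AEStronglyMeasurable g μ) :
    eLpNorm (fun x => g x • f x) 1 μ ≤ eLpNorm g 2 μ * eLpNorm f 2 μ :=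
  eLpNorm_smul_le_mul_eLpNorm hf hg

theorem tendsto_eLpNorm_smul_zero {α F : Type*} [MeasurableSpace α] {μ : Measure α}
    [NormedAddCommGroup F] [NormedSpace ℝ F] {r : ℝ≥0∞} (hr0 : r ≠ 0) (hr : r ≠ ⊤) {f : α → F}
    (hf : MemLp f r μ) {c : ℕ → α → ℝ} (hc : ∀ n, AEStronglyMeasurable (c n) μ) {K : ℝ}
    (hK : ∀ n x, |c n x| ≤ K) (h0 : ∀ᵐ x ∂μ, Tendsto (fun n => c n x) atTop (𝓝 0)) :
    Tendsto (fun n => eLpNorm (fun x => c n x • f x) r μ) atTop (𝓝 0) := by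
  have hs : 0 < r.toReal := ENNReal.toReal_pos hr0 hr
  simp only [eLpNorm_eq_lintegral_rpow_enorm_toReal hr0 hr]
  have key : Tendsto (fun n => ∫⁻ x, ‖c n x • f x‖ₑ ^ r.toReal ∂μ) atTop
      (𝓝 (∫⁻ _, 0 ∂μ)) := by
    refine tendsto_lintegral_of_dominated_convergence'
      (fun x => ENNReal.ofReal K ^ r.toReal * ‖f x‖ₑ ^ r.toReal)
      (fun n => ((hc n).smul hf.1).enorm.pow_const _) (fun n => ae_of_all _ fun x => ?_) ?_ ?_
    · simp only
      rw [← ENNReal.mul_rpow_of_nonneg _ _ hs.le, enorm_smul]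
      gcongr
      rw [← ofReal_norm]
      exact ENNReal.ofReal_le_ofReal (hK n x)
    · rw [lintegral_const_mul'' _ (hf.1.enorm.pow_const _)]
      refine ENNReal.mul_ne_top (ENNReal.rpow_ne_top_of_nonneg hs.le ENNReal.ofReal_ne_top) ?_
      exact (lintegral_rpow_enorm_lt_top_of_eLpNorm_lt_top hr0 hr hf.2).ne
    · filter_upwards [h0] with x hx
      have h1 : Tendsto (fun n => c n x • f x) atTop (𝓝 0) := by
        simpa using hx.smul_const (f x)
      have h2 := (ENNReal.continuous_rpow_const (y := r.toReal)).tendsto 0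
      have h3 : Tendsto (fun n => ‖c n x • f x‖ₑ) atTop (𝓝 0) := by simpa using h1.enorm
      rw [ENNReal.zero_rpow_of_pos hs] at h2
      exact h2.comp h3
  rw [lintegral_zero] at key
  have := (ENNReal.continuous_rpow_const (y := 1 / r.toReal)).tendsto 0
  rw [ENNReal.zero_rpow_of_pos (by positivity)] at this
  exact this.comp key

theorem gradient_inner (x w : Rn N) : ⟪∇ φ x, w⟫ = fderiv ℝ φ x w := by
  rw [gradient, InnerProductSpace.toDual_symm_apply]

theorem setIntegral_eq_integral_of_tsupport_subset {F : Type*} [NormedAddCommGroup F]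
    [NormedSpace ℝ F] {f : Rn N → F} (hS : tsupport φ ⊆ S) (hf : ∀ x, x ∉ tsupport φ → f x = 0) :
    ∫ x in S, f x = ∫ x, f x :=
  setIntegral_eq_integral_of_forall_compl_eq_zero fun x hx => hf x fun h => hx (hS h)

theorem IsTest.integral_mul_fderiv (hφ : IsTest S φ) (hψ : ContDiff ℝ ∞ ψ) (w : Rn N) :
    ∫ x, φ x * fderiv ℝ ψ x w = - ∫ x, fderiv ℝ φ x w * ψ x := by
  have hψ1 : Continuous fun x => fderiv ℝ ψ x w :=
    (hψ.continuous_fderiv (by simp)).clm_apply continuous_const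
  have hφ1 : Continuous fun x => fderiv ℝ φ x w :=
    (hφ.contDiff.continuous_fderiv (by simp)).clm_apply continuous_const
  have hφs : HasCompactSupport fun x => fderiv ℝ φ x w :=
    (hφ.hasCompactSupport.fderiv (𝕜 := ℝ)).comp_left (g := fun L : Rn N →L[ℝ] ℝ => L w) (by simp)
  refine integral_mul_fderiv_eq_neg_fderiv_mul_of_integrable ?_ ?_ ?_
    (fun x _ => hφ.differentiable x) (fun x _ => hψ.differentiable (by simp) x)
  · exact (hφ1.mul hψ.continuous).integrable_of_hasCompactSupport hφs.mul_right
  · exact (hφ.contDiff.continuous.mul hψ1).integrable_of_hasCompactSupport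
      hφ.hasCompactSupport.mul_right
  · exact (hφ.contDiff.continuous.mul hψ.continuous).integrable_of_hasCompactSupport
      hφ.hasCompactSupport.mul_right

theorem hasWeakGradient_of_contDiff (hψ : ContDiff ℝ ∞ ψ) : HasWeakGradient S ψ (∇ ψ) := by
  have hψg : Continuous fun x => ∇ ψ x :=
    (InnerProductSpace.toDual ℝ (Rn N)).symm.continuous.comp (hψ.continuous_fderiv (by simp))
  have h1 : LocallyIntegrableOn ψ S := hψ.continuous.locallyIntegrable.locallyIntegrableOn S
  have h2 : LocallyIntegrableOn (∇ ψ) S := hψg.locallyIntegrable.locallyIntegrableOn S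
  refine ⟨h1, h2, fun φ hφ => ?_⟩
  have i1 := hφ.integrable_smul_gradient h1
  have i2 := hφ.integrable_smul h2
  refine ext_inner_right ℝ fun w => ?_
  rw [inner_neg_left, real_inner_comm, ← integral_inner i1, real_inner_comm, ← integral_inner i2]
  simp only [inner_smul_right, fun x => real_inner_comm (∇ φ x) w, fun x => real_inner_comm (∇ ψ x) w,
    gradient_inner]
  rw [setIntegral_eq_integral_of_tsupport_subset hφ.tsupport_subset,
    setIntegral_eq_integral_of_tsupport_subset hφ.tsupport_subset, hφ.integral_mul_fderiv hψ,
    neg_neg]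
  · simp only [mul_comm]
  · intro x hx; simp [image_eq_zero_of_notMem_tsupport hx]
  · intro x hx; rw [← gradient_inner, IsTest.gradient_eq_zero hx]; simp

theorem IsTest.memLp (hφ : IsTest Ω φ) (r : ℝ≥0∞) : MemLp φ r (volume.restrict S) :=
  (hφ.contDiff.continuous.memLp_of_hasCompactSupport hφ.hasCompactSupport).restrict S

theorem IsTest.memLp_gradient (hφ : IsTest Ω φ) (r : ℝ≥0∞) : MemLp (∇ φ) r (volume.restrict S) := by
  refine MemLp.restrict S (hφ.continuous_gradient.memLp_of_hasCompactSupport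
    (HasCompactSupport.intro hφ.hasCompactSupport fun x hx => IsTest.gradient_eq_zero hx))

theorem locallyIntegrableOn_of_memLp_two {F : Type*} [NormedAddCommGroup F] {f : Rn N → F}
    (hf : MemLp f 2 (volume.restrict S)) : LocallyIntegrableOn f S :=
  locallyIntegrableOn_of_locallyIntegrable_restrict (hf.locallyIntegrable (by norm_num))

theorem HasWeakGradient.of_tendsto {a : ℕ → Rn N → ℝ} {A : ℕ → Rn N → Rn N}
    (ha : ∀ n, HasWeakGradient S (a n) (A n)) (ham : ∀ n, MemLp (a n) 2 (volume.restrict S))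
    (hAm : ∀ n, MemLp (A n) 2 (volume.restrict S)) (hu : MemLp u 2 (volume.restrict S))
    (hG : MemLp G 2 (volume.restrict S))
    (h1 : Tendsto (fun n => eLpNorm (fun x => a n x - u x) 2 (volume.restrict S)) atTop (𝓝 0))
    (h2 : Tendsto (fun n => eLpNorm (fun x => A n x - G x) 2 (volume.restrict S)) atTop (𝓝 0)) :
    HasWeakGradient S u G := by
  have lu := locallyIntegrableOn_of_memLp_two hu
  have lG := locallyIntegrableOn_of_memLp_two hG
  refine ⟨lu, lG, fun φ hφ => ?_⟩
  have t1 : Tendsto (fun n => ∫ x in S, a n x • ∇ φ x) atTop (𝓝 (∫ x in S, u x • ∇ φ x)) := by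
    refine tendsto_integral_of_L1' _ (hφ.integrable_smul_gradient lu).1
      (Eventually.of_forall fun n => hφ.integrable_smul_gradient (ha n).1) ?_
    have hlim : Tendsto (fun n => eLpNorm (fun x => a n x - u x) 2 (volume.restrict S)
        * eLpNorm (∇ φ) 2 (volume.restrict S)) atTop (𝓝 0) := by
      simpa using ENNReal.Tendsto.mul_const h1 (Or.inr (hφ.memLp_gradient 2).2.ne)
    refine tendsto_of_tendsto_of_tendsto_of_le_of_le tendsto_const_nhds hlim
      (fun _ => zero_le) fun n => ?_
    refine le_trans (eLpNorm_congr_ae (ae_of_all _ fun x => ?_)).le (eLpNorm_two_mul_le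
      (hφ.memLp_gradient 2).1 ((ham n).sub hu).1)
    simp [sub_smul]
  have t2 : Tendsto (fun n => ∫ x in S, φ x • A n x) atTop (𝓝 (∫ x in S, φ x • G x)) := by
    refine tendsto_integral_of_L1' _ (hφ.integrable_smul lG).1
      (Eventually.of_forall fun n => hφ.integrable_smul (ha n).2) ?_
    have hlim : Tendsto (fun n => eLpNorm φ 2 (volume.restrict S) *
        eLpNorm (fun x => A n x - G x) 2 (volume.restrict S)) atTop (𝓝 0) := by
      simpa using ENNReal.Tendsto.const_mul h2 (Or.inr (hφ.memLp 2).2.ne)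
    refine tendsto_of_tendsto_of_tendsto_of_le_of_le tendsto_const_nhds hlim
      (fun _ => zero_le) fun n => ?_
    refine le_trans (eLpNorm_congr_ae (ae_of_all _ fun x => ?_)).le (eLpNorm_two_mul_le
      ((hAm n).sub hG).1 (hφ.memLp 2).1)
    simp [smul_sub]
  refine tendsto_nhds_unique t1 ?_
  simp only [(ha _).integral_eq φ hφ]
  exact t2.neg

theorem HasWeakGradient.ae_eq (hΩ : IsOpen Ω) (hu : HasWeakGradient Ω u G)
    (hv : HasWeakGradient Ω u H) : G =ᵐ[volume.restrict Ω] H := by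
  have hloc : LocallyIntegrableOn (fun x => G x - H x) Ω := hu.2.sub hv.2
  have := hΩ.ae_eq_zero_of_integral_contDiff_smul_eq_zero hloc fun φ h1 h2 h3 => by
    have hφ : IsTest Ω φ := ⟨h1, h2, h3⟩
    rw [← setIntegral_eq_integral_of_tsupport_subset hφ.tsupport_subset]
    · simp only [smul_sub]
      rw [integral_sub (hφ.integrable_smul hu.2) (hφ.integrable_smul hv.2), sub_eq_zero]
      have e1 := hu.3 φ hφ
      rw [hv.3 φ hφ] at e1
      exact (neg_inj.1 e1).symm
    · intro x hx; simp [image_eq_zero_of_notMem_tsupport hx]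
  filter_upwards [(ae_restrict_iff' hΩ.measurableSet).2 this] with x hx
  exact sub_eq_zero.1 hx

theorem HasWeakGradient.congr_grad (hu : HasWeakGradient Ω u G)
    (h : G =ᵐ[volume.restrict Ω] H) : HasWeakGradient Ω u H where
  locallyIntegrableOn := hu.1
  locallyIntegrableOn_grad x hx := by
    obtain ⟨s, hs, hi⟩ := hu.2 x hx
    refine ⟨s ∩ Ω, inter_mem hs self_mem_nhdsWithin, ?_⟩
    exact (hi.mono_set inter_subset_left).congr_fun_ae
      (ae_restrict_of_ae_restrict_of_subset inter_subset_right h)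
  integral_eq φ hφ := by
    rw [hu.3 φ hφ]
    congr 1
    refine integral_congr_ae ?_
    filter_upwards [h] with x hx
    rw [hx]

theorem HasWeakGradient.weakGrad_ae_eq (hΩ : IsOpen Ω) (hu : HasWeakGradient Ω u G) :
    weakGrad Ω u =ᵐ[volume.restrict Ω] G := by
  have h : ∃ G, HasWeakGradient Ω u G := ⟨G, hu⟩
  rw [weakGrad, dif_pos h]
  exact h.choose_spec.ae_eq hΩ hu

theorem IsW012.congr_grad (hu : IsW012 Ω u G) (h : G =ᵐ[volume.restrict Ω] H) :
    IsW012 Ω u H where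
  hasWeakGradient := hu.1.congr_grad h
  memLp := hu.2
  memLp_grad := (memLp_congr_ae h).1 hu.3
  exists_seq := by
    obtain ⟨a, ha, ha1, ha2⟩ := hu.4
    refine ⟨a, ha, ha1, ha2.congr fun n => eLpNorm_congr_ae ?_⟩
    filter_upwards [h] with x hx
    rw [hx]

theorem isW012_of_tendsto_test {a : ℕ → Rn N → ℝ} (ha : ∀ n, IsTest Ω (a n))
    (hu : MemLp u 2 (volume.restrict Ω)) (hG : MemLp G 2 (volume.restrict Ω))
    (h1 : Tendsto (fun n => eLpNorm (fun x => a n x - u x) 2 (volume.restrict Ω)) atTop (𝓝 0))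
    (h2 : Tendsto (fun n => eLpNorm (fun x => ∇ (a n) x - G x) 2 (volume.restrict Ω)) atTop
      (𝓝 0)) : IsW012 Ω u G :=
  ⟨.of_tendsto (fun n => hasWeakGradient_of_contDiff (ha n).contDiff) (fun n => (ha n).memLp 2)
    (fun n => (ha n).memLp_gradient 2) hu hG h1 h2, hu, hG, a, ha, h1, h2⟩

theorem IsTest.isW012 (hφ : IsTest Ω φ) : IsW012 Ω φ (∇ φ) :=
  isW012_of_tendsto_test (a := fun _ => φ) (fun _ => hφ) (hφ.memLp 2) (hφ.memLp_gradient 2)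
    (by simp) (by simp)

theorem eLpNorm_sub_le_add {α F : Type*} [MeasurableSpace α] {μ : Measure α}
    [NormedAddCommGroup F] {r : ℝ≥0∞} (hr : 1 ≤ r) {f g h : α → F} (hf : AEStronglyMeasurable f μ)
    (hg : AEStronglyMeasurable g μ) (hh : AEStronglyMeasurable h μ) :
    eLpNorm (fun x => f x - h x) r μ
      ≤ eLpNorm (fun x => f x - g x) r μ + eLpNorm (fun x => g x - h x) r μ := by
  refine le_trans (eLpNorm_congr_ae (ae_of_all _ fun x => ?_)).le
    (eLpNorm_add_le (hf.sub hg) (hg.sub hh) hr)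
  simp

/-- A diagonal argument: each `a n` is replaced by a test function within `1 / n`. -/
theorem isW012_of_tendsto {a : ℕ → Rn N → ℝ} {A : ℕ → Rn N → Rn N}
    (ha : ∀ n, IsW012 Ω (a n) (A n))
    (hu : MemLp u 2 (volume.restrict Ω)) (hG : MemLp G 2 (volume.restrict Ω))
    (h1 : Tendsto (fun n => eLpNorm (fun x => a n x - u x) 2 (volume.restrict Ω)) atTop (𝓝 0))
    (h2 : Tendsto (fun n => eLpNorm (fun x => A n x - G x) 2 (volume.restrict Ω)) atTop (𝓝 0)) :
    IsW012 Ω u G := by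
  have hex : ∀ n : ℕ, ∃ φ, IsTest Ω φ ∧
      eLpNorm (fun x => φ x - a n x) 2 (volume.restrict Ω) < ((n : ℝ≥0∞))⁻¹ ∧
      eLpNorm (fun x => ∇ φ x - A n x) 2 (volume.restrict Ω) < ((n : ℝ≥0∞))⁻¹ := fun n => by
    obtain ⟨b, hb, hb1, hb2⟩ := (ha n).exists_seq
    have hpos : (0 : ℝ≥0∞) < ((n : ℝ≥0∞))⁻¹ := by simp
    obtain ⟨k, h3, h4⟩ := ((hb1.eventually (gt_mem_nhds hpos)).and
      (hb2.eventually (gt_mem_nhds hpos))).exists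
    exact ⟨b k, hb k, h3, h4⟩
  choose φ hφ hφ1 hφ2 using hex
  refine isW012_of_tendsto_test hφ hu hG ?_ ?_
  · refine tendsto_of_tendsto_of_tendsto_of_le_of_le tendsto_const_nhds
      (by simpa using ENNReal.tendsto_inv_nat_nhds_zero.add h1) (fun _ => zero_le) fun n => ?_
    exact (eLpNorm_sub_le_add (by norm_num) ((hφ n).memLp 2).1 (ha n).memLp.1 hu.1).trans
      (add_le_add_left (hφ1 n).le _)
  · refine tendsto_of_tendsto_of_tendsto_of_le_of_le tendsto_const_nhds
      (by simpa using ENNReal.tendsto_inv_nat_nhds_zero.add h2) (fun _ => zero_le) fun n => ?_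
    exact (eLpNorm_sub_le_add (by norm_num) ((hφ n).memLp_gradient 2).1 (ha n).memLp_grad.1
      hG.1).trans (add_le_add_left (hφ2 n).le _)

/-- Functions in `W₀^{1,2}(Ω)` extended by zero have a weak gradient in the whole space. -/
theorem IsW012.hasWeakGradient_indicator (hΩ : IsOpen Ω) (hu : IsW012 Ω u G) :
    HasWeakGradient univ (Ω.indicator u) (Ω.indicator G) := by
  -- The approximating test functions vanish outside `Ω`, so their `L²(Ω)` distances to `u` and `G`
  -- equal the whole-space distances to the extensions by zero.
  obtain ⟨a, ha, ha1, ha2⟩ := hu.4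
  have hm := hΩ.measurableSet
  refine .of_tendsto (a := a) (A := fun n => ∇ (a n))
    (fun n => hasWeakGradient_of_contDiff (ha n).contDiff) (fun n => (ha n).memLp 2)
    (fun n => (ha n).memLp_gradient 2) ?_ ?_ (ha1.congr fun n => ?_) (ha2.congr fun n => ?_)
  · rw [Measure.restrict_univ, memLp_indicator_iff_restrict hm]; exact hu.2
  · rw [Measure.restrict_univ, memLp_indicator_iff_restrict hm]; exact hu.3
  · rw [Measure.restrict_univ, ← eLpNorm_indicator_eq_eLpNorm_restrict hm]
    congr 1; ext x
    by_cases hx : x ∈ Ω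
    · simp [hx]
    · simp [hx, image_eq_zero_of_notMem_tsupport fun h => hx ((ha n).tsupport_subset h)]
  · rw [Measure.restrict_univ, ← eLpNorm_indicator_eq_eLpNorm_restrict hm]
    congr 1; ext1 x
    by_cases hx : x ∈ Ω
    · simp [hx]
    · simp [hx, IsTest.gradient_eq_zero fun h => hx ((ha n).tsupport_subset h)]

end Sobolev

/-! ### Chain rule, multiplication by cutoffs and the Poincaré inequality. -/

section Sobolev

open scoped ENNReal

variable {N : ℕ} {Ω D₂ S : Set (Rn N)} {p : ℝ} {u v φ ψ : Rn N → ℝ} {G H : Rn N → Rn N}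

/-- A smooth contraction of the line fixing the origin. -/
structure IsSmoothContraction (F : ℝ → ℝ) : Prop where
  contDiff : ContDiff ℝ ∞ F
  map_zero : F 0 = 0
  abs_deriv_le : ∀ s, |deriv F s| ≤ 1

theorem IsSmoothContraction.abs_sub_le {F : ℝ → ℝ} (hF : IsSmoothContraction F) (s t : ℝ) :
    |F s - F t| ≤ |s - t| := by
  have := convex_univ.norm_image_sub_le_of_norm_deriv_le (f := F) (C := 1) (x := t) (y := s)
    (fun x _ => hF.contDiff.differentiable (by simp) x) (fun x _ => hF.abs_deriv_le x)
    (mem_univ _) (mem_univ _)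
  simpa using this

theorem IsSmoothContraction.abs_le {F : ℝ → ℝ} (hF : IsSmoothContraction F) (s : ℝ) :
    |F s| ≤ |s| := by
  simpa [hF.map_zero] using hF.abs_sub_le s 0

theorem IsSmoothContraction.continuous_deriv {F : ℝ → ℝ} (hF : IsSmoothContraction F) :
    Continuous (deriv F) :=
  hF.contDiff.continuous_deriv (by simp)

theorem IsTest.comp {F : ℝ → ℝ} (hF : IsSmoothContraction F) (hφ : IsTest Ω φ) :
    IsTest Ω fun x => F (φ x) where
  contDiff := hF.contDiff.comp hφ.contDiff
  hasCompactSupport := hφ.hasCompactSupport.comp_left hF.map_zero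
  tsupport_subset :=
    (closure_mono (Function.support_comp_subset hF.map_zero φ)).trans hφ.tsupport_subset

theorem gradient_comp_apply {F : ℝ → ℝ} (hF : Differentiable ℝ F) (hφ : Differentiable ℝ φ)
    (x : Rn N) : ∇ (fun x => F (φ x)) x = deriv F (φ x) • ∇ φ x := by
  have h : HasFDerivAt (fun x => F (φ x)) (deriv F (φ x) • fderiv ℝ φ x) x :=
    (hF (φ x)).hasDerivAt.comp_hasFDerivAt x (hφ x).hasFDerivAt
  simp [gradient, h.fderiv]

theorem gradient_mul_apply (hψ : Differentiable ℝ ψ) (hφ : Differentiable ℝ φ)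
    (x : Rn N) : ∇ (fun x => ψ x * φ x) x = ψ x • ∇ φ x + φ x • ∇ ψ x := by
  simp [gradient, fderiv_fun_mul (hψ x) (hφ x)]

theorem tendsto_of_le_add {a b c : ℕ → ℝ≥0∞} (h : ∀ n, a n ≤ b n + c n)
    (hb : Tendsto b atTop (𝓝 0)) (hc : Tendsto c atTop (𝓝 0)) : Tendsto a atTop (𝓝 0) :=
  tendsto_of_tendsto_of_tendsto_of_le_of_le tendsto_const_nhds (by simpa using hb.add hc)
    (fun _ => zero_le) h

/-- The chain rule in `W₀^{1,2}(Ω)`. -/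
theorem IsW012.comp {F : ℝ → ℝ} (hF : IsSmoothContraction F) (hu : IsW012 Ω u G) :
    IsW012 Ω (fun x => F (u x)) (fun x => deriv F (u x) • G x) := by
  obtain ⟨a, ha, ha1, ha2⟩ := hu.4
  have hmeas : TendstoInMeasure (volume.restrict Ω) a atTop u :=
    tendstoInMeasure_of_tendsto_eLpNorm (by norm_num) (fun n => ((ha n).memLp 2).1) hu.2.1 ha1
  obtain ⟨ns, hns, hae⟩ := hmeas.exists_seq_tendsto_ae
  have hd := hF.continuous_deriv
  have hFu : MemLp (fun x => F (u x)) 2 (volume.restrict Ω) :=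
    hu.2.mono (hF.contDiff.continuous.comp_aestronglyMeasurable hu.2.1)
      (ae_of_all _ fun x => hF.abs_le (u x))
  have hdu : AEStronglyMeasurable (fun x => deriv F (u x)) (volume.restrict Ω) :=
    hd.comp_aestronglyMeasurable hu.2.1
  have hFG : MemLp (fun x => deriv F (u x) • G x) 2 (volume.restrict Ω) := by
    refine hu.3.mono (hdu.smul hu.3.1) (ae_of_all _ fun x => ?_)
    rw [norm_smul]
    exact mul_le_of_le_one_left (norm_nonneg _) (hF.abs_deriv_le _)
  refine isW012_of_tendsto_test (a := fun n x => F (a (ns n) x)) (fun n => (ha _).comp hF)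
    hFu hFG ?_ ?_
  · refine tendsto_of_tendsto_of_tendsto_of_le_of_le tendsto_const_nhds
      (ha1.comp hns.tendsto_atTop) (fun _ => zero_le) fun n => ?_
    exact eLpNorm_mono fun x => hF.abs_sub_le _ _
  -- The coefficient converges only almost everywhere, along a subsequence, but it is bounded and
  -- multiplies the fixed function `G`, so dominated convergence applies.
  · have h1 : Tendsto (fun n => eLpNorm (fun x => (deriv F (a (ns n) x) - deriv F (u x)) • G x) 2
        (volume.restrict Ω)) atTop (𝓝 0) := by
      refine tendsto_eLpNorm_smul_zero (by norm_num) (by norm_num) hu.3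
        (fun n => (hd.comp_aestronglyMeasurable ((ha (ns n)).memLp 2).1).sub hdu)
        (K := 2) (fun n x => ?_) ?_
      · refine (abs_sub _ _).trans ?_
        linarith [hF.abs_deriv_le (a (ns n) x), hF.abs_deriv_le (u x)]
      · filter_upwards [hae] with x hx
        simpa using ((hd.tendsto _).comp hx).sub_const (deriv F (u x))
    refine tendsto_of_le_add (fun n => ?_) (ha2.comp hns.tendsto_atTop) h1
    have e : (fun x => ∇ (fun x => F (a (ns n) x)) x - deriv F (u x) • G x)
        = (fun x => deriv F (a (ns n) x) • (∇ (a (ns n)) x - G x))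
          + fun x => (deriv F (a (ns n) x) - deriv F (u x)) • G x := by
      ext1 x
      rw [gradient_comp_apply (hF.contDiff.differentiable (by simp)) (ha _).differentiable]
      simp only [Pi.add_apply, smul_sub, sub_smul]
      abel
    have hm1 : AEStronglyMeasurable (fun x => ∇ (a (ns n)) x - G x) (volume.restrict Ω) :=
      ((ha _).memLp_gradient 2).1.sub hu.3.1
    have hm2 := hd.comp_aestronglyMeasurable ((ha (ns n)).memLp (S := Ω) 2).1
    rw [e]
    refine (eLpNorm_add_le (hm2.smul hm1) ((hm2.sub hdu).smul hu.3.1) (by norm_num)).trans ?_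
    refine add_le_add_left (eLpNorm_mono fun x => ?_) _
    rw [Pi.smul_apply', norm_smul]
    exact mul_le_of_le_one_left (norm_nonneg _) (hF.abs_deriv_le _)

theorem IsTest.mul {χ : Rn N → ℝ} (hχ : ContDiff ℝ ∞ χ) (hφ : IsTest Ω φ) :
    IsTest Ω fun x => χ x * φ x where
  contDiff := hχ.mul hφ.contDiff
  hasCompactSupport := hφ.hasCompactSupport.mul_left
  tsupport_subset := (tsupport_mul_subset_right (f := χ) (g := φ)).trans hφ.tsupport_subset

theorem IsW012.test_mul {χ : Rn N → ℝ} (hχ : IsTest univ χ) (hu : IsW012 Ω u G) :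
    IsW012 Ω (fun x => χ x * u x) (fun x => χ x • G x + u x • ∇ χ x) := by
  obtain ⟨a, ha, ha1, ha2⟩ := hu.4
  have hcχ := hχ.contDiff.continuous
  obtain ⟨K, hK⟩ := hχ.hasCompactSupport.exists_bound_of_continuous hcχ
  obtain ⟨L, hL⟩ := (HasCompactSupport.intro hχ.hasCompactSupport fun x hx =>
    IsTest.gradient_eq_zero hx).exists_bound_of_continuous hχ.continuous_gradient
  have b1 : ∀ (w : Rn N → ℝ) (x : Rn N), ‖χ x * w x‖ ≤ K * ‖w x‖ := fun w x => by
    rw [norm_mul]; gcongr; exact hK x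
  have b2 : ∀ (W : Rn N → Rn N) (x : Rn N), ‖χ x • W x‖ ≤ K * ‖W x‖ := fun w x => by
    rw [norm_smul]; gcongr; exact hK x
  have b3 : ∀ (w : Rn N → ℝ) (x : Rn N), ‖w x • ∇ χ x‖ ≤ L * ‖w x‖ := fun w x => by
    rw [norm_smul, mul_comm]; gcongr; exact hL x
  have c1 : AEStronglyMeasurable χ (volume.restrict Ω) := hcχ.aestronglyMeasurable
  have c2 : AEStronglyMeasurable (∇ χ) (volume.restrict Ω) :=
    hχ.continuous_gradient.aestronglyMeasurable
  have hm : MemLp (fun x => χ x * u x) 2 (volume.restrict Ω) :=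
    hu.2.of_le_mul (c1.mul hu.2.1) (ae_of_all _ (b1 u))
  have hM1 : MemLp (fun x => χ x • G x) 2 (volume.restrict Ω) :=
    hu.3.of_le_mul (c1.smul hu.3.1) (ae_of_all _ (b2 G))
  have hM2 : MemLp (fun x => u x • ∇ χ x) 2 (volume.restrict Ω) :=
    hu.2.of_le_mul (hu.2.1.smul c2) (ae_of_all _ (b3 u))
  have lim : ∀ (M : ℝ) {e : ℕ → ℝ≥0∞}, Tendsto e atTop (𝓝 0) →
      Tendsto (fun n => ENNReal.ofReal M * e n) atTop (𝓝 0) := fun M e he => by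
    simpa using ENNReal.Tendsto.const_mul he (Or.inr (ENNReal.ofReal_ne_top (r := M)))
  refine isW012_of_tendsto_test (a := fun n x => χ x * a n x) (fun n => (ha n).mul hχ.contDiff)
    hm (hM1.add hM2) ?_ ?_
  · refine tendsto_of_tendsto_of_tendsto_of_le_of_le tendsto_const_nhds (lim K ha1)
      (fun _ => zero_le) fun n => ?_
    refine eLpNorm_le_mul_eLpNorm_of_ae_le_mul (ae_of_all _ fun x => ?_) _
    rw [← mul_sub]
    exact b1 (fun x => a n x - u x) x
  · refine tendsto_of_le_add (fun n => ?_) (lim K ha2) (lim L ha1)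
    have e : (fun x => ∇ (fun x => χ x * a n x) x - (χ x • G x + u x • ∇ χ x))
        = (fun x => χ x • (∇ (a n) x - G x)) + fun x => (a n x - u x) • ∇ χ x := by
      ext1 x
      rw [gradient_mul_apply hχ.differentiable (ha _).differentiable]
      simp only [Pi.add_apply, smul_sub, sub_smul]
      abel
    have m1 : AEStronglyMeasurable (fun x => ∇ (a n) x - G x) (volume.restrict Ω) :=
      ((ha n).memLp_gradient 2).1.sub hu.3.1
    have m2 : AEStronglyMeasurable (fun x => a n x - u x) (volume.restrict Ω) :=
      ((ha n).memLp 2).1.sub hu.2.1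
    rw [e]
    refine (eLpNorm_add_le (c1.smul m1) (m2.smul c2) (by norm_num)).trans ?_
    exact add_le_add
      (eLpNorm_le_mul_eLpNorm_of_ae_le_mul (ae_of_all _ (b2 fun x => ∇ (a n) x - G x)) _)
      (eLpNorm_le_mul_eLpNorm_of_ae_le_mul (ae_of_all _ (b3 fun x => a n x - u x)) _)

/-- `φ ^ 2` times the derivative `1` of `⟪e, x⟫` along a unit vector `e` is integrated by parts. As
`|⟪e, x⟫| ≤ R` where `φ ≠ 0`, the result is at most `φ ^ 2 / 2 + 2 * R ^ 2 * ‖∇ φ‖ ^ 2`, and the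
first term is absorbed. -/
theorem IsTest.integral_sq_le (hN : 1 ≤ N) {R : ℝ} (hΩ : Ω ⊆ Metric.closedBall 0 R)
    (hφ : IsTest Ω φ) : ∫ x, φ x ^ 2 ≤ (2 * R) ^ 2 * ∫ x, ‖∇ φ x‖ ^ 2 := by
  set e : Rn N := EuclideanSpace.single ⟨0, hN⟩ 1 with he
  have hne : ‖e‖ = 1 := by simp [he]
  have hee : ⟪e, e⟫ = 1 := by rw [real_inner_self_eq_norm_sq, hne]; norm_num
  have hcφ := hφ.contDiff.continuous
  have hcg := hφ.continuous_gradient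
  have hs := hφ.hasCompactSupport
  have hsq : IsTest Ω fun x => φ x * φ x := hφ.mul hφ.contDiff
  have hlin : ContDiff ℝ ∞ fun x : Rn N => ⟪e, x⟫ := contDiff_const.inner ℝ contDiff_id
  have h1 := hsq.integral_mul_fderiv hlin e
  have e1 : ∀ x, fderiv ℝ (fun x : Rn N => ⟪e, x⟫) x e = 1 := fun x => by
    have : HasFDerivAt (fun x : Rn N => ⟪e, x⟫) (innerSL ℝ e) x := (innerSL ℝ e).hasFDerivAt
    rw [this.fderiv, innerSL_apply_apply, hee]
  have e2 : ∀ x, fderiv ℝ (fun x => φ x * φ x) x e = 2 * φ x * ⟪∇ φ x, e⟫ := fun x => by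
    rw [← gradient_inner, gradient_mul_apply hφ.differentiable hφ.differentiable, inner_add_left,
      real_inner_smul_left]
    ring
  simp only [e1, e2, mul_one] at h1
  have i1 : Integrable fun x => φ x ^ 2 :=
    Continuous.integrable_of_hasCompactSupport (by fun_prop)
      (HasCompactSupport.intro hs fun x hx => by
        rw [image_eq_zero_of_notMem_tsupport hx]; simp)
  have i2 : Integrable fun x => ‖∇ φ x‖ ^ 2 :=
    Continuous.integrable_of_hasCompactSupport (by fun_prop)
      (HasCompactSupport.intro hs fun x hx => by
        rw [IsTest.gradient_eq_zero hx]; simp)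
  have i3 : Integrable fun x => 2 * φ x * ⟪∇ φ x, e⟫ * ⟪e, x⟫ :=
    Continuous.integrable_of_hasCompactSupport (by fun_prop)
      (HasCompactSupport.intro hs fun x hx => by
        rw [image_eq_zero_of_notMem_tsupport hx]; simp)
  have hpt : ∀ x, -(2 * φ x * ⟪∇ φ x, e⟫ * ⟪e, x⟫) ≤ φ x ^ 2 / 2 + 2 * R ^ 2 * ‖∇ φ x‖ ^ 2 := by
    intro x
    by_cases hx : φ x = 0
    · rw [hx]; simp; positivity
    have hxR : ‖x‖ ≤ R := by
      have := hΩ (hφ.tsupport_subset (subset_tsupport _ hx))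
      simpa using this
    have b1 : |⟪∇ φ x, e⟫| ≤ ‖∇ φ x‖ := by simpa [hne] using abs_real_inner_le_norm (∇ φ x) e
    have b2 : |⟪e, x⟫| ≤ R := by
      refine (abs_real_inner_le_norm e x).trans ?_
      rw [hne, one_mul]; exact hxR
    have b3 : (⟪∇ φ x, e⟫ * ⟪e, x⟫) ^ 2 ≤ (‖∇ φ x‖ * R) ^ 2 := by
      rw [sq_le_sq, abs_mul, abs_mul, abs_of_nonneg (norm_nonneg (∇ φ x))]
      exact mul_le_mul b1 (b2.trans (le_abs_self R)) (abs_nonneg _) (norm_nonneg _)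
    nlinarith [sq_nonneg (φ x + 2 * (⟪∇ φ x, e⟫ * ⟪e, x⟫))]
  have h2 : ∫ x, φ x ^ 2 ≤ ∫ x, (φ x ^ 2 / 2 + 2 * R ^ 2 * ‖∇ φ x‖ ^ 2) := by
    have : ∫ x, φ x ^ 2 = ∫ x, -(2 * φ x * ⟪∇ φ x, e⟫ * ⟪e, x⟫) := by
      rw [integral_neg, ← h1]; simp only [sq]
    rw [this]
    exact integral_mono i3.neg ((i1.div_const 2).add (i2.const_mul _)) hpt
  rw [integral_add (i1.div_const 2) (i2.const_mul _), integral_div, integral_const_mul] at h2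
  linarith

theorem eLpNorm_two_eq {F : Type*} [NormedAddCommGroup F] {f : Rn N → F} (hf : MemLp f 2 volume) :
    eLpNorm f 2 volume = ENNReal.ofReal (√(∫ x, ‖f x‖ ^ 2)) := by
  rw [hf.eLpNorm_eq_integral_rpow_norm (by norm_num) (by norm_num), Real.sqrt_eq_rpow]
  simp

/-- The Poincaré inequality. -/
theorem IsW012.poincare (hN : 1 ≤ N) (hO : IsOpen Ω) {R : ℝ} (hR : 0 ≤ R)
    (hΩ : Ω ⊆ Metric.closedBall 0 R) (hu : IsW012 Ω u G) :
    eLpNorm u 2 (volume.restrict Ω) ≤ ENNReal.ofReal (2 * R) * eLpNorm G 2 (volume.restrict Ω) := by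
  obtain ⟨a, ha, ha1, ha2⟩ := hu.4
  have hm := hO.measurableSet
  have key : ∀ n, eLpNorm (a n) 2 (volume.restrict Ω)
      ≤ ENNReal.ofReal (2 * R) * eLpNorm (∇ (a n)) 2 (volume.restrict Ω) := fun n => by
    have e1 : Ω.indicator (a n) = a n := by
      refine indicator_eq_self.2 ?_
      exact (subset_tsupport _).trans (ha n).tsupport_subset
    have e2 : Ω.indicator (∇ (a n)) = ∇ (a n) := by
      refine indicator_eq_self.2 fun x hx => (ha n).tsupport_subset ?_
      by_contra h
      exact hx (IsTest.gradient_eq_zero h)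
    rw [← eLpNorm_indicator_eq_eLpNorm_restrict hm, e1, ← eLpNorm_indicator_eq_eLpNorm_restrict hm,
      e2, eLpNorm_two_eq (by simpa using (ha n).memLp (S := univ) 2),
      eLpNorm_two_eq (by simpa using (ha n).memLp_gradient (S := univ) 2),
      ← ENNReal.ofReal_mul (by positivity)]
    refine ENNReal.ofReal_le_ofReal ?_
    have := (ha n).integral_sq_le hN hΩ
    rw [← Real.sqrt_sq (by positivity : (0 : ℝ) ≤ 2 * R), ← Real.sqrt_mul (by positivity)]
    exact Real.sqrt_le_sqrt (by simpa using this)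
  have l1 : Tendsto (fun n => eLpNorm (fun x => a n x - u x) 2 (volume.restrict Ω)
      + ENNReal.ofReal (2 * R) * (eLpNorm (fun x => ∇ (a n) x - G x) 2 (volume.restrict Ω)
        + eLpNorm G 2 (volume.restrict Ω))) atTop
      (𝓝 (ENNReal.ofReal (2 * R) * eLpNorm G 2 (volume.restrict Ω))) := by
    have := ha1.add (ENNReal.Tendsto.const_mul (a := ENNReal.ofReal (2 * R))
      (ha2.add_const (eLpNorm G 2 (volume.restrict Ω))) (Or.inr ENNReal.ofReal_ne_top))
    simpa using this
  refine ge_of_tendsto' l1 fun n => ?_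
  have t1 : eLpNorm u 2 (volume.restrict Ω) ≤ eLpNorm (fun x => a n x - u x) 2 (volume.restrict Ω)
      + eLpNorm (a n) 2 (volume.restrict Ω) := by
    have := eLpNorm_sub_le (((ha n).memLp (S := Ω) 2).1) (((ha n).memLp (S := Ω) 2).1.sub hu.2.1)
      (p := 2) (by norm_num)
    rw [sub_sub_cancel, add_comm] at this
    exact this
  have t2 : eLpNorm (∇ (a n)) 2 (volume.restrict Ω)
      ≤ eLpNorm (fun x => ∇ (a n) x - G x) 2 (volume.restrict Ω)
        + eLpNorm G 2 (volume.restrict Ω) := by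
    have := eLpNorm_add_le (((ha n).memLp_gradient (S := Ω) 2).1.sub hu.3.1) hu.3.1
      (p := 2) (by norm_num)
    rw [sub_add_cancel] at this
    exact this
  exact t1.trans (add_le_add_right ((key n).trans (by gcongr)) _)

end Sobolev

/-! ### Density of test functions in `𝒲(Ω)`, preserving nonnegativity. -/

section Density

open scoped ENNReal Pointwise

variable {N : ℕ} {Ω D₁ D₂ : Set (Rn N)} {r : ℝ≥0∞} {σ : Prop} {u v φ : Rn N → ℝ}
  {G H V : Rn N → Rn N}

/-- `G` is a limit, in `L²(Ω)` and in `Lʳ(D₂)`, of gradients of functions in `C_c^∞(Ω)`, which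
are nonnegative if `σ` holds. -/
def IsTestGradLimit (Ω D₂ : Set (Rn N)) (r : ℝ≥0∞) (σ : Prop) (G : Rn N → Rn N) : Prop :=
  ∀ ε : ℝ≥0∞, 0 < ε → ∃ φ, IsTest Ω φ ∧ (σ → ∀ x, 0 ≤ φ x) ∧
    eLpNorm (fun x => ∇ φ x - G x) 2 (volume.restrict Ω) ≤ ε ∧
    eLpNorm (fun x => ∇ φ x - G x) r (volume.restrict D₂) ≤ ε

theorem IsTestGradLimit.add (hr : 1 ≤ r) (hG : IsTestGradLimit Ω D₂ r σ G)
    (hH : IsTestGradLimit Ω D₂ r σ H) (hG2 : AEStronglyMeasurable G (volume.restrict Ω))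
    (hH2 : AEStronglyMeasurable H (volume.restrict Ω)) (hD : D₂ ⊆ Ω) :
    IsTestGradLimit Ω D₂ r σ fun x => G x + H x := fun ε hε => by
  obtain ⟨φ, h1, h2, h3, h4⟩ := hG (ε / 2) (ENNReal.half_pos hε.ne')
  obtain ⟨ψ, k1, k2, k3, k4⟩ := hH (ε / 2) (ENNReal.half_pos hε.ne')
  have e : (fun x => ∇ (fun y => φ y + ψ y) x - (G x + H x))
      = (fun x => ∇ φ x - G x) + fun x => ∇ ψ x - H x := by
    ext1 x
    rw [gradient_add_apply h1.differentiable k1.differentiable]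
    simp only [Pi.add_apply]; abel
  have m1 : AEStronglyMeasurable (fun x => ∇ φ x - G x) (volume.restrict Ω) :=
    h1.continuous_gradient.aestronglyMeasurable.sub hG2
  have m2 : AEStronglyMeasurable (fun x => ∇ ψ x - H x) (volume.restrict Ω) :=
    k1.continuous_gradient.aestronglyMeasurable.sub hH2
  have hle := Measure.restrict_mono hD (le_refl (volume : Measure (Rn N)))
  refine ⟨_, h1.add k1, fun s x => add_nonneg (h2 s x) (k2 s x), ?_, ?_⟩
  · rw [e, ← ENNReal.add_halves ε]
    exact (eLpNorm_add_le m1 m2 (by norm_num)).trans (add_le_add h3 k3)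
  · rw [e, ← ENNReal.add_halves ε]
    exact (eLpNorm_add_le (m1.mono_measure hle) (m2.mono_measure hle) hr).trans (add_le_add h4 k4)

theorem IsTestGradLimit.congr (hG : IsTestGradLimit Ω D₂ r σ G) (hD : D₂ ⊆ Ω)
    (h : G =ᵐ[volume.restrict Ω] H) : IsTestGradLimit Ω D₂ r σ H := fun ε hε => by
  obtain ⟨φ, h1, h2, h3, h4⟩ := hG ε hε
  refine ⟨φ, h1, h2, ?_, ?_⟩
  · refine (eLpNorm_congr_ae ?_).trans_le h3
    filter_upwards [h] with x hx; rw [hx]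
  · refine (eLpNorm_congr_ae ?_).trans_le h4
    filter_upwards [ae_restrict_of_ae_restrict_of_subset hD h] with x hx; rw [hx]

theorem IsTestGradLimit.of_tendsto (hr : 1 ≤ r) (hD : D₂ ⊆ Ω) {A : ℕ → Rn N → Rn N}
    (hA : ∀ n, IsTestGradLimit Ω D₂ r σ (A n))
    (hAm : ∀ n, AEStronglyMeasurable (A n) (volume.restrict Ω))
    (hG : AEStronglyMeasurable G (volume.restrict Ω))
    (h1 : Tendsto (fun n => eLpNorm (fun x => A n x - G x) 2 (volume.restrict Ω)) atTop (𝓝 0))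
    (h2 : Tendsto (fun n => eLpNorm (fun x => A n x - G x) r (volume.restrict D₂)) atTop (𝓝 0)) :
    IsTestGradLimit Ω D₂ r σ G := fun ε hε => by
  have hε2 := ENNReal.half_pos hε.ne'
  obtain ⟨n, hn1, hn2⟩ := ((h1.eventually (gt_mem_nhds hε2)).and
    (h2.eventually (gt_mem_nhds hε2))).exists
  obtain ⟨φ, k1, k2, k3, k4⟩ := hA n _ hε2
  have hle := Measure.restrict_mono hD (le_refl (volume : Measure (Rn N)))
  have m : AEStronglyMeasurable (∇ φ) (volume.restrict Ω) :=
    k1.continuous_gradient.aestronglyMeasurable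
  refine ⟨φ, k1, k2, ?_, ?_⟩
  · rw [← ENNReal.add_halves ε]
    exact (eLpNorm_sub_le_add (by norm_num) m (hAm n) hG).trans (add_le_add k3 hn1.le)
  · rw [← ENNReal.add_halves ε]
    exact (eLpNorm_sub_le_add hr (m.mono_measure hle) ((hAm n).mono_measure hle)
      (hG.mono_measure hle)).trans (add_le_add k4 hn2.le)

/-- A common radius for the stability of `Ω` and `D₁` under translations near `x₀`. -/
theorem IsSplitting.exists_direction (h : IsSplitting Ω D₁ D₂) {x₀ : Rn N}
    (hx₀ : x₀ ∈ closure Ω) : ∃ d : Rn N, ∃ δ > 0, ∀ y, dist y x₀ < δ → ∀ t : ℝ, 0 < t → t < δ →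
      ∀ z : Rn N, ‖z - t • d‖ < δ * t → (y ∈ closure Ω → y + z ∈ Ω) ∧ (y ∈ D₁ → y + z ∈ D₁) := by
  obtain ⟨d, hΩ, δ₁, hδ₁, h₁⟩ := h.exists_coneAt hx₀
  obtain ⟨δ₀, hδ₀, h₀⟩ := hΩ.closure
  refine ⟨d, min δ₀ δ₁, lt_min hδ₀ hδ₁, fun y hy t ht htδ z hz => ?_⟩
  have e : y + z = y + t • d + (z - t • d) := by abel
  have m0 : min δ₀ δ₁ ≤ δ₀ := min_le_left _ _
  have m1 : min δ₀ δ₁ ≤ δ₁ := min_le_right _ _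
  rw [e]
  exact ⟨fun hy' => h₀ y hy' (hy.trans_le m0) t ht (htδ.trans_le m0) _ (hz.trans_le (by gcongr)),
    fun hy' => h₁ y hy' (hy.trans_le m1) t ht (htδ.trans_le m1) _ (hz.trans_le (by gcongr))⟩

/-- A kernel supported close to `t • d`. -/
theorem exists_isKernel {ρ : ℝ} (hρ : 0 < ρ) (c : Rn N) :
    ∃ η : Rn N → ℝ, IsKernel η ∧ tsupport η ⊆ Metric.closedBall c ρ := by
  let f : ContDiffBump c := ⟨ρ / 2, ρ, by positivity, by linarith⟩
  exact ⟨f.normed volume, ⟨f.contDiff_normed, f.hasCompactSupport_normed, f.nonneg_normed,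
    f.integral_normed⟩, (f.tsupport_normed_eq (μ := volume)).subset⟩

theorem IsSplitting.indicator_compl_ae_eq (h : IsSplitting Ω D₁ D₂) (V : Rn N → Rn N) :
    D₁ᶜ.indicator (Ω.indicator V) =ᵐ[volume] D₂.indicator V := by
  filter_upwards [h.ae_mem] with x hx
  by_cases hΩ : x ∈ Ω
  · rcases hx hΩ with h1 | h2
    · have h2 : x ∉ D₂ := fun h2 => h.disjoint.subset ⟨h1, h2⟩
      simp [h1, h2]
    · have h1 : x ∉ D₁ := fun h1 => h.disjoint.subset ⟨h1, h2⟩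
      simp [h1, h2, hΩ]
  · have h2 : x ∉ D₂ := fun h2 => hΩ (h.subset₂ h2)
    simp [hΩ, h2, indicator]

/-- The one-sided mollification: the kernel is supported in the common cone near `x₀`, so averaging
at a point of `D₂` uses no value of `V` from `D₁`, and the support moves inside `Ω`. -/
theorem IsSplitting.isTestGradLimit_of_local (h : IsSplitting Ω D₁ D₂) (hr : 1 ≤ r) (hr' : r ≠ ⊤)
    {x₀ d : Rn N} {δ ρ : ℝ} (hδ : 0 < δ) (hρ : ρ < δ)
    (hcone : ∀ y, dist y x₀ < δ → ∀ t : ℝ, 0 < t → t < δ →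
      ∀ z : Rn N, ‖z - t • d‖ < δ * t → (y ∈ closure Ω → y + z ∈ Ω) ∧ (y ∈ D₁ → y + z ∈ D₁))
    (hv : IsW012 Ω v V) (hV : MemLp V r (volume.restrict D₂))
    (hv0 : ∀ x, ρ < dist x x₀ → v x = 0) (hV0 : ∀ x, ρ < dist x x₀ → V x = 0)
    (hσ : σ → ∀ᵐ x ∂(volume.restrict Ω), 0 ≤ v x) : IsTestGradLimit Ω D₂ r σ V := fun ε hε => by
  have hΩm := h.isOpen.measurableSet
  have hwg := hv.hasWeakGradient_indicator h.isOpen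
  have hloc : LocallyIntegrable (Ω.indicator v) := locallyIntegrableOn_univ.1 hwg.1
  have hV2 : MemLp (Ω.indicator V) 2 volume := (memLp_indicator_iff_restrict hΩm).2 hv.3
  -- Discarding the values in `D₁` leaves a field in `Lʳ` of the whole space. It is this field whose
  -- mollification is compared with `V` on `D₂`.
  have hVr : MemLp (D₁ᶜ.indicator (Ω.indicator V)) r volume :=
    (memLp_congr_ae (h.indicator_compl_ae_eq V)).2
      ((memLp_indicator_iff_restrict h.isOpen₂.measurableSet).2 hV)
  obtain ⟨ρ₁, hρ₁, h₁⟩ := exists_forall_eLpNorm_translate_sub_le (by norm_num) (by norm_num) hV2 hε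
  obtain ⟨ρ₂, hρ₂, h₂⟩ := exists_forall_eLpNorm_translate_sub_le hr hr' hVr hε
  set m := min ρ₁ ρ₂
  have hm0 : 0 < m := lt_min hρ₁ hρ₂
  -- Points of the kernel's support satisfy `‖z‖ ≤ t * ‖d‖ + δ * t`, so this keeps all translations
  -- within the range allowed by `ε`.
  obtain ⟨t, ht, htδ, htm⟩ : ∃ t : ℝ, 0 < t ∧ t < δ ∧ t * (‖d‖ + δ) < m := by
    refine ⟨min (δ / 2) (m / (2 * (‖d‖ + δ))), by positivity,
      (min_le_left _ _).trans_lt (by linarith), ?_⟩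
    calc _ ≤ m / (2 * (‖d‖ + δ)) * (‖d‖ + δ) := by gcongr; exact min_le_right _ _
      _ = m / 2 := by field_simp
      _ < m := by linarith
  obtain ⟨η, hη, hηs⟩ := exists_isKernel (ρ := δ * t / 2) (by positivity) (t • d)
  have hηb : ∀ z ∈ Metric.closedBall (t • d) (δ * t / 2), ‖z - t • d‖ < δ * t := fun z hz => by
    rw [Metric.mem_closedBall, dist_eq_norm] at hz
    have : 0 < δ * t := by positivity
    linarith
  have hηz : ∀ z, η z ≠ 0 → ‖z - t • d‖ < δ * t := fun z hz =>
    hηb z (hηs (subset_tsupport _ hz))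
  have hηm : ∀ z, η z ≠ 0 → ‖z‖ < m := fun z hz => by
    have e : z = t • d + (z - t • d) := by abel
    have h3 : ‖z‖ ≤ ‖t • d‖ + ‖z - t • d‖ := by
      conv_lhs => rw [e]
      exact norm_add_le _ _
    rw [norm_smul, Real.norm_of_nonneg ht.le] at h3
    linarith [hηz z hz]
  set K := (closure Ω ∩ Metric.closedBall x₀ ρ) + Metric.closedBall (t • d) (δ * t / 2)
  have hKc : IsCompact K :=
    ((Metric.isCompact_of_isClosed_isBounded isClosed_closure h.isBounded.closure).inter_right
      Metric.isClosed_closedBall).add (isCompact_closedBall _ _)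
  have hKΩ : K ⊆ Ω := by
    rintro _ ⟨y, ⟨hy, hyρ⟩, z, hz, rfl⟩
    exact (hcone y (hyρ.trans_lt hρ) t ht htδ z (hηb z hz)).1 hy
  set φ := mollify η (Ω.indicator v)
  have hsupp : Function.support φ ⊆ K := fun x hx => by
    obtain ⟨z, hz, hxz⟩ := mollify_ne_zero hx
    have hxΩ : x - z ∈ Ω := mem_of_indicator_ne_zero hxz
    rw [indicator_of_mem hxΩ] at hxz
    refine ⟨x - z, ⟨subset_closure hxΩ, ?_⟩, z, hηs (subset_tsupport _ hz), sub_add_cancel x z⟩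
    by_contra hc
    exact hxz (hv0 _ (by simpa using hc))
  have htsupp : tsupport φ ⊆ K := closure_minimal hsupp hKc.isClosed
  have hgrad : ∀ x, ∇ φ x = mollify η (Ω.indicator V) x := fun x => hη.gradient_mollify hwg x
  refine ⟨φ, ⟨hη.contDiff_mollify hloc, hKc.of_isClosed_subset (isClosed_tsupport _) htsupp,
    htsupp.trans hKΩ⟩, fun s x => ?_, ?_, ?_⟩
  · refine mollify_nonneg hη ?_ x
    filter_upwards [(ae_restrict_iff' hΩm).1 (hσ s)] with y hy
    exact indicator_apply_nonneg hy
  · have key := hη.eLpNorm_mollify_sub_le (by norm_num) (by norm_num) hV2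
      (fun z hz => h₁ z ((hηm z hz).trans_le (min_le_left _ _)))
    refine le_trans (eLpNorm_congr_ae ?_).le ((eLpNorm_mono_measure _
      (Measure.restrict_le_self (s := Ω))).trans key)
    filter_upwards [ae_restrict_mem hΩm] with x hx
    rw [hgrad, indicator_of_mem hx]
  · have key := hη.eLpNorm_mollify_sub_le hr hr' hVr
      (fun z hz => h₂ z ((hηm z hz).trans_le (min_le_right _ _)))
    refine le_trans (eLpNorm_congr_ae ?_).le ((eLpNorm_mono_measure _
      (Measure.restrict_le_self (s := D₂))).trans key)
    filter_upwards [ae_restrict_mem h.isOpen₂.measurableSet] with x hx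
    have hx1 : x ∉ D₁ := fun h1 => h.disjoint.subset ⟨h1, hx⟩
    rw [hgrad, indicator_of_mem (show x ∈ D₁ᶜ from hx1), indicator_of_mem (h.subset₂ hx)]
    congr 1
    refine integral_congr_ae (ae_of_all _ fun z => ?_)
    by_cases hz : η z = 0
    · simp [hz]
    simp only
    congr 1
    -- If `x - z` were in `D₁` near `x₀`, the cone property would put `x` in `D₁`; far from `x₀` the
    -- field `V` vanishes. Hence both mollifications agree on `D₂`.
    by_cases hxz : x - z ∈ D₁
    · rw [indicator_of_notMem (show x - z ∉ D₁ᶜ from fun hn => hn hxz)]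
      by_cases hd : dist (x - z) x₀ < δ
      · have := (hcone _ hd t ht htδ z (hηz z hz)).2 hxz
        rw [sub_add_cancel] at this
        exact absurd this hx1
      · rw [indicator_of_mem (h.subset₁ hxz), hV0 _ (hρ.trans_le (not_lt.1 hd))]
    · rw [indicator_of_mem (show x - z ∈ D₁ᶜ from hxz)]

/-- `u ∈ W₀^{1,2}(Ω)` with weak gradient `G` in `Lʳ(D₂)`. -/
structure IsW (Ω D₂ : Set (Rn N)) (r : ℝ≥0∞) (u : Rn N → ℝ) (G : Rn N → Rn N) : Prop where
  isW012 : IsW012 Ω u G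
  memLp : MemLp G r (volume.restrict D₂)

theorem IsW.add (hu : IsW Ω D₂ r u G) (hv : IsW Ω D₂ r v H) :
    IsW Ω D₂ r (fun x => u x + v x) fun x => G x + H x :=
  ⟨hu.1.add hv.1, hu.2.add hv.2⟩

theorem IsW.const_mul (c : ℝ) (hu : IsW Ω D₂ r u G) :
    IsW Ω D₂ r (fun x => c * u x) fun x => c • G x :=
  ⟨hu.1.const_mul c, hu.2.const_smul c⟩

theorem IsW.sub (hu : IsW Ω D₂ r u G) (hv : IsW Ω D₂ r v H) :
    IsW Ω D₂ r (fun x => u x - v x) fun x => G x - H x := by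
  convert hu.add (hv.const_mul (-1)) using 2
  · ring
  · module

/-- Induction on the number of balls: `u = f * u + (1 - f) * u` with a cutoff `f` equal to `1` on
one ball. The first piece is local, the second lives on the remaining balls, and both stay
nonnegative and bounded if `u` is. -/
theorem IsSplitting.isTestGradLimit_of_cover (h : IsSplitting Ω D₁ D₂) (hr : 1 ≤ r) (hr' : r ≠ ⊤)
    {d : Rn N → Rn N} {δ : Rn N → ℝ} (s : Finset (Rn N)) (hδ : ∀ x₀ ∈ s, 0 < δ x₀)
    (hcone : ∀ x₀ ∈ s, ∀ y, dist y x₀ < δ x₀ → ∀ t : ℝ, 0 < t → t < δ x₀ →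
      ∀ z : Rn N, ‖z - t • d x₀‖ < δ x₀ * t →
        (y ∈ closure Ω → y + z ∈ Ω) ∧ (y ∈ D₁ → y + z ∈ D₁)) :
    ∀ (u : Rn N → ℝ) (G : Rn N → Rn N), IsW Ω D₂ r u G → (∃ M, ∀ x, |u x| ≤ M) →
      (σ → ∀ᵐ x ∂(volume.restrict Ω), 0 ≤ u x) →
      (∀ x ∈ Ω, u x ≠ 0 → ∃ x₀ ∈ s, dist x x₀ ≤ δ x₀ / 2) → IsTestGradLimit Ω D₂ r σ G := by
  have hΩm := h.isOpen.measurableSet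
  have hfin : IsFiniteMeasure (volume.restrict D₂) := ⟨by
    rw [Measure.restrict_apply_univ]
    exact (h.isBounded.subset h.subset₂).measure_lt_top⟩
  classical
  induction s using Finset.induction_on with
  | empty =>
    intro u G hu _ _ h0
    have hu0 : u =ᵐ[volume.restrict Ω] fun _ => 0 := by
      filter_upwards [ae_restrict_mem hΩm] with x hx
      by_contra hc
      simpa using h0 x hx hc
    have hG0 := HasWeakGradient.ae_eq h.isOpen HasWeakGradient.zero (hu.1.1.congr hu0)
    refine IsTestGradLimit.congr (G := fun _ => 0) (fun ε _ => ⟨fun _ => 0, IsTest.zero,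
      fun _ _ => le_rfl, ?_, ?_⟩) h.subset₂ hG0
    all_goals
      have : ∀ x : Rn N, ∇ (fun _ : Rn N => (0 : ℝ)) x = 0 := fun x => by simp [gradient]
      simp [this]
  | insert x₀ s _ ih =>
    intro u G hu ⟨M, hM⟩ hσ h0
    have hδ0 := hδ x₀ (Finset.mem_insert_self _ _)
    let f : ContDiffBump x₀ := ⟨δ x₀ / 2, 3 / 4 * δ x₀, by positivity, by linarith⟩
    have hf : IsTest univ f := ⟨f.contDiff, f.hasCompactSupport, subset_univ _⟩
    have hout : ∀ x, 3 / 4 * δ x₀ < dist x x₀ → x ∉ tsupport f := fun x hx => by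
      rw [f.tsupport_eq, Metric.mem_closedBall, not_le]; exact hx
    obtain ⟨L, hL⟩ := (HasCompactSupport.intro hf.hasCompactSupport fun x hx =>
      IsTest.gradient_eq_zero hx).exists_bound_of_continuous hf.continuous_gradient
    have hle := Measure.restrict_mono h.subset₂ (le_refl (volume : Measure (Rn N)))
    have hfu : IsW Ω D₂ r (fun x => f x * u x) (fun x => f x • G x + u x • ∇ f x) := by
      refine ⟨hu.1.test_mul hf, MemLp.add ?_ ?_⟩
      · refine hu.2.mono (hf.contDiff.continuous.aestronglyMeasurable.smul hu.2.1)
          (ae_of_all _ fun x => ?_)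
        rw [norm_smul, Real.norm_of_nonneg f.nonneg]
        exact mul_le_of_le_one_left (norm_nonneg _) f.le_one
      -- The boundedness of `u` enters here: for `u` merely in `L²`, the term `u • ∇ f` need not be
      -- in `Lʳ(D₂)`.
      · refine MemLp.of_bound ((hu.1.2.1.mono_measure hle).smul
          hf.continuous_gradient.aestronglyMeasurable) (M * L) (ae_of_all _ fun x => ?_)
        rw [norm_smul]
        exact mul_le_mul (hM x) (hL x) (norm_nonneg _) ((abs_nonneg _).trans (hM x))
    have l1 : IsTestGradLimit Ω D₂ r σ (fun x => f x • G x + u x • ∇ f x) := by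
      refine h.isTestGradLimit_of_local hr hr' hδ0 (ρ := 3 / 4 * δ x₀) (by linarith)
        (hcone x₀ (Finset.mem_insert_self _ _)) hfu.1 hfu.2 (fun x hx => ?_) (fun x hx => ?_)
        fun hs => ?_
      · rw [image_eq_zero_of_notMem_tsupport (hout x hx), zero_mul]
      · rw [image_eq_zero_of_notMem_tsupport (hout x hx), IsTest.gradient_eq_zero (hout x hx)]
        simp
      · filter_upwards [hσ hs] with x hx
        exact mul_nonneg f.nonneg hx
    have hgu := hu.sub hfu
    have l2 : IsTestGradLimit Ω D₂ r σ (fun x => G x - (f x • G x + u x • ∇ f x)) := by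
      refine ih (fun y hy => hδ y (Finset.mem_insert_of_mem hy))
        (fun y hy => hcone y (Finset.mem_insert_of_mem hy)) _ _ hgu ⟨M, fun x => ?_⟩
        (fun hs => ?_) fun x hx hne => ?_
      · have e : u x - f x * u x = (1 - f x) * u x := by ring
        rw [e, abs_mul, abs_of_nonneg (sub_nonneg.2 f.le_one)]
        refine (mul_le_of_le_one_left (abs_nonneg _) ?_).trans (hM x)
        linarith [f.nonneg (x := x)]
      · filter_upwards [hσ hs] with x hx
        have : f x * u x ≤ u x := mul_le_of_le_one_left hx f.le_one
        linarith
      · have hu0 : u x ≠ 0 := fun hc => hne (by rw [hc]; ring)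
        obtain ⟨y, hy, hyx⟩ := h0 x hx hu0
        rcases Finset.mem_insert.1 hy with rfl | hy
        · exact absurd (by rw [f.one_of_mem_closedBall hyx]; ring) hne
        · exact ⟨y, hy, hyx⟩
    refine (l1.add hr l2 hfu.1.3.1 hgu.1.3.1 h.subset₂).congr h.subset₂ (ae_of_all _ fun x => ?_)
    simp

theorem isSmoothContraction_arctan {k : ℝ} (hk : 0 < k) :
    IsSmoothContraction (fun s => k * Real.arctan (s / k)) ∧
      (∀ s, deriv (fun s => k * Real.arctan (s / k)) s = 1 / (1 + (s / k) ^ 2)) := by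
  have hd : ∀ s, deriv (fun s => k * Real.arctan (s / k)) s = 1 / (1 + (s / k) ^ 2) := fun s => by
    have := ((Real.hasDerivAt_arctan (s / k)).comp s ((hasDerivAt_id s).div_const k)).const_mul k
    refine (HasDerivAt.deriv this).trans ?_
    field_simp
  refine ⟨⟨?_, by simp, fun s => ?_⟩, hd⟩
  · exact contDiff_const.mul (Real.contDiff_arctan.comp (contDiff_id.div_const k))
  · rw [hd, abs_of_nonneg (by positivity), div_le_one (by positivity)]
    linarith [sq_nonneg (s / k)]

theorem IsW.comp {F : ℝ → ℝ} (hF : IsSmoothContraction F) (hD : D₂ ⊆ Ω) (hu : IsW Ω D₂ r u G) :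
    IsW Ω D₂ r (fun x => F (u x)) (fun x => deriv F (u x) • G x) := by
  refine ⟨hu.1.comp hF, hu.2.mono ?_ (ae_of_all _ fun x => ?_)⟩
  · exact (hF.continuous_deriv.comp_aestronglyMeasurable (hu.1.2.1.mono_measure
      (Measure.restrict_mono hD le_rfl))).smul hu.2.1
  · rw [norm_smul]
    exact mul_le_of_le_one_left (norm_nonneg _) (hF.abs_deriv_le _)

/-- Density of `C_c^∞(Ω)` in `𝒲(Ω)`, with nonnegative functions approximated by nonnegative
ones. -/
theorem IsSplitting.isTestGradLimit (h : IsSplitting Ω D₁ D₂) (hr : 1 ≤ r) (hr' : r ≠ ⊤)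
    (hu : IsW Ω D₂ r u G) (hσ : σ → ∀ᵐ x ∂(volume.restrict Ω), 0 ≤ u x) :
    IsTestGradLimit Ω D₂ r σ G := by
  have hcone := fun x₀ hx₀ => h.exists_direction (x₀ := x₀) hx₀
  choose! d δ hδ hcone using hcone
  have hK : IsCompact (closure Ω) :=
    Metric.isCompact_of_isClosed_isBounded isClosed_closure h.isBounded.closure
  obtain ⟨s, hs, hcov⟩ := hK.elim_nhds_subcover (fun x₀ => Metric.closedBall x₀ (δ x₀ / 2))
    fun x₀ hx₀ => Metric.closedBall_mem_nhds _ (half_pos (hδ x₀ hx₀))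
  -- Smooth truncations: each is bounded, a contraction and sign preserving, and their derivatives
  -- tend to `1` pointwise.
  set F : ℕ → ℝ → ℝ := fun n s => ((n : ℝ) + 1) * Real.arctan (s / ((n : ℝ) + 1)) with hF
  have hpos : ∀ n : ℕ, (0 : ℝ) < (n : ℝ) + 1 := fun n => by positivity
  have hFc : ∀ n, IsSmoothContraction (F n) := fun n => (isSmoothContraction_arctan (hpos n)).1
  have hFd : ∀ n s, deriv (F n) s = 1 / (1 + (s / ((n : ℝ) + 1)) ^ 2) :=
    fun n => (isSmoothContraction_arctan (hpos n)).2
  have hW := fun n => hu.comp (hFc n) h.subset₂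
  have hlim : ∀ s, Tendsto (fun n => deriv (F n) s - 1) atTop (𝓝 0) := fun s => by
    have h1 : Tendsto (fun n : ℕ => s / ((n : ℝ) + 1)) atTop (𝓝 0) := by
      simpa [div_eq_mul_inv] using (tendsto_one_div_add_atTop_nhds_zero_nat (𝕜 := ℝ)).const_mul s
    have h2 : Tendsto (fun n : ℕ => 1 / (1 + (s / ((n : ℝ) + 1)) ^ 2)) atTop
        (𝓝 (1 / (1 + 0 ^ 2))) := (tendsto_const_nhds.div ((h1.pow 2).const_add 1) (by norm_num))
    simp only [hFd]
    simpa using h2.sub_const 1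
  have hbd : ∀ n x, |deriv (F n) (u x) - 1| ≤ 2 := fun n x => by
    refine (abs_sub _ _).trans ?_
    rw [abs_one]
    linarith [(hFc n).abs_deriv_le (u x)]
  have hm : ∀ n, AEStronglyMeasurable (fun x => deriv (F n) (u x) - 1) (volume.restrict Ω) :=
    fun n => ((hFc n).continuous_deriv.comp_aestronglyMeasurable hu.1.2.1).sub
      aestronglyMeasurable_const
  have hle := Measure.restrict_mono h.subset₂ (le_refl (volume : Measure (Rn N)))
  have e : ∀ n x, deriv (F n) (u x) • G x - G x = (deriv (F n) (u x) - 1) • G x := fun n x => by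
    rw [sub_smul, one_smul]
  refine IsTestGradLimit.of_tendsto (A := fun n x => deriv (F n) (u x) • G x) hr h.subset₂
    (fun n => ?_) (fun n => (hW n).1.3.1) hu.1.3.1 ?_ ?_
  · refine h.isTestGradLimit_of_cover hr hr' (d := d) (δ := δ) s (fun x hx => hδ x (hs x hx))
      (fun x hx => hcone x (hs x hx)) _ _ (hW n) ⟨((n : ℝ) + 1) * (Real.pi / 2), fun x => ?_⟩
      (fun hs' => ?_) fun x hx _ => ?_
    · simp only [hF, abs_mul, abs_of_pos (hpos n)]
      gcongr
      exact abs_le.2 ⟨(Real.neg_pi_div_two_lt_arctan _).le, (Real.arctan_lt_pi_div_two _).le⟩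
    · filter_upwards [hσ hs'] with x hx
      exact mul_nonneg (hpos n).le (Real.arctan_nonneg.2 (div_nonneg hx (hpos n).le))
    · simpa using hcov (subset_closure hx)
  · simp only [e]
    exact tendsto_eLpNorm_smul_zero (by norm_num) (by norm_num) hu.1.3 hm hbd
      (ae_of_all _ fun x => hlim (u x))
  · simp only [e]
    exact tendsto_eLpNorm_smul_zero (one_pos.trans_le hr).ne' hr' hu.2
      (fun n => (hm n).mono_measure hle) hbd (ae_of_all _ fun x => hlim (u x))

end Density

/-! ### The positive part of a function in `𝒲(Ω)`. -/

section PositivePart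

open scoped ENNReal

variable {N : ℕ} {Ω D₂ : Set (Rn N)} {r : ℝ≥0∞} {u : Rn N → ℝ} {G : Rn N → Rn N}

/-- The derivative of `s ↦ max s 0`, with value `1 / 2` at the origin. -/
def posSlope (s : ℝ) : ℝ := (1 + s / |s|) / 2

theorem measurable_posSlope : Measurable posSlope := by
  unfold posSlope
  exact ((measurable_id.div measurable_id.abs).const_add 1).div_const 2

theorem posSlope_nonneg (s : ℝ) : 0 ≤ posSlope s := by
  have : -1 ≤ s / |s| := by
    rcases eq_or_ne s 0 with rfl | hs
    · simp
    · rw [le_div_iff₀ (abs_pos.2 hs)]; linarith [neg_abs_le s]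
  unfold posSlope; linarith

theorem posSlope_le_one (s : ℝ) : posSlope s ≤ 1 := by
  have : s / |s| ≤ 1 := div_le_one_of_le₀ (le_abs_self s) (abs_nonneg s)
  unfold posSlope; linarith

/-- A smooth approximation of `s ↦ max s 0`. -/
def smoothPos (ε s : ℝ) : ℝ := (s + √(s ^ 2 + ε ^ 2) - ε) / 2

theorem deriv_smoothPos {ε : ℝ} (hε : 0 < ε) (s : ℝ) :
    deriv (smoothPos ε) s = (1 + s / √(s ^ 2 + ε ^ 2)) / 2 := by
  have hpos : s ^ 2 + ε ^ 2 ≠ 0 := by positivity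
  have h1 : HasDerivAt (fun s : ℝ => s ^ 2 + ε ^ 2) (2 * s) s := by
    simpa using (hasDerivAt_pow 2 s).add_const (ε ^ 2)
  have h2 : HasDerivAt (smoothPos ε) ((1 + 2 * s / (2 * √(s ^ 2 + ε ^ 2))) / 2) s :=
    (((hasDerivAt_id s).add (h1.sqrt hpos)).sub_const ε).div_const 2
  rw [h2.deriv, mul_div_mul_left _ _ two_ne_zero]

theorem isSmoothContraction_smoothPos {ε : ℝ} (hε : 0 < ε) :
    IsSmoothContraction (smoothPos ε) where
  contDiff := by
    have h : ContDiff ℝ ∞ fun s : ℝ => √(s ^ 2 + ε ^ 2) :=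
      ((contDiff_id.pow 2).add contDiff_const).sqrt fun s => by positivity
    exact ((contDiff_id.add h).sub contDiff_const).div_const 2
  map_zero := by simp [smoothPos, Real.sqrt_sq hε.le]
  abs_deriv_le s := by
    have h0 : 0 < √(s ^ 2 + ε ^ 2) := Real.sqrt_pos.2 (by positivity)
    have h1 : |s / √(s ^ 2 + ε ^ 2)| ≤ 1 := by
      rw [abs_div, abs_of_pos h0, div_le_one h0]
      exact Real.abs_le_sqrt (by linarith [sq_nonneg ε])
    rw [deriv_smoothPos hε, abs_le]
    constructor <;> linarith [abs_le.1 h1]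

theorem abs_smoothPos_sub_le {ε : ℝ} (hε : 0 < ε) (s : ℝ) :
    |smoothPos ε s - max s 0| ≤ ε := by
  have h1 : |s| ≤ √(s ^ 2 + ε ^ 2) := Real.abs_le_sqrt (by linarith [sq_nonneg ε])
  have h2 : √(s ^ 2 + ε ^ 2) ≤ |s| + ε := by
    rw [Real.sqrt_le_left (by positivity)]
    nlinarith [abs_nonneg s, sq_abs s]
  have h3 : max s 0 = (s + |s|) / 2 := by
    rcases le_total s 0 with hs | hs
    · rw [max_eq_right hs, abs_of_nonpos hs]; ring
    · rw [max_eq_left hs, abs_of_nonneg hs]; ring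
  rw [h3, smoothPos, abs_le]
  constructor <;> linarith

/-- The value `posSlope 0 = 1 / 2`, which comes from `0 / 0 = 0`, is the derivative of every
`smoothPos ε` at `0`. Convergence thus holds at every point, and no separate argument is needed that
the gradient vanishes on `{u = 0}`. -/
theorem tendsto_deriv_smoothPos (s : ℝ) :
    Tendsto (fun n : ℕ => deriv (smoothPos (1 / ((n : ℝ) + 1))) s - posSlope s) atTop (𝓝 0) := by
  have h0 := tendsto_one_div_add_atTop_nhds_zero_nat (𝕜 := ℝ)
  have e : ∀ n : ℕ, deriv (smoothPos (1 / ((n : ℝ) + 1))) s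
      = (1 + s / √(s ^ 2 + (1 / ((n : ℝ) + 1)) ^ 2)) / 2 := fun n =>
    deriv_smoothPos (by positivity) s
  simp only [e]
  rcases eq_or_ne s 0 with rfl | hs
  · simp [posSlope]
  · have h1 : Tendsto (fun n : ℕ => √(s ^ 2 + (1 / ((n : ℝ) + 1)) ^ 2)) atTop (𝓝 |s|) := by
      have := ((h0.pow 2).const_add (s ^ 2)).sqrt
      simpa [Real.sqrt_sq_eq_abs] using this
    have h2 := (((tendsto_const_nhds (x := s)).div h1 (abs_ne_zero.2 hs)).const_add 1).div_const 2
    simpa [posSlope] using h2.sub_const (posSlope s)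

theorem IsW.posPart (hfin : volume Ω ≠ ⊤) (hD : D₂ ⊆ Ω) (hu : IsW Ω D₂ r u G) :
    IsW Ω D₂ r (fun x => max (u x) 0) (fun x => posSlope (u x) • G x) := by
  have : IsFiniteMeasure (volume.restrict Ω) := ⟨by simpa using hfin.lt_top⟩
  have hle := Measure.restrict_mono hD (le_refl (volume : Measure (Rn N)))
  have hms : AEStronglyMeasurable (fun x => posSlope (u x)) (volume.restrict Ω) :=
    (measurable_posSlope.comp_aemeasurable hu.1.2.1.aemeasurable).aestronglyMeasurable
  have hb : ∀ x, ‖posSlope (u x) • G x‖ ≤ ‖G x‖ := fun x => by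
    rw [norm_smul, Real.norm_of_nonneg (posSlope_nonneg _)]
    exact mul_le_of_le_one_left (norm_nonneg _) (posSlope_le_one _)
  have hε : ∀ n : ℕ, (0 : ℝ) < 1 / ((n : ℝ) + 1) := fun n => by positivity
  have hu' : MemLp (fun x => max (u x) 0) 2 (volume.restrict Ω) := by
    refine hu.1.2.mono ((continuous_id.max continuous_const).comp_aestronglyMeasurable hu.1.2.1)
      (ae_of_all _ fun x => ?_)
    rw [Real.norm_of_nonneg (le_max_right _ _), Real.norm_eq_abs]
    exact max_le (le_abs_self _) (abs_nonneg _)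
  refine ⟨isW012_of_tendsto
    (fun n : ℕ => hu.1.comp (isSmoothContraction_smoothPos (hε n))) hu'
    (hu.1.3.mono (hms.smul hu.1.3.1) (ae_of_all _ hb)) ?_ ?_,
    hu.2.mono ((hms.mono_measure hle).smul hu.2.1) (ae_of_all _ hb)⟩
  · have h0 := tendsto_one_div_add_atTop_nhds_zero_nat (𝕜 := ℝ)
    have h1 : Tendsto (fun n : ℕ => (volume.restrict Ω) univ ^ (2 : ℝ≥0∞).toReal⁻¹
        * ENNReal.ofReal (1 / ((n : ℝ) + 1))) atTop (𝓝 0) := by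
      have h2 : Tendsto (fun n : ℕ => ENNReal.ofReal (1 / ((n : ℝ) + 1))) atTop (𝓝 0) := by
        rw [← ENNReal.ofReal_zero]
        exact (ENNReal.continuous_ofReal.tendsto 0).comp h0
      have := ENNReal.Tendsto.const_mul (a := (volume.restrict Ω) univ ^ (2 : ℝ≥0∞).toReal⁻¹) h2
        (Or.inr (ENNReal.rpow_ne_top_of_nonneg (by positivity) (measure_ne_top _ _)))
      simpa using this
    refine tendsto_of_tendsto_of_tendsto_of_le_of_le tendsto_const_nhds h1 (fun _ => zero_le)
      fun n => eLpNorm_le_of_ae_bound (ae_of_all _ fun x => ?_)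
    exact abs_smoothPos_sub_le (hε n) (u x)
  · have e : ∀ (n : ℕ) x, deriv (smoothPos (1 / ((n : ℝ) + 1))) (u x) • G x - posSlope (u x) • G x
        = (deriv (smoothPos (1 / ((n : ℝ) + 1))) (u x) - posSlope (u x)) • G x := fun n x => by
      rw [sub_smul]
    simp only [e]
    refine tendsto_eLpNorm_smul_zero (by norm_num) (by norm_num) hu.1.3 (fun n => ?_)
      (K := 2) (fun n x => ?_) (ae_of_all _ fun x => tendsto_deriv_smoothPos (u x))
    · exact ((isSmoothContraction_smoothPos (hε n)).continuous_deriv.comp_aestronglyMeasurable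
        hu.1.2.1).sub hms
    · refine (abs_sub _ _).trans ?_
      have := (isSmoothContraction_smoothPos (hε n)).abs_deriv_le (u x)
      rw [abs_of_nonneg (posSlope_nonneg _)]
      linarith [posSlope_le_one (u x)]

end PositivePart

/-! ### Monotonicity of the form, and comparison of power integrals with norms. -/

section FluxNorm

open scoped ENNReal

variable {α E : Type*} [MeasurableSpace α] {μ : Measure α} [NormedAddCommGroup E]
  [InnerProductSpace ℝ E] {s : ℝ} {a b h : α → E}

theorem powInt_eq_eLpNorm (hs : 2 ≤ s) (ha : MemLp a (ENNReal.ofReal s) μ) :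
    powInt s μ a = (eLpNorm a (ENNReal.ofReal s) μ).toReal ^ s := by
  have hs0 : 0 < s := by linarith
  rw [ha.eLpNorm_eq_integral_rpow_norm (by simpa using hs0) (by simp),
    ENNReal.toReal_ofReal hs0.le, ENNReal.toReal_ofReal (by positivity),
    ← Real.rpow_mul (integral_nonneg fun _ => by positivity), inv_mul_cancel₀ hs0.ne',
    Real.rpow_one, powInt]

theorem tendsto_powInt_zero_iff {ι : Type*} {l : Filter ι} (hs : 2 ≤ s) {h : ι → α → E}
    (hh : ∀ n, MemLp (h n) (ENNReal.ofReal s) μ) :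
    Tendsto (fun n => powInt s μ (h n)) l (𝓝 0) ↔
      Tendsto (fun n => eLpNorm (h n) (ENNReal.ofReal s) μ) l (𝓝 0) := by
  have hs0 : 0 < s := by linarith
  have h1 : Tendsto (fun n => eLpNorm (h n) (ENNReal.ofReal s) μ) l (𝓝 0) ↔
      Tendsto (fun n => (eLpNorm (h n) (ENNReal.ofReal s) μ).toReal) l (𝓝 0) := by
    rw [← ENNReal.toReal_zero, ENNReal.tendsto_toReal_iff (fun n => (hh n).2.ne) (by simp)]
  rw [h1]
  simp only [fun n => powInt_eq_eLpNorm hs (hh n)]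
  constructor <;> intro h2
  · have h3 := h2.rpow_const (p := 1 / s) (Or.inr (by positivity))
    rw [Real.zero_rpow (by positivity)] at h3
    refine h3.congr fun n => ?_
    rw [← Real.rpow_mul ENNReal.toReal_nonneg, mul_one_div_cancel hs0.ne', Real.rpow_one]
  · have h3 := h2.rpow_const (p := s) (Or.inr (by positivity))
    rwa [Real.zero_rpow (by positivity)] at h3

/-- The sum of the two uniform convexity inequalities, from `x` to `y` and from `y` to `x`. -/
theorem rpow_mul_inner_monotone (hs : 2 ≤ s) (x y : E) :
    2 * convexityConst s * ‖x - y‖ ^ s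
      ≤ ‖x‖ ^ (s - 2) * ⟪x, x - y⟫ - ‖y‖ ^ (s - 2) * ⟪y, x - y⟫ := by
  have h1 := norm_rpow_uniformly_convex hs x y
  have h2 := norm_rpow_uniformly_convex hs y x
  rw [← neg_sub x y, inner_neg_right, norm_neg] at h1
  linarith

/-- The weight `c` allows for the gradient of a positive part, `posSlope (u - v) • (∇u - ∇v)`.
Monotonicity produces one factor `c`, which dominates the needed `c ^ s` because `0 ≤ c ≤ 1`. -/
theorem powInt_le_flux_sub (hs : 2 ≤ s) (ha : MemLp a (ENNReal.ofReal s) μ)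
    (hb : MemLp b (ENNReal.ofReal s) μ) {c : α → ℝ} (hc0 : ∀ x, 0 ≤ c x) (hc1 : ∀ x, c x ≤ 1)
    (hc : AEStronglyMeasurable c μ) :
    2 * convexityConst s * powInt s μ (fun x => c x • (a x - b x))
      ≤ flux s μ a (fun x => c x • (a x - b x)) - flux s μ b (fun x => c x • (a x - b x)) := by
  have hk : MemLp (fun x => c x • (a x - b x)) (ENNReal.ofReal s) μ := by
    have hab : MemLp (fun x => a x - b x) (ENNReal.ofReal s) μ := ha.sub hb
    refine hab.mono (hc.smul hab.1) (ae_of_all _ fun x => ?_)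
    rw [norm_smul, Real.norm_of_nonneg (hc0 x)]
    exact mul_le_of_le_one_left (norm_nonneg _) (hc1 x)
  unfold powInt flux
  rw [← integral_const_mul, ← integral_sub (integrable_flux hs ha hk) (integrable_flux hs hb hk)]
  refine integral_mono ((integrable_norm_rpow hs hk).const_mul _)
    ((integrable_flux hs ha hk).sub (integrable_flux hs hb hk)) fun x => ?_
  simp only [inner_smul_right, norm_smul, Real.norm_of_nonneg (hc0 x)]
  rw [Real.mul_rpow (hc0 x) (norm_nonneg _)]
  have h1 := mul_le_mul_of_nonneg_left (rpow_mul_inner_monotone hs (a x) (b x)) (hc0 x)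
  have h2 : c x ^ s ≤ c x := by
    simpa using Real.rpow_le_rpow_of_exponent_ge' (hc0 x) (hc1 x) zero_le_one
      (by linarith : (1 : ℝ) ≤ s)
  have h3 : 0 ≤ 2 * convexityConst s * ‖a x - b x‖ ^ s :=
    mul_nonneg (by linarith [convexityConst_pos hs]) (Real.rpow_nonneg (norm_nonneg _) s)
  nlinarith [mul_le_mul_of_nonneg_right h2 h3]

theorem exists_tendsto_eLpNorm {F : Type*} [NormedAddCommGroup F] [CompleteSpace F] {r : ℝ≥0∞}
    (hr : 1 ≤ r) {g : ℕ → α → F} (hg : ∀ n, MemLp (g n) r μ)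
    (hc : Tendsto (fun q : ℕ × ℕ => eLpNorm (fun x => g q.1 x - g q.2 x) r μ) atTop (𝓝 0)) :
    ∃ k, MemLp k r μ ∧ Tendsto (fun n => eLpNorm (fun x => g n x - k x) r μ) atTop (𝓝 0) := by
  have : Fact (1 ≤ r) := ⟨hr⟩
  have hcs : CauchySeq fun n => (hg n).toLp (g n) := by
    rw [cauchySeq_iff_tendsto_dist_atTop_0]
    have h1 := (ENNReal.tendsto_toReal ENNReal.zero_ne_top).comp hc
    refine h1.congr fun q => ?_
    rw [dist_edist, Lp.edist_toLp_toLp]; rfl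
  obtain ⟨k, hk⟩ := cauchySeq_tendsto_of_complete hcs
  refine ⟨k, Lp.memLp k, ?_⟩
  have h1 := tendsto_iff_edist_tendsto_0.1 hk
  refine h1.congr fun n => ?_
  rw [Lp.edist_def]
  refine eLpNorm_congr_ae ?_
  filter_upwards [(hg n).coeFn_toLp] with x hx
  simp [hx]

end FluxNorm

/-! ### The energy on pairs (function, gradient): convexity, Euler–Lagrange equation, coercivity. -/

section Energy

open scoped ENNReal

variable {N : ℕ} {Ω D₁ D₂ : Set (Rn N)} {p : ℝ} {σ : Prop} {f u v w : Rn N → ℝ}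
  {G H K : Rn N → Rn N}

/-- `∫_{D₁} G·H + ∫_{D₂} |G|^{p-2} G·H`. -/
def gradForm (D₁ D₂ : Set (Rn N)) (p : ℝ) (G H : Rn N → Rn N) : ℝ :=
  flux 2 (volume.restrict D₁) G H + flux p (volume.restrict D₂) G H

/-- `∫_{D₁} |G|² + ∫_{D₂} |G|^p`. -/
def gradPow (D₁ D₂ : Set (Rn N)) (p : ℝ) (G : Rn N → Rn N) : ℝ :=
  powInt 2 (volume.restrict D₁) G + powInt p (volume.restrict D₂) G

/-- The energy of a function `u` with gradient `G`. -/
def pairEnergy (Ω D₁ D₂ : Set (Rn N)) (p : ℝ) (f u : Rn N → ℝ) (G : Rn N → Rn N) : ℝ :=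
  powInt 2 (volume.restrict D₁) G / 2 + powInt p (volume.restrict D₂) G / p - ∫ x in Ω, f x * u x

theorem IsW.memLp_left (h : IsSplitting Ω D₁ D₂) (hu : IsW Ω D₂ (ENNReal.ofReal p) u G) :
    MemLp G (ENNReal.ofReal 2) (volume.restrict D₁) := by
  have := hu.1.3.mono_measure (Measure.restrict_mono h.subset₁ le_rfl)
  simpa using this

theorem gradForm_sub (h : IsSplitting Ω D₁ D₂) (hp : 2 < p)
    (hu : IsW Ω D₂ (ENNReal.ofReal p) u G) (hv : IsW Ω D₂ (ENNReal.ofReal p) v H)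
    (hw : IsW Ω D₂ (ENNReal.ofReal p) w K) :
    gradForm D₁ D₂ p G (fun x => H x - K x) = gradForm D₁ D₂ p G H - gradForm D₁ D₂ p G K := by
  unfold gradForm
  rw [flux_sub le_rfl (hu.memLp_left h) (hv.memLp_left h) (hw.memLp_left h),
    flux_sub hp.le hu.2 hv.2 hw.2]
  ring

theorem gradForm_smul (c : ℝ) :
    gradForm D₁ D₂ p G (fun x => c • H x) = c * gradForm D₁ D₂ p G H := by
  unfold gradForm
  rw [flux_smul, flux_smul]; ring

theorem gradPow_nonneg : 0 ≤ gradPow D₁ D₂ p G := add_nonneg powInt_nonneg powInt_nonneg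

theorem IsSplitting.ae_of_ae (h : IsSplitting Ω D₁ D₂) {P : Rn N → Prop}
    (h1 : ∀ᵐ x ∂(volume.restrict D₁), P x) (h2 : ∀ᵐ x ∂(volume.restrict D₂), P x) :
    ∀ᵐ x ∂(volume.restrict Ω), P x := by
  rw [ae_restrict_iff' h.isOpen₁.measurableSet] at h1
  rw [ae_restrict_iff' h.isOpen₂.measurableSet] at h2
  rw [ae_restrict_iff' h.isOpen.measurableSet]
  filter_upwards [h1, h2, h.ae_mem] with x a1 a2 a3 hx
  exact (a3 hx).elim a1 a2

theorem ae_eq_zero_of_gradPow_le (h : IsSplitting Ω D₁ D₂) (hp : 2 < p)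
    (hu : IsW Ω D₂ (ENNReal.ofReal p) u G) (h0 : gradPow D₁ D₂ p G ≤ 0) :
    G =ᵐ[volume.restrict Ω] 0 := by
  have h1 : 0 ≤ powInt 2 (volume.restrict D₁) G := powInt_nonneg
  have h2 : 0 ≤ powInt p (volume.restrict D₂) G := powInt_nonneg
  unfold gradPow at h0
  exact h.ae_of_ae (ae_eq_zero_of_powInt_eq_zero le_rfl (hu.memLp_left h) (by linarith))
    (ae_eq_zero_of_powInt_eq_zero hp.le hu.2 (by linarith))

theorem IsSplitting.exists_poincare (h : IsSplitting Ω D₁ D₂) (hN : 1 ≤ N) :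
    ∃ C : ℝ, 0 ≤ C ∧ ∀ (u : Rn N → ℝ) (G : Rn N → Rn N), IsW012 Ω u G →
      eLpNorm u 2 (volume.restrict Ω) ≤ ENNReal.ofReal C * eLpNorm G 2 (volume.restrict Ω) := by
  obtain ⟨R, hR⟩ := h.isBounded.subset_closedBall (0 : Rn N)
  refine ⟨2 * max R 0, by positivity, fun u G hu => ?_⟩
  exact hu.poincare hN h.isOpen (le_max_right _ _)
    (hR.trans (Metric.closedBall_subset_closedBall (le_max_left _ _)))

theorem IsW012.ae_eq_zero (h : IsSplitting Ω D₁ D₂) (hN : 1 ≤ N) (hu : IsW012 Ω u G)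
    (hG : G =ᵐ[volume.restrict Ω] 0) : u =ᵐ[volume.restrict Ω] 0 := by
  obtain ⟨C, -, hC⟩ := h.exists_poincare hN
  have h1 := hC u G hu
  rw [eLpNorm_congr_ae hG, eLpNorm_zero, mul_zero, nonpos_iff_eq_zero,
    eLpNorm_eq_zero_iff hu.2.1 (by norm_num)] at h1
  exact h1

theorem eLpNorm_mul_le {α : Type*} [MeasurableSpace α] {μ : Measure α} {f g : α → ℝ}
    (hf : AEStronglyMeasurable f μ) (hg : AEStronglyMeasurable g μ) :
    eLpNorm (fun x => f x * g x) 1 μ ≤ eLpNorm f 2 μ * eLpNorm g 2 μ := by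
  have := eLpNorm_le_eLpNorm_mul_eLpNorm_of_nnnorm (p := 2) (q := 2) (r := 1) hf hg
    (fun a b => a * b) 1 (ae_of_all _ fun x => by rw [nnnorm_mul, one_mul])
  simpa using this

theorem integrable_load {α : Type*} [MeasurableSpace α] {μ : Measure α} {f g : α → ℝ}
    (hf : MemLp f 2 μ) (hg : MemLp g 2 μ) : Integrable (fun x => f x * g x) μ :=
  memLp_one_iff_integrable.1 ⟨hf.1.mul hg.1,
    (eLpNorm_mul_le hf.1 hg.1).trans_lt (ENNReal.mul_lt_top hf.2 hg.2)⟩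

theorem abs_integral_mul_le {α : Type*} [MeasurableSpace α] {μ : Measure α} {f g : α → ℝ}
    (hf : MemLp f 2 μ) (hg : MemLp g 2 μ) :
    |∫ x, f x * g x ∂μ| ≤ (eLpNorm f 2 μ).toReal * (eLpNorm g 2 μ).toReal := by
  rw [← ENNReal.toReal_mul]
  refine (abs_integral_le_integral_abs).trans ?_
  have h1 : ∫ x, |f x * g x| ∂μ = (eLpNorm (fun x => f x * g x) 1 μ).toReal := by
    rw [eLpNorm_one_eq_lintegral_enorm,
      ← integral_norm_eq_lintegral_enorm (f := fun x => f x * g x) (hf.1.mul hg.1)]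
    rfl
  rw [h1]
  exact ENNReal.toReal_mono (ENNReal.mul_lt_top hf.2 hg.2).ne (eLpNorm_mul_le hf.1 hg.1)

theorem tendsto_integral_mul {α : Type*} [MeasurableSpace α] {μ : Measure α} {f g : α → ℝ}
    {a : ℕ → α → ℝ} (hf : MemLp f 2 μ) (hg : MemLp g 2 μ) (ha : ∀ n, MemLp (a n) 2 μ)
    (h : Tendsto (fun n => eLpNorm (fun x => a n x - g x) 2 μ) atTop (𝓝 0)) :
    Tendsto (fun n => ∫ x, f x * a n x ∂μ) atTop (𝓝 (∫ x, f x * g x ∂μ)) := by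
  rw [tendsto_iff_dist_tendsto_zero]
  have h1 : Tendsto (fun n => (eLpNorm f 2 μ).toReal
      * (eLpNorm (fun x => a n x - g x) 2 μ).toReal) atTop (𝓝 0) := by
    simpa using ((ENNReal.tendsto_toReal ENNReal.zero_ne_top).comp h).const_mul
      (eLpNorm f 2 μ).toReal
  refine squeeze_zero (fun _ => dist_nonneg) (fun n => ?_) h1
  rw [Real.dist_eq, ← integral_sub (integrable_load hf (ha n)) (integrable_load hf hg)]
  simp only [← mul_sub]
  exact abs_integral_mul_le hf ((ha n).sub hg)

/-- The modulus of convexity of the energy. -/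
def energyConst (p : ℝ) : ℝ := min (convexityConst 2) (convexityConst p)

theorem energyConst_pos (hp : 2 < p) : 0 < energyConst p :=
  lt_min (convexityConst_pos le_rfl) (convexityConst_pos hp.le)

theorem pairEnergy_uniformly_convex (h : IsSplitting Ω D₁ D₂) (hp : 2 < p)
    (hu : IsW Ω D₂ (ENNReal.ofReal p) u G) (hv : IsW Ω D₂ (ENNReal.ofReal p) v H) :
    pairEnergy Ω D₁ D₂ p f u G + (gradForm D₁ D₂ p G (fun x => H x - G x)
        - ((∫ x in Ω, f x * v x) - ∫ x in Ω, f x * u x))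
      + energyConst p * gradPow D₁ D₂ p (fun x => H x - G x) ≤ pairEnergy Ω D₁ D₂ p f v H := by
  have h1 := powInt_uniformly_convex le_rfl (hu.memLp_left h) (hv.memLp_left h)
  have h2 := powInt_uniformly_convex hp.le hu.2 hv.2
  have n1 : 0 ≤ powInt 2 (volume.restrict D₁) (fun x => H x - G x) := powInt_nonneg
  have n2 : 0 ≤ powInt p (volume.restrict D₂) (fun x => H x - G x) := powInt_nonneg
  have c1 := mul_le_mul_of_nonneg_right (min_le_left (convexityConst 2) (convexityConst p)) n1
  have c2 := mul_le_mul_of_nonneg_right (min_le_right (convexityConst 2) (convexityConst p)) n2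
  unfold pairEnergy gradForm gradPow energyConst
  rw [mul_add]
  linarith

theorem tendsto_gradForm (h : IsSplitting Ω D₁ D₂) (hp : 2 < p)
    (hu : IsW Ω D₂ (ENNReal.ofReal p) u G) (hv : IsW Ω D₂ (ENNReal.ofReal p) v H)
    {a : ℕ → Rn N → ℝ} {A : ℕ → Rn N → Rn N} (ha : ∀ n, IsW Ω D₂ (ENNReal.ofReal p) (a n) (A n))
    (h1 : Tendsto (fun n => eLpNorm (fun x => A n x - H x) 2 (volume.restrict Ω)) atTop (𝓝 0))
    (h2 : Tendsto (fun n => eLpNorm (fun x => A n x - H x) (ENNReal.ofReal p)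
      (volume.restrict D₂)) atTop (𝓝 0)) :
    Tendsto (fun n => gradForm D₁ D₂ p G (A n)) atTop (𝓝 (gradForm D₁ D₂ p G H)) := by
  have hd := fun n => (ha n).sub hv
  have h1' : Tendsto (fun n => eLpNorm (fun x => A n x - H x) (ENNReal.ofReal 2)
      (volume.restrict D₁)) atTop (𝓝 0) := by
    rw [ENNReal.ofReal_ofNat]
    exact tendsto_of_tendsto_of_tendsto_of_le_of_le tendsto_const_nhds h1 (fun _ => zero_le)
      fun n => eLpNorm_mono_measure _ (Measure.restrict_mono h.subset₁ le_rfl)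
  have t1 := tendsto_flux_zero le_rfl (hu.memLp_left h) (fun n => (hd n).memLp_left h)
    ((tendsto_powInt_zero_iff le_rfl fun n => (hd n).memLp_left h).2 h1')
  have t2 := tendsto_flux_zero hp.le hu.2 (fun n => (hd n).2)
    ((tendsto_powInt_zero_iff hp.le fun n => (hd n).2).2 h2)
  have t3 := (t1.add t2).add_const (gradForm D₁ D₂ p G H)
  rw [add_zero, zero_add] at t3
  refine t3.congr fun n => ?_
  have := gradForm_sub h hp hu (ha n) hv
  unfold gradForm at this ⊢
  linarith

theorem IsTest.isW {φ : Rn N → ℝ} (hφ : IsTest Ω φ) (r : ℝ≥0∞) : IsW Ω D₂ r φ (∇ φ) :=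
  ⟨hφ.isW012, hφ.memLp_gradient r⟩

/-- Elements of `𝒲(Ω)` are limits of test functions, in the sense that suffices to pass to the
limit in the weak formulation. -/
theorem IsW.exists_test_seq (h : IsSplitting Ω D₁ D₂) (hN : 1 ≤ N) (hp : 2 < p)
    (hf : MemLp f 2 (volume.restrict Ω)) (hv : IsW Ω D₂ (ENNReal.ofReal p) v H)
    (hσ : σ → ∀ᵐ x ∂(volume.restrict Ω), 0 ≤ v x) :
    ∃ φ : ℕ → Rn N → ℝ, (∀ n, IsTest Ω (φ n)) ∧ (σ → ∀ n x, 0 ≤ φ n x) ∧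
      Tendsto (fun n => ∫ x in Ω, f x * φ n x) atTop (𝓝 (∫ x in Ω, f x * v x)) ∧
      ∀ u G, IsW Ω D₂ (ENNReal.ofReal p) u G →
        Tendsto (fun n => gradForm D₁ D₂ p G (∇ (φ n))) atTop (𝓝 (gradForm D₁ D₂ p G H)) := by
  have hr : 1 ≤ ENNReal.ofReal p := by
    rw [← ENNReal.ofReal_one]; exact ENNReal.ofReal_le_ofReal (by linarith)
  have hd := h.isTestGradLimit hr ENNReal.ofReal_ne_top hv hσ
  have hpos : ∀ n : ℕ, (0 : ℝ≥0∞) < ((n : ℝ≥0∞))⁻¹ := fun n => by simp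
  choose φ h1 h2 h3 h4 using fun n : ℕ => hd _ (hpos n)
  have t1 := tendsto_of_tendsto_of_tendsto_of_le_of_le tendsto_const_nhds
    ENNReal.tendsto_inv_nat_nhds_zero (fun _ => zero_le) h3
  have t2 := tendsto_of_tendsto_of_tendsto_of_le_of_le tendsto_const_nhds
    ENNReal.tendsto_inv_nat_nhds_zero (fun _ => zero_le) h4
  -- Density gives convergence of gradients only; the Poincaré inequality adds the `L²` convergence
  -- of the functions needed for the load term.
  obtain ⟨C, -, hC⟩ := h.exists_poincare hN
  have hlim : Tendsto (fun n => ENNReal.ofReal C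
      * eLpNorm (fun x => ∇ (φ n) x - H x) 2 (volume.restrict Ω)) atTop (𝓝 0) := by
    simpa using ENNReal.Tendsto.const_mul t1 (Or.inr (ENNReal.ofReal_ne_top (r := C)))
  refine ⟨φ, h1, fun s n => h2 n s, ?_, fun u G hu => ?_⟩
  · refine tendsto_integral_mul hf hv.1.2 (fun n => (h1 n).memLp 2) ?_
    exact tendsto_of_tendsto_of_tendsto_of_le_of_le tendsto_const_nhds hlim (fun _ => zero_le)
      fun n => hC _ _ (((h1 n).isW _).sub hv).1
  · exact tendsto_gradForm h hp hu hv (fun n => (h1 n).isW _) t1 t2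

/-- The weak formulation, tested with all of `𝒲(Ω)`. -/
theorem gradForm_eq_of_test (h : IsSplitting Ω D₁ D₂) (hN : 1 ≤ N) (hp : 2 < p)
    (hf : MemLp f 2 (volume.restrict Ω)) (hu : IsW Ω D₂ (ENNReal.ofReal p) u G)
    (hs : ∀ φ, IsTest Ω φ → gradForm D₁ D₂ p G (∇ φ) = ∫ x in Ω, f x * φ x)
    (hv : IsW Ω D₂ (ENNReal.ofReal p) v H) :
    gradForm D₁ D₂ p G H = ∫ x in Ω, f x * v x := by
  obtain ⟨φ, h1, -, h3, h4⟩ := hv.exists_test_seq h hN hp hf (σ := False) (fun hF => hF.elim)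
  refine tendsto_nhds_unique (h4 u G hu) ?_
  simpa only [fun n => hs (φ n) (h1 n)] using h3

/-- Testing the equation with `v - u` cancels the first-order term of the tangent inequality. The
surviving remainder gives uniqueness as well as minimality. -/
theorem pairEnergy_le_of_solution (h : IsSplitting Ω D₁ D₂) (hN : 1 ≤ N) (hp : 2 < p)
    (hf : MemLp f 2 (volume.restrict Ω)) (hu : IsW Ω D₂ (ENNReal.ofReal p) u G)
    (hs : ∀ φ, IsTest Ω φ → gradForm D₁ D₂ p G (∇ φ) = ∫ x in Ω, f x * φ x)
    (hv : IsW Ω D₂ (ENNReal.ofReal p) v H) :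
    pairEnergy Ω D₁ D₂ p f u G + energyConst p * gradPow D₁ D₂ p (fun x => H x - G x)
      ≤ pairEnergy Ω D₁ D₂ p f v H := by
  have h1 := pairEnergy_uniformly_convex (f := f) h hp hu hv
  have h2 := gradForm_eq_of_test h hN hp hf hu hs (hv.sub hu)
  simp only [mul_sub] at h2
  rw [integral_sub (integrable_load hf hv.1.2) (integrable_load hf hu.1.2)] at h2
  linarith

/-- The tangent inequality at `u + t * v`, evaluated at `u`, bounds the energy increment by `t`
times the first variation at `u + t * v`. Minimality makes that increment nonnegative; one divides
by `t` and lets `t → 0⁺`. Applying the result to `±φ` gives the equation. -/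
theorem le_gradForm_of_minimizer (h : IsSplitting Ω D₁ D₂) (hp : 2 < p)
    (hf : MemLp f 2 (volume.restrict Ω)) (hu : IsW Ω D₂ (ENNReal.ofReal p) u G)
    (hmin : ∀ v H, IsW Ω D₂ (ENNReal.ofReal p) v H →
      pairEnergy Ω D₁ D₂ p f u G ≤ pairEnergy Ω D₁ D₂ p f v H)
    (hv : IsW Ω D₂ (ENNReal.ofReal p) v H) :
    ∫ x in Ω, f x * v x ≤ gradForm D₁ D₂ p G H := by
  have hlim : Tendsto (fun t : ℝ => gradForm D₁ D₂ p (fun x => G x + t • H x) H) (𝓝[>] 0)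
      (𝓝 (gradForm D₁ D₂ p G H)) :=
    ((tendsto_flux_add_smul le_rfl (hu.memLp_left h) (hv.memLp_left h)).add
      (tendsto_flux_add_smul hp.le hu.2 hv.2)).mono_left nhdsWithin_le_nhds
  refine ge_of_tendsto hlim ?_
  filter_upwards [self_mem_nhdsWithin] with t ht
  have ht : 0 < t := ht
  have hut := hu.add (hv.const_mul t)
  have h1 := hmin _ _ hut
  have h2 := pairEnergy_uniformly_convex (f := f) h hp hut hu
  have h3 : 0 ≤ energyConst p * gradPow D₁ D₂ p (fun x => G x - (G x + t • H x)) :=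
    mul_nonneg (energyConst_pos hp).le gradPow_nonneg
  have e1 : (fun x => G x - (G x + t • H x)) = fun x => (-t) • H x := by
    ext1 x; module
  have e2 : ∫ x in Ω, f x * (u x + t * v x)
      = (∫ x in Ω, f x * u x) + t * ∫ x in Ω, f x * v x := by
    rw [← integral_const_mul, ← integral_add (integrable_load hf hu.1.2)
      ((integrable_load hf hv.1.2).const_mul t)]
    congr 1; ext x; ring
  rw [e2, e1, gradForm_smul] at h2
  rw [e1] at h3
  have h4 : t * (∫ x in Ω, f x * v x) ≤ t * gradForm D₁ D₂ p (fun x => G x + t • H x) H := by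
    linarith
  exact le_of_mul_le_mul_left h4 ht

/-- The norm `‖G‖_{L²(D₁)} + ‖G‖_{Lᵖ(D₂)}`. -/
def gradNorm (D₁ D₂ : Set (Rn N)) (p : ℝ) (G : Rn N → Rn N) : ℝ :=
  (eLpNorm G 2 (volume.restrict D₁)).toReal
    + (eLpNorm G (ENNReal.ofReal p) (volume.restrict D₂)).toReal

theorem eLpNorm_two_le (h : IsSplitting Ω D₁ D₂) (hG : AEStronglyMeasurable G (volume.restrict Ω)) :
    eLpNorm G 2 (volume.restrict Ω)
      ≤ eLpNorm G 2 (volume.restrict D₁) + eLpNorm G 2 (volume.restrict D₂) := by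
  have m1 := h.isOpen₁.measurableSet
  have m2 := h.isOpen₂.measurableSet
  have e : G =ᵐ[volume.restrict Ω] D₁.indicator G + D₂.indicator G := by
    filter_upwards [(ae_restrict_iff' h.isOpen.measurableSet).2 h.ae_mem] with x hx
    rcases hx with h1 | h2
    · have h2 : x ∉ D₂ := fun h2 => h.disjoint.subset ⟨h1, h2⟩
      simp [h1, h2]
    · have h1 : x ∉ D₁ := fun h1 => h.disjoint.subset ⟨h1, h2⟩
      simp [h1, h2]
  rw [eLpNorm_congr_ae e]
  refine (eLpNorm_add_le (hG.indicator m1) (hG.indicator m2) (by norm_num)).trans ?_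
  rw [eLpNorm_indicator_eq_eLpNorm_restrict m1, eLpNorm_indicator_eq_eLpNorm_restrict m2,
    Measure.restrict_restrict m1, Measure.restrict_restrict m2,
    inter_eq_self_of_subset_left h.subset₁, inter_eq_self_of_subset_left h.subset₂]

theorem exists_eLpNorm_two_le (h : IsSplitting Ω D₁ D₂) (hp : 2 < p) :
    ∃ C : ℝ, 0 ≤ C ∧ ∀ G : Rn N → Rn N, AEStronglyMeasurable G (volume.restrict D₂) →
      eLpNorm G 2 (volume.restrict D₂)
        ≤ ENNReal.ofReal C * eLpNorm G (ENNReal.ofReal p) (volume.restrict D₂) := by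
  have hfin : (volume.restrict D₂) univ < ⊤ := by
    rw [Measure.restrict_apply_univ]
    exact (h.isBounded.subset h.subset₂).measure_lt_top
  have h2p : (2 : ℝ≥0∞) ≤ ENNReal.ofReal p := by
    rw [← ENNReal.ofReal_ofNat]; exact ENNReal.ofReal_le_ofReal hp.le
  have hexp : 0 ≤ 1 / (2 : ℝ≥0∞).toReal - 1 / (ENNReal.ofReal p).toReal := by
    rw [ENNReal.toReal_ofReal (by linarith), ENNReal.toReal_ofNat]
    have := one_div_le_one_div_of_le two_pos hp.le
    linarith
  refine ⟨((volume.restrict D₂) univ ^ (1 / (2 : ℝ≥0∞).toReal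
    - 1 / (ENNReal.ofReal p).toReal)).toReal, ENNReal.toReal_nonneg, fun G hG => ?_⟩
  rw [ENNReal.ofReal_toReal (ENNReal.rpow_ne_top_of_nonneg hexp hfin.ne), mul_comm]
  exact eLpNorm_le_eLpNorm_mul_rpow_measure_univ h2p hG

/-- Coercivity of the energy, in quantitative form. -/
theorem exists_gradNorm_le_pairEnergy (h : IsSplitting Ω D₁ D₂) (hN : 1 ≤ N) (hp : 2 < p)
    (hf : MemLp f 2 (volume.restrict Ω)) : ∃ C : ℝ, ∀ u G, IsW Ω D₂ (ENNReal.ofReal p) u G →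
      gradNorm D₁ D₂ p G - C ≤ pairEnergy Ω D₁ D₂ p f u G := by
  obtain ⟨C₁, hC₁, h₁⟩ := h.exists_poincare hN
  obtain ⟨C₂, hC₂, h₂⟩ := exists_eLpNorm_two_le h hp
  set F := (eLpNorm f 2 (volume.restrict Ω)).toReal
  have hF0 : 0 ≤ F := ENNReal.toReal_nonneg
  -- The load is at most `(M - 1) * (A + B)`, so lower bounds of slope `M` in `A` and `B` for the
  -- two power terms leave exactly `A + B`, up to a constant.
  set M := F * C₁ * (1 + C₂) + 1 with hM
  refine ⟨M ^ 2 / 2 + p * M ^ 2 / 4 + 1 / p, fun u G hu => ?_⟩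
  have n1 : eLpNorm G 2 (volume.restrict D₁) ≠ ⊤ := by
    simpa using (hu.memLp_left h).2.ne
  have n2 : eLpNorm G (ENNReal.ofReal p) (volume.restrict D₂) ≠ ⊤ := hu.2.2.ne
  set A := (eLpNorm G 2 (volume.restrict D₁)).toReal
  set B := (eLpNorm G (ENNReal.ofReal p) (volume.restrict D₂)).toReal
  have hA0 : 0 ≤ A := ENNReal.toReal_nonneg
  have hB0 : 0 ≤ B := ENNReal.toReal_nonneg
  have b1 : (eLpNorm u 2 (volume.restrict Ω)).toReal ≤ C₁ * (A + C₂ * B) := by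
    have : eLpNorm u 2 (volume.restrict Ω) ≤ ENNReal.ofReal (C₁ * (A + C₂ * B)) := by
      rw [ENNReal.ofReal_mul hC₁, ENNReal.ofReal_add hA0 (by positivity), ENNReal.ofReal_mul hC₂,
        ENNReal.ofReal_toReal n1, ENNReal.ofReal_toReal n2]
      refine (h₁ u G hu.1).trans ?_
      gcongr
      exact (eLpNorm_two_le h hu.1.3.1).trans (by gcongr; exact h₂ G hu.2.1)
    exact ENNReal.toReal_le_of_le_ofReal (by positivity) this
  have b2 : |∫ x in Ω, f x * u x| ≤ (M - 1) * (A + B) := by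
    refine (abs_integral_mul_le hf hu.1.2).trans ?_
    calc _ ≤ F * (C₁ * (A + C₂ * B)) := by gcongr
      _ ≤ F * (C₁ * ((1 + C₂) * (A + B))) := by
        gcongr; nlinarith [mul_nonneg hC₂ hA0]
      _ = _ := by rw [hM]; ring
  have e1 : powInt 2 (volume.restrict D₁) G = A ^ 2 := by
    rw [powInt_eq_eLpNorm le_rfl (hu.memLp_left h), ENNReal.ofReal_ofNat, Real.rpow_two]
  have e2 : powInt p (volume.restrict D₂) G = B ^ p := powInt_eq_eLpNorm hp.le hu.2
  have hp0 : 0 < p := by linarith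
  -- This reduces the `p`-term to a quadratic, where completing the square suffices.
  have b3 : B ^ 2 - 1 ≤ B ^ p := by
    rcases le_total B 1 with hB1 | hB1
    · have := Real.rpow_nonneg hB0 p
      nlinarith
    · have : B ^ (2 : ℝ) ≤ B ^ p := Real.rpow_le_rpow_of_exponent_le hB1 hp.le
      rw [Real.rpow_two] at this
      linarith
  have b4 : (B ^ 2 - 1) / p ≤ B ^ p / p := by gcongr
  have b5 : M * B - p * M ^ 2 / 4 ≤ B ^ 2 / p := by
    rw [le_div_iff₀ hp0]
    nlinarith [sq_nonneg (B - p * M / 2)]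
  have b6 : M * A - M ^ 2 / 2 ≤ A ^ 2 / 2 := by nlinarith [sq_nonneg (A - M)]
  have b7 : (B ^ 2 - 1) / p = B ^ 2 / p - 1 / p := by ring
  have hgn : gradNorm D₁ D₂ p G = A + B := rfl
  unfold pairEnergy
  rw [hgn, e1, e2]
  have := le_abs_self (∫ x in Ω, f x * u x)
  linarith

end Energy

/-! ### Existence of a minimizer and the comparison principle. -/

section Existence

open scoped ENNReal

variable {N : ℕ} {Ω D₁ D₂ : Set (Rn N)} {p : ℝ} {f u v : Rn N → ℝ} {G H : Rn N → Rn N}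

/-- Tangent inequalities at the convex combination toward `u` and toward `v` are averaged with
weights `s` and `t`; the first-order terms cancel and the remainders stay. -/
theorem pairEnergy_convex_combination (h : IsSplitting Ω D₁ D₂) (hp : 2 < p)
    (hf : MemLp f 2 (volume.restrict Ω)) (hu : IsW Ω D₂ (ENNReal.ofReal p) u G)
    (hv : IsW Ω D₂ (ENNReal.ofReal p) v H) {s t : ℝ} (hs : 0 ≤ s) (ht : 0 ≤ t) (hst : s + t = 1) :
    pairEnergy Ω D₁ D₂ p f (fun x => s * u x + t * v x) (fun x => s • G x + t • H x)
      + energyConst p * (s * gradPow D₁ D₂ p (fun x => t • (G x - H x))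
        + t * gradPow D₁ D₂ p (fun x => s • (H x - G x)))
      ≤ s * pairEnergy Ω D₁ D₂ p f u G + t * pairEnergy Ω D₁ D₂ p f v H := by
  have hw := (hu.const_mul s).add (hv.const_mul t)
  have h1 := pairEnergy_uniformly_convex (f := f) h hp hw hu
  have h2 := pairEnergy_uniformly_convex (f := f) h hp hw hv
  have hs' : s = 1 - t := by linarith
  have e1 : (fun x => G x - (s • G x + t • H x)) = fun x => t • (G x - H x) := by
    ext1 x; rw [hs']; module
  have e2 : (fun x => H x - (s • G x + t • H x)) = fun x => s • (H x - G x) := by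
    ext1 x; rw [hs']; module
  have e3 : ∫ x in Ω, f x * (s * u x + t * v x)
      = s * (∫ x in Ω, f x * u x) + t * ∫ x in Ω, f x * v x := by
    rw [← integral_const_mul, ← integral_const_mul,
      ← integral_add ((integrable_load hf hu.1.2).const_mul s)
      ((integrable_load hf hv.1.2).const_mul t)]
    congr 1; ext x; ring
  have e4 : (fun x => H x - G x) = fun x => (-1 : ℝ) • (G x - H x) := by ext1 x; module
  have e5 : gradForm D₁ D₂ p (fun x => s • G x + t • H x) (fun x => s • (H x - G x))
      = -(s * gradForm D₁ D₂ p (fun x => s • G x + t • H x) (fun x => G x - H x)) := by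
    rw [gradForm_smul, e4, gradForm_smul]; ring
  rw [e1, gradForm_smul, e3] at h1
  rw [e2, e5, e3] at h2
  have h3 := mul_le_mul_of_nonneg_left h1 hs
  have h4 := mul_le_mul_of_nonneg_left h2 ht
  have e6 : s * (t * gradForm D₁ D₂ p (fun x => s • G x + t • H x) (fun x => G x - H x))
      = t * (s * gradForm D₁ D₂ p (fun x => s • G x + t • H x) (fun x => G x - H x)) := by ring
  subst hs'
  linarith

theorem tendsto_eLpNorm_of_gradPow (h : IsSplitting Ω D₁ D₂) (hp : 2 < p) {ι : Type*} {l : Filter ι}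
    {a : ι → Rn N → ℝ} {A : ι → Rn N → Rn N} (ha : ∀ i, IsW Ω D₂ (ENNReal.ofReal p) (a i) (A i))
    (h0 : Tendsto (fun i => gradPow D₁ D₂ p (A i)) l (𝓝 0)) :
    Tendsto (fun i => eLpNorm (A i) 2 (volume.restrict Ω)) l (𝓝 0) ∧
      Tendsto (fun i => eLpNorm (A i) (ENNReal.ofReal p) (volume.restrict D₂)) l (𝓝 0) := by
  have h1 : Tendsto (fun i => powInt 2 (volume.restrict D₁) (A i)) l (𝓝 0) :=
    squeeze_zero (fun _ => powInt_nonneg)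
      (fun i => le_add_of_nonneg_right powInt_nonneg) h0
  have h2 : Tendsto (fun i => powInt p (volume.restrict D₂) (A i)) l (𝓝 0) :=
    squeeze_zero (fun _ => powInt_nonneg)
      (fun i => le_add_of_nonneg_left powInt_nonneg) h0
  rw [tendsto_powInt_zero_iff le_rfl fun i => (ha i).memLp_left h, ENNReal.ofReal_ofNat] at h1
  rw [tendsto_powInt_zero_iff hp.le fun i => (ha i).2] at h2
  refine ⟨?_, h2⟩
  obtain ⟨C, -, hC⟩ := exists_eLpNorm_two_le h hp
  have h3 := ENNReal.Tendsto.const_mul h2 (Or.inr (ENNReal.ofReal_ne_top (r := C)))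
  refine tendsto_of_tendsto_of_tendsto_of_le_of_le tendsto_const_nhds
    (by simpa using h1.add h3) (fun _ => zero_le) fun i => ?_
  exact (eLpNorm_two_le h (ha i).1.3.1).trans (add_le_add_right (hC _ (ha i).2.1) _)

/-- Completeness of `𝒲(Ω)`. -/
theorem exists_limit (h : IsSplitting Ω D₁ D₂) (hN : 1 ≤ N) (hp : 2 < p) {a : ℕ → Rn N → ℝ}
    {A : ℕ → Rn N → Rn N} (ha : ∀ n, IsW Ω D₂ (ENNReal.ofReal p) (a n) (A n))
    (h1 : Tendsto (fun q : ℕ × ℕ => eLpNorm (fun x => A q.1 x - A q.2 x) 2 (volume.restrict Ω))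
      atTop (𝓝 0))
    (h2 : Tendsto (fun q : ℕ × ℕ => eLpNorm (fun x => A q.1 x - A q.2 x) (ENNReal.ofReal p)
      (volume.restrict D₂)) atTop (𝓝 0)) :
    ∃ u G, IsW Ω D₂ (ENNReal.ofReal p) u G ∧
      Tendsto (fun n => eLpNorm (fun x => a n x - u x) 2 (volume.restrict Ω)) atTop (𝓝 0) ∧
      Tendsto (fun n => eLpNorm (fun x => A n x - G x) 2 (volume.restrict Ω)) atTop (𝓝 0) ∧
      Tendsto (fun n => eLpNorm (fun x => A n x - G x) (ENNReal.ofReal p)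
        (volume.restrict D₂)) atTop (𝓝 0) := by
  have hr : 1 ≤ ENNReal.ofReal p := by
    rw [← ENNReal.ofReal_one]; exact ENNReal.ofReal_le_ofReal (by linarith)
  obtain ⟨C, -, hC⟩ := h.exists_poincare hN
  have h0 : Tendsto (fun q : ℕ × ℕ => eLpNorm (fun x => a q.1 x - a q.2 x) 2 (volume.restrict Ω))
      atTop (𝓝 0) := by
    have h3 := ENNReal.Tendsto.const_mul h1 (Or.inr (ENNReal.ofReal_ne_top (r := C)))
    rw [mul_zero] at h3
    exact tendsto_of_tendsto_of_tendsto_of_le_of_le tendsto_const_nhds h3 (fun _ => zero_le)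
      fun q => hC _ _ ((ha q.1).sub (ha q.2)).1
  obtain ⟨u, hu, hu'⟩ := exists_tendsto_eLpNorm (by norm_num) (fun n => (ha n).1.2) h0
  obtain ⟨G, hG, hG'⟩ := exists_tendsto_eLpNorm (by norm_num) (fun n => (ha n).1.3) h1
  obtain ⟨K, hK, hK'⟩ := exists_tendsto_eLpNorm hr (fun n => (ha n).2) h2
  have hle := Measure.restrict_mono h.subset₂ (le_refl (volume : Measure (Rn N)))
  have hGD : Tendsto (fun n => eLpNorm (fun x => A n x - G x) 2 (volume.restrict D₂)) atTop
      (𝓝 0) :=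
    tendsto_of_tendsto_of_tendsto_of_le_of_le tendsto_const_nhds hG' (fun _ => zero_le)
      fun n => eLpNorm_mono_measure _ hle
  have m1 : TendstoInMeasure (volume.restrict D₂) A atTop G :=
    tendstoInMeasure_of_tendsto_eLpNorm (by norm_num) (fun n => (ha n).2.1)
      (hG.1.mono_measure hle) hGD
  have m2 : TendstoInMeasure (volume.restrict D₂) A atTop K :=
    tendstoInMeasure_of_tendsto_eLpNorm (one_pos.trans_le hr).ne' (fun n => (ha n).2.1) hK.1 hK'
  -- The `L²` and `Lᵖ` limits of the gradients on `D₂` coincide, both being limits in measure.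
  have hGK : G =ᵐ[volume.restrict D₂] K := tendstoInMeasure_ae_unique m1 m2
  refine ⟨u, G, ⟨isW012_of_tendsto (fun n => (ha n).1) hu hG hu' hG',
    (memLp_congr_ae hGK).2 hK⟩, hu', hG', hK'.congr fun n => eLpNorm_congr_ae ?_⟩
  filter_upwards [hGK] with x hx
  rw [hx]

theorem IsW.zero {r : ℝ≥0∞} : IsW Ω D₂ r (fun _ => 0) (fun _ => 0) := ⟨IsW012.zero, MemLp.zero⟩

/-- The energy at the midpoint of two almost minimizing functions is at least the infimum, so the
convexity remainder is small: the sequence is Cauchy and converges strongly. -/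
theorem exists_minimizer (h : IsSplitting Ω D₁ D₂) (hN : 1 ≤ N) (hp : 2 < p)
    (hf : MemLp f 2 (volume.restrict Ω)) :
    ∃ u G, IsW Ω D₂ (ENNReal.ofReal p) u G ∧ ∀ v H, IsW Ω D₂ (ENNReal.ofReal p) v H →
      pairEnergy Ω D₁ D₂ p f u G ≤ pairEnergy Ω D₁ D₂ p f v H := by
  obtain ⟨C, hC⟩ := exists_gradNorm_le_pairEnergy h hN hp hf
  set S : Set ℝ := {e | ∃ u G, IsW Ω D₂ (ENNReal.ofReal p) u G ∧ e = pairEnergy Ω D₁ D₂ p f u G}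
  have hSb : BddBelow S := by
    refine ⟨-C, ?_⟩
    rintro _ ⟨u, G, hu, rfl⟩
    have h0 : 0 ≤ gradNorm D₁ D₂ p G := add_nonneg ENNReal.toReal_nonneg ENNReal.toReal_nonneg
    linarith [hC u G hu]
  have hSn : S.Nonempty := ⟨_, _, _, IsW.zero, rfl⟩
  have hle : ∀ u G, IsW Ω D₂ (ENNReal.ofReal p) u G → sInf S ≤ pairEnergy Ω D₁ D₂ p f u G :=
    fun u G hu => csInf_le hSb ⟨u, G, hu, rfl⟩
  have hex : ∀ n : ℕ, ∃ u G, IsW Ω D₂ (ENNReal.ofReal p) u G ∧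
      pairEnergy Ω D₁ D₂ p f u G < sInf S + 1 / ((n : ℝ) + 1) := fun n => by
    obtain ⟨_, ⟨u, G, hu, rfl⟩, hlt⟩ := exists_lt_of_csInf_lt hSn
      (lt_add_of_pos_right (sInf S) (by positivity : 0 < 1 / ((n : ℝ) + 1)))
    exact ⟨u, G, hu, hlt⟩
  choose a A ha hlt using hex
  have h0 := tendsto_one_div_add_atTop_nhds_zero_nat (𝕜 := ℝ)
  have hc := energyConst_pos hp
  have hpow : Tendsto (fun q : ℕ × ℕ => gradPow D₁ D₂ p
      (fun x => (1 / 2 : ℝ) • (A q.1 x - A q.2 x))) atTop (𝓝 0) := by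
    have hb : Tendsto (fun q : ℕ × ℕ => (1 / ((q.1 : ℝ) + 1) + 1 / ((q.2 : ℝ) + 1))
        / energyConst p) atTop (𝓝 0) := by
      rw [← prod_atTop_atTop_eq]
      simpa using ((h0.comp tendsto_fst).add (h0.comp tendsto_snd)).div_const (energyConst p)
    refine squeeze_zero (fun _ => gradPow_nonneg) (fun q => ?_) hb
    have hm := pairEnergy_convex_combination h hp hf (ha q.1) (ha q.2) (s := 1 / 2) (t := 1 / 2)
      (by norm_num) (by norm_num) (by norm_num)
    have hi := hle _ _ (((ha q.1).const_mul (1 / 2)).add ((ha q.2).const_mul (1 / 2)))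
    have n2 : 0 ≤ energyConst p * gradPow D₁ D₂ p (fun x => (1 / 2 : ℝ) • (A q.2 x - A q.1 x)) :=
      mul_nonneg hc.le gradPow_nonneg
    rw [le_div_iff₀ hc]
    linarith [hlt q.1, hlt q.2]
  have hhalf := tendsto_eLpNorm_of_gradPow h hp
    (fun q : ℕ × ℕ => ((ha q.1).sub (ha q.2)).const_mul (1 / 2)) hpow
  have hdbl : ∀ {r : ℝ≥0∞} {S' : Set (Rn N)},
      Tendsto (fun q : ℕ × ℕ => eLpNorm (fun x => (1 / 2 : ℝ) • (A q.1 x - A q.2 x)) r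
        (volume.restrict S')) atTop (𝓝 0) →
      Tendsto (fun q : ℕ × ℕ => eLpNorm (fun x => A q.1 x - A q.2 x) r
        (volume.restrict S')) atTop (𝓝 0) := fun {r S'} ht => by
    have h3 := ENNReal.Tendsto.const_mul ht (Or.inr (ENNReal.ofReal_ne_top (r := 2)))
    rw [mul_zero] at h3
    refine tendsto_of_tendsto_of_tendsto_of_le_of_le tendsto_const_nhds h3 (fun _ => zero_le)
      fun q => eLpNorm_le_mul_eLpNorm_of_ae_le_mul (ae_of_all _ fun x => ?_) _
    rw [norm_smul, Real.norm_of_nonneg (by norm_num : (0:ℝ) ≤ 1 / 2)]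
    linarith
  obtain ⟨u, G, hu, h3, h4, h5⟩ := exists_limit h hN hp ha (hdbl hhalf.1) (hdbl hhalf.2)
  refine ⟨u, G, hu, fun v H hv => le_trans ?_ (hle v H hv)⟩
  have t1 := (tendsto_gradForm h hp hu hu ha h4 h5).sub_const (gradForm D₁ D₂ p G G)
  have t2 := (tendsto_integral_mul hf hu.1.2 (fun n => (ha n).1.2) h3).sub_const
    (∫ x in Ω, f x * u x)
  rw [sub_self] at t1 t2
  have t3 := (t1.sub t2).const_add (pairEnergy Ω D₁ D₂ p f u G)
  have t4 := h0.const_add (sInf S)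
  rw [sub_self, add_zero] at t3
  rw [add_zero] at t4
  -- Lower semicontinuity follows from the tangent inequality at the limit `u`, whose linear term in
  -- `a n - u` tends to zero.
  refine le_of_tendsto_of_tendsto' t3 t4 fun n => ?_
  have h6 := pairEnergy_uniformly_convex (f := f) h hp hu (ha n)
  have h7 : 0 ≤ energyConst p * gradPow D₁ D₂ p (fun x => A n x - G x) :=
    mul_nonneg hc.le gradPow_nonneg
  rw [gradForm_sub h hp hu (ha n) hu] at h6
  linarith [hlt n]

/-- The comparison principle. -/
theorem ae_le_of_sub_super (h : IsSplitting Ω D₁ D₂) (hN : 1 ≤ N) (hp : 2 < p)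
    (hf : MemLp f 2 (volume.restrict Ω)) (hu : IsW Ω D₂ (ENNReal.ofReal p) u G)
    (hv : IsW Ω D₂ (ENNReal.ofReal p) v H)
    (hsub : ∀ φ, IsTest Ω φ → (∀ x, 0 ≤ φ x) →
      gradForm D₁ D₂ p G (∇ φ) ≤ ∫ x in Ω, f x * φ x)
    (hsuper : ∀ φ, IsTest Ω φ → (∀ x, 0 ≤ φ x) →
      ∫ x in Ω, f x * φ x ≤ gradForm D₁ D₂ p H (∇ φ)) :
    ∀ᵐ x ∂(volume.restrict Ω), u x ≤ v x := by
  have hw := hu.sub hv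
  have hw' := hw.posPart h.isBounded.measure_lt_top.ne h.subset₂
  set c : Rn N → ℝ := fun x => posSlope (u x - v x)
  obtain ⟨φ, h1, h2, -, h4⟩ := hw'.exists_test_seq h hN hp hf (σ := True)
    (fun _ => ae_of_all _ fun x => le_max_right _ _)
  -- The same test sequence approximates `(u - v)⁺` for both forms; the load separates them at each
  -- `n`, so only the forms pass to the limit.
  have hle : gradForm D₁ D₂ p G (fun x => c x • (G x - H x))
      ≤ gradForm D₁ D₂ p H (fun x => c x • (G x - H x)) :=
    le_of_tendsto_of_tendsto' (h4 u G hu) (h4 v H hv) fun n =>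
      (hsub _ (h1 n) (h2 trivial n)).trans (hsuper _ (h1 n) (h2 trivial n))
  have hcm : AEStronglyMeasurable c (volume.restrict Ω) :=
    (measurable_posSlope.comp_aemeasurable hw.1.2.1.aemeasurable).aestronglyMeasurable
  have f1 := powInt_le_flux_sub le_rfl (hu.memLp_left h) (hv.memLp_left h)
    (fun x => posSlope_nonneg (u x - v x)) (fun x => posSlope_le_one (u x - v x))
    (hcm.mono_measure (Measure.restrict_mono h.subset₁ le_rfl))
  have f2 := powInt_le_flux_sub hp.le hu.2 hv.2
    (fun x => posSlope_nonneg (u x - v x)) (fun x => posSlope_le_one (u x - v x))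
    (hcm.mono_measure (Measure.restrict_mono h.subset₂ le_rfl))
  have k1 := convexityConst_pos (le_refl (2 : ℝ))
  have k2 := convexityConst_pos hp.le
  have n1 : 0 ≤ powInt 2 (volume.restrict D₁) (fun x => c x • (G x - H x)) := powInt_nonneg
  have n2 : 0 ≤ powInt p (volume.restrict D₂) (fun x => c x • (G x - H x)) := powInt_nonneg
  unfold gradForm at hle
  have hzero : gradPow D₁ D₂ p (fun x => c x • (G x - H x)) ≤ 0 := by
    have z1 : powInt 2 (volume.restrict D₁) (fun x => c x • (G x - H x)) ≤ 0 := by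
      have := mul_nonneg (by linarith : 0 ≤ 2 * convexityConst p) n2
      by_contra! hlt
      have := mul_pos (by linarith : 0 < 2 * convexityConst 2) hlt
      linarith
    have z2 : powInt p (volume.restrict D₂) (fun x => c x • (G x - H x)) ≤ 0 := by
      have := mul_nonneg (by linarith : 0 ≤ 2 * convexityConst 2) n1
      by_contra! hlt
      have := mul_pos (by linarith : 0 < 2 * convexityConst p) hlt
      linarith
    exact add_nonpos z1 z2
  have hu0 := hw'.1.ae_eq_zero h hN (ae_eq_zero_of_gradPow_le h hp hw' hzero)
  filter_upwards [hu0] with x hx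
  have hx' : max (u x - v x) 0 = 0 := hx
  linarith [le_max_left (u x - v x) 0]

end Existence

/-! ### Transfer from pairs to classes in `spaceW` with the chosen `weakGrad`. -/

section Space

variable {N : ℕ} {Ω D₁ D₂ : Set (Rn N)} {p : ℝ} {f u v : Rn N → ℝ} {G H : Rn N → Rn N}

theorem pairEnergy_congr (h : IsSplitting Ω D₁ D₂) (h1 : u =ᵐ[volume.restrict Ω] v)
    (h2 : G =ᵐ[volume.restrict Ω] H) :
    pairEnergy Ω D₁ D₂ p f u G = pairEnergy Ω D₁ D₂ p f v H := by
  unfold pairEnergy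
  rw [powInt_congr (ae_restrict_of_ae_restrict_of_subset h.subset₁ h2),
    powInt_congr (ae_restrict_of_ae_restrict_of_subset h.subset₂ h2)]
  congr 1
  refine integral_congr_ae ?_
  filter_upwards [h1] with x hx
  rw [hx]

theorem isW_weakGrad (h : IsSplitting Ω D₁ D₂) (u : spaceW Ω D₂ p) :
    IsW Ω D₂ (ENNReal.ofReal p) u.1 (weakGrad Ω u.1) := by
  obtain ⟨G, h1, h2⟩ := u.2
  have e := (h1.1.weakGrad_ae_eq h.isOpen).symm
  exact ⟨h1.congr_grad e,
    (memLp_congr_ae (ae_restrict_of_ae_restrict_of_subset h.subset₂ e)).1 h2⟩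

theorem exists_mem_spaceW (h : IsSplitting Ω D₁ D₂) (hu : IsW Ω D₂ (ENNReal.ofReal p) u G) :
    ∃ w : spaceW Ω D₂ p, w.1 =ᵐ[volume.restrict Ω] u ∧
      weakGrad Ω w.1 =ᵐ[volume.restrict Ω] G := by
  have e := hu.1.2.coeFn_toLp
  refine ⟨⟨hu.1.2.toLp u, MemW.congr ⟨G, hu.1, hu.2⟩ e.symm⟩, e, ?_⟩
  exact (hu.1.1.congr e.symm).weakGrad_ae_eq h.isOpen

theorem energy_eq (u : spaceW Ω D₂ p) :
    energy D₁ f u = pairEnergy Ω D₁ D₂ p f u.1 (weakGrad Ω u.1) := by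
  unfold energy pairEnergy powInt
  rw [integral_div, integral_div]
  simp only [Real.rpow_two]

theorem weakForm_eq (φ : Rn N → ℝ) :
    weakForm Ω D₁ D₂ p u φ = gradForm D₁ D₂ p (weakGrad Ω u) (∇ φ) := by
  unfold weakForm gradForm flux
  -- On `D₁` the weight is `‖G‖ ^ (2 - 2) = 1`, also where `G = 0`, since `0 ^ 0 = 1` for real
  -- powers.
  simp only [sub_self, Real.rpow_zero, one_mul]

theorem coe_eq_of_gradPow_le (h : IsSplitting Ω D₁ D₂) (hN : 1 ≤ N) (hp : 2 < p)
    {u v : spaceW Ω D₂ p}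
    (h0 : gradPow D₁ D₂ p (fun x => weakGrad Ω u.1 x - weakGrad Ω v.1 x) ≤ 0) : u = v := by
  have hw := (isW_weakGrad h u).sub (isW_weakGrad h v)
  have h1 := hw.1.ae_eq_zero h hN (ae_eq_zero_of_gradPow_le h hp hw h0)
  refine Subtype.ext (Lp.ext ?_)
  filter_upwards [h1] with x hx
  exact sub_eq_zero.1 hx

theorem isWeakSolution_iff (h : IsSplitting Ω D₁ D₂) (hN : 1 ≤ N) (hp : 2 < p)
    (hf : MemLp f 2 (volume.restrict Ω)) (u : spaceW Ω D₂ p) :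
    IsWeakSolution D₁ f u ↔ ∀ v : spaceW Ω D₂ p, energy D₁ f u ≤ energy D₁ f v := by
  have hu := isW_weakGrad h u
  constructor
  · intro hs v
    have h1 := pairEnergy_le_of_solution h hN hp hf hu
      (fun φ hφ => (weakForm_eq φ).symm.trans (hs φ hφ)) (isW_weakGrad h v)
    rw [energy_eq, energy_eq]
    exact (le_add_of_nonneg_right (mul_nonneg (energyConst_pos hp).le gradPow_nonneg)).trans h1
  · intro hmin φ hφ
    have hmin' : ∀ v H, IsW Ω D₂ (ENNReal.ofReal p) v H →
        pairEnergy Ω D₁ D₂ p f u.1 (weakGrad Ω u.1) ≤ pairEnergy Ω D₁ D₂ p f v H :=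
      fun v H hv => by
        obtain ⟨w, hw1, hw2⟩ := exists_mem_spaceW h hv
        have := hmin w
        rwa [energy_eq, energy_eq, pairEnergy_congr h hw1 hw2] at this
    have hφW : IsW Ω D₂ (ENNReal.ofReal p) φ (∇ φ) := hφ.isW _
    have h1 := le_gradForm_of_minimizer h hp hf hu hmin' hφW
    have h2 := le_gradForm_of_minimizer h hp hf hu hmin' (hφW.const_mul (-1))
    rw [gradForm_smul] at h2
    have e : ∫ x in Ω, f x * (-1 * φ x) = -∫ x in Ω, f x * φ x := by
      rw [← integral_neg]; congr 1; ext x; ring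
    rw [e] at h2
    rw [weakForm_eq]
    linarith

theorem existsUnique_isWeakSolution (h : IsSplitting Ω D₁ D₂) (hN : 1 ≤ N) (hp : 2 < p)
    (hf : MemLp f 2 (volume.restrict Ω)) :
    ∃! u : spaceW Ω D₂ p, IsWeakSolution D₁ f u := by
  obtain ⟨u, G, hu, hmin⟩ := exists_minimizer h hN hp hf
  obtain ⟨w, hw1, hw2⟩ := exists_mem_spaceW h hu
  refine ⟨w, (isWeakSolution_iff h hN hp hf w).2 fun v => ?_, fun v hv => ?_⟩
  · rw [energy_eq, energy_eq, pairEnergy_congr h hw1 hw2]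
    exact hmin _ _ (isW_weakGrad h v)
  · refine (coe_eq_of_gradPow_le h hN hp ?_).symm
    have h1 := pairEnergy_le_of_solution h hN hp hf (isW_weakGrad h v)
      (fun φ hφ => (weakForm_eq φ).symm.trans (hv φ hφ)) (isW_weakGrad h w)
    have h2 := hmin _ _ (isW_weakGrad h v)
    rw [← pairEnergy_congr h hw1 hw2] at h2
    by_contra! hlt
    have := mul_pos (energyConst_pos hp) hlt
    linarith

theorem strictConvexOn_energy (h : IsSplitting Ω D₁ D₂) (hN : 1 ≤ N) (hp : 2 < p)
    (hf : MemLp f 2 (volume.restrict Ω)) :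
    StrictConvexOn ℝ univ (energy D₁ f : spaceW Ω D₂ p → ℝ) := by
  refine ⟨convex_univ, fun u _ v _ huv s t hs ht hst => ?_⟩
  have hu := isW_weakGrad h u
  have hv := isW_weakGrad h v
  have hw := (hu.const_mul s).add (hv.const_mul t)
  have e1 : (s • u + t • v : spaceW Ω D₂ p).1 =ᵐ[volume.restrict Ω]
      fun x => s * u.1 x + t * v.1 x := by
    filter_upwards [Lp.coeFn_add (s • u.1) (t • v.1), Lp.coeFn_smul s u.1,
      Lp.coeFn_smul t v.1] with x h1 h2 h3
    simp only [Submodule.coe_add, Submodule.coe_smul, h1, Pi.add_apply, h2, h3, Pi.smul_apply,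
      smul_eq_mul]
  have e2 := (hw.1.1.congr e1.symm).weakGrad_ae_eq h.isOpen
  have hm := pairEnergy_convex_combination h hp hf hu hv hs.le ht.le hst
  rw [energy_eq, energy_eq, energy_eq, pairEnergy_congr h e1 e2, smul_eq_mul, smul_eq_mul]
  refine lt_of_lt_of_le (lt_add_of_pos_right _ (mul_pos (energyConst_pos hp) ?_)) hm
  have n2 : 0 ≤ t * gradPow D₁ D₂ p (fun x => s • (weakGrad Ω v.1 x - weakGrad Ω u.1 x)) :=
    mul_nonneg ht.le gradPow_nonneg
  refine add_pos_of_pos_of_nonneg (mul_pos hs ?_) n2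
  -- If the remainder vanished, the two gradients would agree almost everywhere, and by Poincaré so
  -- would the functions.
  by_contra! hle
  refine huv (coe_eq_of_gradPow_le h hN hp ?_)
  have h0 := ae_eq_zero_of_gradPow_le h hp ((hu.sub hv).const_mul t) hle
  have h1 : (fun x => weakGrad Ω u.1 x - weakGrad Ω v.1 x) =ᵐ[volume.restrict Ω] 0 := by
    filter_upwards [h0] with x hx
    simpa [ht.ne'] using hx
  unfold gradPow
  rw [powInt_congr (ae_restrict_of_ae_restrict_of_subset h.subset₁ h1),
    powInt_congr (ae_restrict_of_ae_restrict_of_subset h.subset₂ h1)]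
  simp [powInt, Real.zero_rpow (by linarith : p ≠ 0)]

theorem tendsto_energy_atTop (h : IsSplitting Ω D₁ D₂) (hN : 1 ≤ N) (hp : 2 < p)
    (hf : MemLp f 2 (volume.restrict Ω)) :
    Tendsto (energy D₁ f : spaceW Ω D₂ p → ℝ)
      (comap (fun u : spaceW Ω D₂ p => normW Ω D₁ D₂ p u.1) atTop) atTop := by
  obtain ⟨C, hC⟩ := exists_gradNorm_le_pairEnergy h hN hp hf
  refine tendsto_atTop_mono (fun u => ?_) (tendsto_atTop_add_const_right _ (-C) tendsto_comap)
  rw [energy_eq, ← sub_eq_add_neg]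
  exact hC _ _ (isW_weakGrad h u)

end Space

end Transmission

end

theorem mainTheorem4 {N : ℕ} (hN : 1 ≤ N) {Ω D₁ D₂ : Set (Transmission.Rn N)}
    (hΩ : Transmission.IsSplitting Ω D₁ D₂) {p : ℝ} (hp : 2 < p)
    {f : Transmission.Rn N → ℝ} (hf : MemLp f 2 (volume.restrict Ω)) :
    -- existence and uniqueness of the weak solution
    (∃! u : Transmission.spaceW Ω D₂ p, Transmission.IsWeakSolution D₁ f u) ∧
    -- the functional is strictly convex and coercive on `𝒲(Ω)`
    StrictConvexOn ℝ Set.univ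
      (Transmission.energy D₁ f : Transmission.spaceW Ω D₂ p → ℝ) ∧
    Tendsto (Transmission.energy D₁ f : Transmission.spaceW Ω D₂ p → ℝ)
      (comap (fun u : Transmission.spaceW Ω D₂ p => Transmission.normW Ω D₁ D₂ p u.1) atTop)
      atTop ∧
    -- the weak solution is its minimizer
    (∀ u : Transmission.spaceW Ω D₂ p, Transmission.IsWeakSolution D₁ f u ↔
      ∀ v : Transmission.spaceW Ω D₂ p,
        Transmission.energy D₁ f u ≤ Transmission.energy D₁ f v) ∧
    -- comparison principle
    (∀ u₁ u₂ : Transmission.spaceW Ω D₂ p, Transmission.IsWeakSubsolution D₁ f u₁ →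
      Transmission.IsWeakSupersolution D₁ f u₂ →
      ∀ᵐ x ∂(volume.restrict Ω), u₁.1 x ≤ u₂.1 x) := by
  refine ⟨Transmission.existsUnique_isWeakSolution hΩ hN hp hf,
    Transmission.strictConvexOn_energy hΩ hN hp hf, Transmission.tendsto_energy_atTop hΩ hN hp hf,
    Transmission.isWeakSolution_iff hΩ hN hp hf, fun u₁ u₂ h₁ h₂ => ?_⟩
  exact Transmission.ae_le_of_sub_super hΩ hN hp hf (Transmission.isW_weakGrad hΩ u₁)
    (Transmission.isW_weakGrad hΩ u₂)
    (fun φ hφ h0 => (Transmission.weakForm_eq φ).symm.trans_le (h₁ φ hφ h0))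
    (fun φ hφ h0 => (h₂ φ hφ h0).trans_eq (Transmission.weakForm_eq φ))
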